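/- Let $M$ be a compact complex manifold of dimension $m$ and $(L,h)\to M$ a positive Hermitian holomorphic line bundle with Kähler form $\omega=-i\,\partial\bar\partial\log h$ and metric $g(X,Y)=\omega(X,JY)$. Let $H:M\to\mathbb R$ be smooth, with Hamiltonian vector field $\xi_H$ defined by $\omega(\xi_H,Y)=dH(Y)$ and gradient $\nabla H=J\xi_H$ (so $g(\nabla H,Y)=dH(Y)$), and assume that $\xi_H$ is a holomorphic vector field, i.e. preserves the complex structure $J$. For $k\ge 1$ give sections of $L^k$ the inner product $\langle s,t\rangle=\int_M h^k(s,t)\,\omega^m/m!$ (conjugate linear in $s$). Let $\Pi_k$ be the orthogonal projection onto the space $H^0(M,L^k)$ of holomorphic sections, and let $\hat H_k=\Pi_k\circ\bigl(H+\tfrac{i}{k}\nabla_{\xi_H}\bigr):H^0(M,L^k)\to H^0(M,L^k)$, where $\nabla$ is the Chern connection of $(L^k,h^k)$. An eigensection with eigenvalue $\mu$ is a nonzero $s\in H^0(M,L^k)$ with $\hat H_k s=\mu s$. Let $z_c$ be a critical point of $H$ and $E=H(z_c)$. For $0\ne\nu\in L^k_{z_c}$ let $\Phi_\nu=\Pi_k(\cdot,z_c)\nu\in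 H^0(M,L^k)$ be the Bergman kernel at $z_c$ contracted with $\nu$, i.e. the holomorphic section with $\langle\Phi_\nu,t\rangle=h^k(\nu,t(z_c))$ for all $t\in H^0(M,L^k)$. Let $s_{k,z_c}=\Phi_\nu/\|\Phi_\nu\|_{L^2}$ (taken to be $0$ if $\Phi_\nu=0$) be the peak section at $z_c$. Put $$W^{\pm}(z_c)=\{z\in M:\ \lim_{t\to\infty}\exp(\mp t\nabla H)z=z_c\}.$$ Then for every $k\ge1$: 1. If some section in $H^0(M,L^k)$ does not vanish at $z_c$, then $\|s_{k,z_c}\|_{L^2}=1$ and $s_{k,z_c}$ is an eigensection of $\hat H_k$ with eigenvalue $E$. Every eigensection of $\hat H_k$ orthogonal to $s_{k,z_c}$ vanishes at $z_c$. 2. Every eigensection of $\hat H_k$ with real eigenvalue $\mu<E$ vanishes on $W^+(z_c)$. 3. Every eigensection of $\hat H_k$ with real eigenvalue $\mu>E$ vanishes on $W^-(z_c)$. -/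

import Mathlib

open Bundle Filter Topology MeasureTheory Complex
open scoped Manifold ContDiff TensorProduct ComplexConjugate

noncomputable section

set_option linter.unusedSectionVars false

namespace KahlerQuant

/-- The model space `ℂᵐ` of an `m`-dimensional complex manifold. -/
abbrev Cm (m : ℕ) : Type := Fin m → ℂ

/-! ### Pointwise complex calculus on `ℂᵐ` -/

/-- The Levi form `∂_u ∂̄_v φ (y) = ∑ φ_{j k̄} u_j (v_k)‾` of a real function, where
`∂_u = (D_u - i D_{iu}) / 2` and `∂̄_v = (D_v + i D_{iv}) / 2` are the Wirtinger derivatives.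
It is complex linear in `u` and conjugate linear in `v`. -/
def levi {m : ℕ} (φ : Cm m → ℝ) (y u v : Cm m) : ℂ :=
  let D : Cm m → Cm m → ℂ := fun a b => ((fderiv ℝ (fderiv ℝ φ) y a b : ℝ) : ℂ)
  (1 / 4) * (D u v + D (I • u) (I • v) + I * (D u (I • v) - D (I • u) v))

/-- The real 2-form `i ∂∂̄ φ` at `y`, that is `i ∑ φ_{j k̄} dz_j ∧ dz̄_k`. -/
def iddbar {m : ℕ} (φ : Cm m → ℝ) (y u v : Cm m) : ℝ :=
  (I * (levi φ y u v - levi φ y v u)).re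

/-- The matrix `φ_{j k̄} = ∂² φ / ∂z_j ∂z̄_k` at `y`. -/
def leviMatrix {m : ℕ} (φ : Cm m → ℝ) (y : Cm m) : Matrix (Fin m) (Fin m) ℂ :=
  Matrix.of fun j k => levi φ y (Pi.single j 1) (Pi.single k 1)

theorem levi_add_left {m : ℕ} (φ : Cm m → ℝ) (y u u' v : Cm m) :
    levi φ y (u + u') v = levi φ y u v + levi φ y u' v := by
  simp only [levi, smul_add, map_add, add_apply, Complex.ofReal_add]
  ring

theorem levi_add_right {m : ℕ} (φ : Cm m → ℝ) (y u v v' : Cm m) :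
    levi φ y u (v + v') = levi φ y u v + levi φ y u v' := by
  simp only [levi, smul_add, map_add, Complex.ofReal_add]
  ring

theorem levi_smul_left {m : ℕ} (φ : Cm m → ℝ) (y u v : Cm m) (c : ℝ) :
    levi φ y (c • u) v = c * levi φ y u v := by
  simp only [levi, smul_comm I c u, map_smul, smul_apply, smul_eq_mul,
    Complex.ofReal_mul]
  ring

theorem levi_smul_right {m : ℕ} (φ : Cm m → ℝ) (y u v : Cm m) (c : ℝ) :
    levi φ y u (c • v) = c * levi φ y u v := by
  simp only [levi, smul_comm I c v, map_smul, smul_eq_mul, Complex.ofReal_mul]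
  ring

theorem levi_I_left {m : ℕ} (φ : Cm m → ℝ) (y u v : Cm m) :
    levi φ y (I • u) v = I * levi φ y u v := by
  have h : I • I • u = -u := by rw [smul_smul, I_mul_I, neg_one_smul]
  simp only [levi, h, map_neg, neg_apply, Complex.ofReal_neg]
  linear_combination (1 / 4 : ℂ) * ((fderiv ℝ (fderiv ℝ φ) y (I • u) v : ℝ)
    - (fderiv ℝ (fderiv ℝ φ) y u (I • v) : ℝ)) * I_sq

theorem levi_I_right {m : ℕ} (φ : Cm m → ℝ) (y u v : Cm m) :
    levi φ y u (I • v) = -I * levi φ y u v := by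
  have h : I • I • v = -v := by rw [smul_smul, I_mul_I, neg_one_smul]
  simp only [levi, h, map_neg, Complex.ofReal_neg]
  linear_combination (1 / 4 : ℂ) * ((fderiv ℝ (fderiv ℝ φ) y u (I • v) : ℝ)
    - (fderiv ℝ (fderiv ℝ φ) y (I • u) v : ℝ)) * I_sq

/-- The form `i ∂∂̄ φ` at `y`, as a real bilinear map. -/
def iddbarBilin {m : ℕ} (φ : Cm m → ℝ) (y : Cm m) : Cm m →ₗ[ℝ] Cm m →ₗ[ℝ] ℝ :=
  LinearMap.mk₂ ℝ (iddbar φ y)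
    (fun u u' v => by
      simp only [iddbar, levi_add_left, levi_add_right, ← Complex.add_re]; congr 1; ring)
    (fun c u v => by
      simp only [iddbar, levi_smul_left, levi_smul_right, smul_eq_mul, ← Complex.re_ofReal_mul]
      congr 1; ring)
    (fun u v v' => by
      simp only [iddbar, levi_add_left, levi_add_right, ← Complex.add_re]; congr 1; ring)
    (fun c u v => by
      simp only [iddbar, levi_smul_left, levi_smul_right, smul_eq_mul, ← Complex.re_ofReal_mul]
      congr 1; ring)

theorem iddbar_I_left {m : ℕ} (φ : Cm m → ℝ) (y u v : Cm m) :
    iddbar φ y (I • u) (I • v) = iddbar φ y u v := by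
  simp only [iddbar, levi_I_left, levi_I_right]
  congr 1
  linear_combination (-I * levi φ y u v + I * levi φ y v u) * I_sq

section Bundle

variable {m : ℕ} {M : Type*} [TopologicalSpace M] [ChartedSpace (Cm m) M]

/-! ### A holomorphic line bundle `L`, its powers and their sections -/

section Line

variable (m) (L : M → Type*) [∀ x, AddCommGroup (L x)] [∀ x, Module ℂ (L x)]
  [∀ x, TopologicalSpace (L x)] [TopologicalSpace (TotalSpace ℂ L)] [FiberBundle ℂ L]
  [VectorBundle ℂ ℂ L]

/-- The domain of the preferred local trivialization of `L` around `x₀`. -/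
def frameSet (x₀ : M) : Set M := (trivializationAt ℂ L x₀).baseSet

/-- The local holomorphic frame `e` of `L` on `frameSet L x₀` given by the preferred local
trivialization around `x₀`. -/
def frame (x₀ x : M) : L x := (trivializationAt ℂ L x₀).symm x 1

/-- The `k`-th tensor power `v ⊗ ⋯ ⊗ v`. -/
def tpow {V : Type*} [AddCommGroup V] [Module ℂ V] (k : ℕ) (v : V) : ⨂[ℂ]^k V :=
  PiTensorProduct.tprod ℂ fun _ => v

/-- A set-theoretic section of `L^k = L^{⊗k}`. -/
abbrev PowSection (k : ℕ) : Type _ := (x : M) → ⨂[ℂ]^k (L x)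

/-- The coefficient on `frameSet L x₀` of an element of `L_x^k` with respect to `e^k`, where `e` is
the frame around `x₀`; this is the trivialization of `L^k` induced by the one of `L`. -/
def powCoeff (k : ℕ) (x₀ x : M) : ⨂[ℂ]^k (L x) →ₗ[ℂ] ℂ :=
  PiTensorProduct.lift ((MultilinearMap.mkPiAlgebra ℂ (Fin k) ℂ).compLinearMap
    fun _ => (trivializationAt ℂ L x₀).linearMapAt ℂ x)

/-- The coefficient function `f` of `s = f e^k` with respect to the frame `e` around `x₀`. -/
def localRep {k : ℕ} (s : PowSection L k) (x₀ x : M) : ℂ := powCoeff L k x₀ x (s x)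

/-- `H⁰(M, L^k)`: the sections whose coefficient functions are holomorphic (that is, smooth over
the field `ℂ`). -/
def holSections (k : ℕ) : Submodule ℂ (PowSection L k) where
  carrier := {s | ∀ x₀ : M, ContMDiffOn 𝓘(ℂ, Cm m) 𝓘(ℂ, ℂ) ∞ (localRep L s x₀) (frameSet L x₀)}
  add_mem' := fun {s t} hs ht x₀ => by
    have h : localRep L (s + t) x₀ = localRep L s x₀ + localRep L t x₀ := by
      funext x; simp [localRep]
    rw [h]; exact (hs x₀).add (ht x₀)
  zero_mem' := fun x₀ => by
    have h : localRep L (0 : PowSection L k) x₀ = fun _ => 0 := by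
      funext x; simp [localRep]
    rw [h]; exact contMDiffOn_const
  smul_mem' := fun c s hs x₀ => by
    have h : localRep L (c • s) x₀ = c • localRep L s x₀ := by
      funext x; simp [localRep]
    rw [h]; exact (ContinuousLinearMap.contMDiff (n := ∞) (c • ContinuousLinearMap.id ℂ ℂ)).comp_contMDiffOn (hs x₀)

/-- A smooth Hermitian metric on the holomorphic line bundle `L`, conjugate linear in the first
variable. -/
structure HermitianMetric where
  form : ∀ x : M, L x →ₗ⋆[ℂ] L x →ₗ[ℂ] ℂ
  conj_symm : ∀ x v w, conj (form x v w) = form x w v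
  pos : ∀ x v, v ≠ 0 → 0 < (form x v v).re
  smooth : ∀ x₀ : M, ContMDiffOn 𝓘(ℝ, Cm m) 𝓘(ℝ, ℝ) ∞
    (fun x => (form x (frame L x₀ x) (frame L x₀ x)).re) (frameSet L x₀)

end Line

/-! ### The Kähler form, the Hamiltonian vector field and the gradient -/

/-- The complex structure `J` on the real tangent space. -/
def J (x : M) (u : TangentSpace 𝓘(ℝ, Cm m) x) : TangentSpace 𝓘(ℝ, Cm m) x :=
  let u' : Cm m := u
  (I • u' : Cm m)

variable {L : M → Type*} [∀ x, AddCommGroup (L x)] [∀ x, Module ℂ (L x)]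
  [∀ x, TopologicalSpace (L x)] [TopologicalSpace (TotalSpace ℂ L)] [FiberBundle ℂ L]
  [VectorBundle ℂ ℂ L] (h : HermitianMetric m L)

/-- The local weight `φ = -log h(e, e)` of the metric, `e` the frame around `x₀`. -/
def weight (x₀ x : M) : ℝ := -Real.log (h.form x (frame L x₀ x) (frame L x₀ x)).re

/-- The form `ω = -i ∂∂̄ log h = i ∂∂̄ φ` on `T_x M`, computed in the preferred chart at `x`, which
is the one that identifies `T_x M` with `ℂᵐ`. -/
def kahlerForm (x : M) : TangentSpace 𝓘(ℝ, Cm m) x →ₗ[ℝ] TangentSpace 𝓘(ℝ, Cm m) x →ₗ[ℝ] ℝ :=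
  iddbarBilin (weight h x ∘ (chartAt (Cm m) x).symm) (chartAt (Cm m) x x)

/-- The Riemannian metric `g(X, Y) = ω(X, J Y)`. -/
def kahlerMetric (x : M) (u v : TangentSpace 𝓘(ℝ, Cm m) x) : ℝ := kahlerForm h x u (J x v)

/-- The Hermitian line bundle is positive: `ω` is a Kähler form. -/
def IsPositive : Prop :=
  ∀ (x : M) (u : TangentSpace 𝓘(ℝ, Cm m) x), u ≠ 0 → 0 < kahlerMetric h x u u

/-- The Hamiltonian vector field `ξ_H`: `ω(ξ_H, Y) = dH(Y)` for all `Y`. -/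
def hamVF (H : M → ℝ) (x : M) : TangentSpace 𝓘(ℝ, Cm m) x :=
  Classical.epsilon fun u : TangentSpace 𝓘(ℝ, Cm m) x =>
    ∀ Y : TangentSpace 𝓘(ℝ, Cm m) x, kahlerForm h x u Y = mfderiv 𝓘(ℝ, Cm m) 𝓘(ℝ, ℝ) H x Y

/-- The gradient `∇H = J ξ_H` with respect to `g`. -/
def gradVF (H : M → ℝ) (x : M) : TangentSpace 𝓘(ℝ, Cm m) x := J x (hamVF h H x)

theorem hamVF_spec (hpos : IsPositive h) (H : M → ℝ) (x : M) (Y : TangentSpace 𝓘(ℝ, Cm m) x) :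
    kahlerForm h x (hamVF h H x) Y = mfderiv 𝓘(ℝ, Cm m) 𝓘(ℝ, ℝ) H x Y := by
  have hinj : Function.Injective (kahlerForm h x) := by
    rw [← LinearMap.ker_eq_bot, LinearMap.ker_eq_bot']
    intro u hu
    by_contra hne
    have := hpos x u hne
    rw [kahlerMetric, hu] at this
    exact lt_irrefl _ this
  have : FiniteDimensional ℝ (TangentSpace 𝓘(ℝ, Cm m) x) :=
    inferInstanceAs (FiniteDimensional ℝ (Cm m))
  have hsurj : Function.Surjective (kahlerForm h x) :=
    (LinearMap.injective_iff_surjective_of_finrank_eq_finrank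
      (Subspace.dual_finrank_eq (K := ℝ) (V := TangentSpace 𝓘(ℝ, Cm m) x)).symm).1 hinj
  let dH : TangentSpace 𝓘(ℝ, Cm m) x →ₗ[ℝ] ℝ :=
    (mfderiv 𝓘(ℝ, Cm m) 𝓘(ℝ, ℝ) H x).toLinearMap
  obtain ⟨u, hu⟩ := hsurj dH
  have hex : ∃ u : TangentSpace 𝓘(ℝ, Cm m) x, ∀ Y : TangentSpace 𝓘(ℝ, Cm m) x,
      kahlerForm h x u Y = mfderiv 𝓘(ℝ, Cm m) 𝓘(ℝ, ℝ) H x Y :=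
    ⟨u, fun Y => by rw [hu]; rfl⟩
  exact Classical.epsilon_spec hex Y

theorem gradVF_spec (hpos : IsPositive h) (H : M → ℝ) (x : M) (Y : TangentSpace 𝓘(ℝ, Cm m) x) :
    kahlerMetric h x (gradVF h H x) Y = mfderiv 𝓘(ℝ, Cm m) 𝓘(ℝ, ℝ) H x Y := by
  rw [← hamVF_spec h hpos H x Y]
  exact iddbar_I_left _ _ _ _

/-- `ξ_H` preserves the complex structure: it is a holomorphic vector field, that is, a holomorphic
section of the tangent bundle of the complex manifold `M`. -/
def IsHolomorphicHamiltonian [IsManifold 𝓘(ℂ, Cm m) ω M] (H : M → ℝ) : Prop :=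
  haveI : IsManifold 𝓘(ℂ, Cm m) 1 M := IsManifold.of_le (n := ω) le_top
  MDifferentiable 𝓘(ℂ, Cm m) 𝓘(ℂ, Cm m).tangent
    (fun x : M => (⟨x, (hamVF h H x : Cm m)⟩ : TangentBundle 𝓘(ℂ, Cm m) M))

/-- `W⁺(z_c)`: the points `z` with `exp(-t ∇H) z → z_c` as `t → ∞`. -/
def stablePlus (H : M → ℝ) (z_c : M) : Set M :=
  {z | ∃ γ : ℝ → M, IsMIntegralCurve γ (fun x => gradVF h H x) ∧ γ 0 = z ∧
    Tendsto (fun t => γ (-t)) atTop (𝓝 z_c)}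

/-- `W⁻(z_c)`: the points `z` with `exp(t ∇H) z → z_c` as `t → ∞`. -/
def stableMinus (H : M → ℝ) (z_c : M) : Set M :=
  {z | ∃ γ : ℝ → M, IsMIntegralCurve γ (fun x => gradVF h H x) ∧ γ 0 = z ∧
    Tendsto γ atTop (𝓝 z_c)}

/-! ### The metric `h^k`, the Chern connection of `L^k` and the volume -/

/-- The Hermitian metric `h^k` on `L_x^k`: `h^k(a e^k, b e^k) = ā b h(e, e)^k`. -/
def powMetric (k : ℕ) (x : M) (s t : ⨂[ℂ]^k (L x)) : ℂ :=
  conj (powCoeff L k x x s) * powCoeff L k x x t * h.form x (frame L x x) (frame L x x) ^ k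

theorem smul_frame (x : M) (v : L x) :
    (trivializationAt ℂ L x).linearMapAt ℂ x v • frame L x x = v := by
  have hx : x ∈ (trivializationAt ℂ L x).baseSet := FiberBundle.mem_baseSet_trivializationAt' x
  rw [frame, ← Trivialization.symmₗ_apply (R := ℂ) _ hx, ← map_smul, smul_eq_mul, mul_one]
  exact (trivializationAt ℂ L x).symmₗ_linearMapAt hx v

theorem powMetric_tprod (k : ℕ) (x : M) (v w : Fin k → L x) :
    powMetric h k x (PiTensorProduct.tprod ℂ v) (PiTensorProduct.tprod ℂ w) =
      ∏ i, h.form x (v i) (w i) := by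
  have key : ∀ i, h.form x (v i) (w i) =
      conj ((trivializationAt ℂ L x).linearMapAt ℂ x (v i)) *
        (trivializationAt ℂ L x).linearMapAt ℂ x (w i) *
        h.form x (frame L x x) (frame L x x) := by
    intro i
    conv_lhs => rw [← smul_frame x (v i), ← smul_frame x (w i)]
    simp only [LinearMap.map_smulₛₗ, map_smul, LinearMap.smul_apply, smul_eq_mul]
    ring
  simp only [powMetric, powCoeff, PiTensorProduct.lift.tprod,
    MultilinearMap.compLinearMap_apply, MultilinearMap.mkPiAlgebra_apply, map_prod, key,
    Finset.prod_mul_distrib, Finset.prod_const, Finset.card_univ, Fintype.card_fin]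

/-- The Chern covariant derivative `∇_u s` of a section of `L^k`: if `s = f e^k` then
`∇ s = (df - k f ∂φ) e^k`, where `∂φ(u) = (dφ(u) - i dφ(Ju)) / 2`. -/
def chernDeriv {k : ℕ} (s : PowSection L k) (x : M) (u : TangentSpace 𝓘(ℝ, Cm m) x) :
    ⨂[ℂ]^k (L x) :=
  let df : ℂ := mfderiv 𝓘(ℝ, Cm m) 𝓘(ℝ, ℂ) (localRep L s x) x u
  let dφ : TangentSpace 𝓘(ℝ, Cm m) x → ℝ := fun w =>
    mfderiv 𝓘(ℝ, Cm m) 𝓘(ℝ, ℝ) (weight h x) x w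
  let delφ : ℂ := (1 / 2) * ((dφ u : ℂ) - I * (dφ (J x u) : ℂ))
  (df - k * localRep L s x x * delφ) • tpow k (frame L x x)

/-- The density of `ω^m / m!` with respect to Lebesgue measure on `ℂᵐ`, in the chart `chartAt p` at
the coordinate `y`: it is `2^m det (φ_{j k̄})`. -/
def volumeDensity (p : M) (y : Cm m) : ℝ :=
  let c := chartAt (Cm m) p
  2 ^ m * (leviMatrix (weight h (c.symm y) ∘ c.symm) y).det.re

theorem exists_finite_chart_cover [CompactSpace M] :
    ∃ (n : ℕ) (p : Fin n → M), ⋃ i, (chartAt (Cm m) (p i)).source = Set.univ := by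
  obtain ⟨t, ht⟩ := CompactSpace.elim_nhds_subcover (fun x : M => (chartAt (Cm m) x).source)
    (fun x => chart_source_mem_nhds (Cm m) x)
  refine ⟨t.card, fun i => (t.equivFin.symm i : M), ?_⟩
  rw [Set.eq_univ_iff_forall]
  intro x
  have hx : x ∈ ⋃ y ∈ t, (chartAt (Cm m) y).source := by rw [ht]; trivial
  obtain ⟨y, hy, hxy⟩ := Set.mem_iUnion₂.1 hx
  exact Set.mem_iUnion.2 ⟨t.equivFin ⟨y, hy⟩, by simpa using hxy⟩

/-- The Kähler volume measure `ω^m / m!` on the compact manifold `M`: `M` is cut into finitely many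
disjoint pieces, each inside a chart, and on each piece the measure has the density
`volumeDensity`. -/
def kahlerVolume [CompactSpace M] [MeasurableSpace M] : Measure M :=
  let n := (exists_finite_chart_cover (m := m) (M := M)).choose
  let p : Fin n → M := (exists_finite_chart_cover (m := m) (M := M)).choose_spec.choose
  let A : Fin n → Set M := fun i =>
    (chartAt (Cm m) (p i)).source \ ⋃ j, ⋃ _ : j < i, (chartAt (Cm m) (p j)).source
  ∑ i, Measure.map (chartAt (Cm m) (p i)).symm
    ((volume.restrict ((chartAt (Cm m) (p i)).target ∩ (chartAt (Cm m) (p i)).symm ⁻¹' A i)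
      ).withDensity fun y => ENNReal.ofReal (volumeDensity h (p i) y))

/-! ### Toeplitz quantization and peak sections -/

variable [CompactSpace M] [MeasurableSpace M]

/-- The `L²` inner product of sections of `L^k`, conjugate linear in the first variable. -/
def l2 {k : ℕ} (s t : PowSection L k) : ℂ :=
  ∫ x, powMetric h k x (s x) (t x) ∂(kahlerVolume h)

open Classical in
/-- The Bergman projection `Π_k`, the orthogonal projection onto `H⁰(M, L^k)`: `Π_k σ` is the
holomorphic section with `⟨t, Π_k σ⟩ = ⟨t, σ⟩` for all holomorphic `t`. -/
def bergmanProj {k : ℕ} (σ : PowSection L k) : PowSection L k :=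
  if hσ : ∃ p ∈ holSections m L k, ∀ t ∈ holSections m L k, l2 h t p = l2 h t σ then hσ.choose else 0

/-- The Toeplitz quantization `Ĥ_k = Π_k ∘ (H + (i/k) ∇_{ξ_H})` of `H`, acting on
`H⁰(M, L^k)`. -/
def toeplitz (H : M → ℝ) {k : ℕ} (s : PowSection L k) : PowSection L k :=
  bergmanProj h fun x => (H x : ℂ) • s x + (I / k) • chernDeriv h s x (hamVF h H x)

/-- `s` is an eigensection of `Ĥ_k` on `H⁰(M, L^k)` with eigenvalue `μ`. -/
def IsEigensection (H : M → ℝ) {k : ℕ} (s : PowSection L k) (μ : ℂ) : Prop :=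
  s ∈ holSections m L k ∧ s ≠ 0 ∧ toeplitz h H s = μ • s

open Classical in
/-- The Bergman kernel `Π_k(·, w)` contracted with `ν ∈ L_w^k`, the section
`z ↦ ∑_j s_j(z) h^k(s_j(w), ν)` for an orthonormal basis `(s_j)` of `H⁰(M, L^k)`. It is the
holomorphic section `Φ` with the reproducing property `⟨Φ, t⟩ = h^k(ν, t(w))` for all holomorphic
`t`. -/
def bergmanKernel {k : ℕ} (w : M) (ν : ⨂[ℂ]^k (L w)) : PowSection L k :=
  if hν : ∃ Φ ∈ holSections m L k, ∀ t ∈ holSections m L k, l2 h Φ t = powMetric h k w ν (t w)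
  then hν.choose else 0

/-- The peak section at `w`: `C(w) Π_k(·, w) ν` with the constant `C(w)` that makes it
`L²`-normalized. -/
def peakSection {k : ℕ} (w : M) (ν : ⨂[ℂ]^k (L w)) : PowSection L k :=
  (((Real.sqrt (l2 h (bergmanKernel h w ν) (bergmanKernel h w ν)).re)⁻¹ : ℝ) : ℂ) •
    bergmanKernel h w ν

end Bundle

end KahlerQuant

end

set_option linter.unusedSectionVars false

/-! Let Q = H + (i/k)∇_ξ with ξ = ξ_H. The crucial point is that Q already maps holomorphic sections
to holomorphic sections. In a frame e with weight φ, Q sends f e^k to (K f + (i/k) df(ξ)) e^k with K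
= H - i ∂φ(ξ). Since ξ is holomorphic, ∂̄(∂φ(ξ)) is the contraction of ξ with the Levi form, and the
Hamiltonian equation says that i times this contraction is ∂̄H; hence ∂̄K = 0
(`IsLocalHamiltonian.contDiffOn_moment`, `prequantum_mem`). So the projection does nothing and the
Toeplitz operator is Q itself (`toeplitz_eq`).

Eigenvalue E. At the critical point ξ vanishes, so (Qt)(z_c) = E t(z_c) for all holomorphic t
(`prequantum_critical`). Moreover Q is symmetric (`l2_prequantum`): the Chern connection is metric,
so ⟨s, Qt⟩ - ⟨Qs, t⟩ is (i/k) times the integral of the derivative of h^k(s, t) along ξ. That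
integral is zero because ξ preserves ω, hence is divergence free for the Kähler volume
(`integral_hamDeriv`). Therefore ⟨QΦ, t⟩ = ⟨Φ, Qt⟩ = h^k(ν, E t(z_c)) = E⟨Φ, t⟩ for every t, and QΦ
= EΦ. The statement about orthogonal eigensections is the reproducing property alone.

Vanishing on W^±. If Qs = μs with μ ≠ E, evaluation at z_c gives s(z_c) = 0. For holomorphic s the
connection is complex linear in the direction, so ∇_{∇H}s = i∇_ξ s = k(μ - H)s, and |s|² solves v' =
2k(μ - H)v along the gradient flow (`hasDerivAt_powMetric_gradient`). On a trajectory converging to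
z_c, followed in the appropriate time direction, the coefficient is eventually nonnegative while v
tends to |s(z_c)|² = 0. A nonnegative nondecreasing function with limit 0 is 0, and a linear
equation carries the zero back to the starting point (`eq_zero_of_tendsto_zero`).

Two analytic foundations are also proved. The measure defined by cutting M into chart pieces is
shown to have the expected density in every chart (`kahlerVolume_apply`), which makes the divergence
theorem accessible through a partition of unity. The space of holomorphic sections is finite
dimensional, by the Schwarz lemma and compactness (`exists_nhds_powMetric_le`), so the Bergman
kernel exists by Riesz. -/

namespace KahlerQuant

/-! ### Real and complex derivatives on normed spaces -/

section Calculus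

variable {E F G : Type*} [NormedAddCommGroup E] [NormedSpace ℂ E] [NormedAddCommGroup F]
  [NormedSpace ℂ F] [NormedAddCommGroup G] [NormedSpace ℝ G]

/-- The Cauchy–Riemann criterion: a real differentiable function whose derivative commutes with
multiplication by `i` is complex differentiable. -/
theorem differentiableAt_complex_of_fderiv_I {f : E → F} {y : E} (hf : DifferentiableAt ℝ f y)
    (hI : ∀ v, fderiv ℝ f y (I • v) = I • fderiv ℝ f y v) : DifferentiableAt ℂ f y := by
  rw [differentiableAt_iff_restrictScalars ℝ hf]
  refine ⟨⟨⟨(fderiv ℝ f y).toLinearMap.toAddHom, fun c v => ?_⟩, (fderiv ℝ f y).cont⟩, ?_⟩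
  · change fderiv ℝ f y (c • v) = c • fderiv ℝ f y v
    have hc : c • v = c.re • v + c.im • (I • v) := by
      conv_lhs => rw [← Complex.re_add_im c]
      rw [add_smul, mul_smul, Complex.coe_smul, Complex.coe_smul]
    have hc' : c • fderiv ℝ f y v = c.re • fderiv ℝ f y v + c.im • (I • fderiv ℝ f y v) := by
      conv_lhs => rw [← Complex.re_add_im c]
      rw [add_smul, mul_smul, Complex.coe_smul, Complex.coe_smul]
    rw [hc, hc', map_add, map_smul, map_smul, hI]
  · ext v; rfl

theorem fderiv_real_eq {f : E → F} {y : E} (hf : DifferentiableAt ℂ f y) (v : E) :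
    fderiv ℝ f y v = fderiv ℂ f y v := by
  rw [hf.fderiv_restrictScalars ℝ]; rfl

theorem fderiv_real_I {f : E → F} {y : E} (hf : DifferentiableAt ℂ f y) (v : E) :
    fderiv ℝ f y (I • v) = I • fderiv ℝ f y v := by
  rw [fderiv_real_eq hf, fderiv_real_eq hf, map_smul]

/-- The second derivative applied to constant vectors. -/
theorem fderiv_fderiv_apply {f : E → G} {y : E} (hf : ContDiffAt ℝ 2 f y) (u v : E) :
    fderiv ℝ (fun z => fderiv ℝ f z v) y u = fderiv ℝ (fderiv ℝ f) y u v := by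
  have h1 : DifferentiableAt ℝ (fderiv ℝ f) y :=
    (hf.fderiv_right (m := 1) (by norm_num)).differentiableAt (by norm_num)
  rw [fderiv_clm_apply h1 (differentiableAt_const v)]
  simp

theorem fderiv_fderiv_comm {f : E → G} {y : E} (hf : ContDiffAt ℝ 2 f y) (u v : E) :
    fderiv ℝ (fderiv ℝ f) y u v = fderiv ℝ (fderiv ℝ f) y v u :=
  (hf.isSymmSndFDerivAt (by simp)).eq u v

/-- Differentiate the Cauchy–Riemann equation, which holds on the whole open set. -/
theorem fderiv_fderiv_I {f : E → F} {U : Set E} (hU : IsOpen U) (hf : ContDiffOn ℝ 2 f U)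
    (hd : DifferentiableOn ℂ f U) {y : E} (hy : y ∈ U) (u v : E) :
    fderiv ℝ (fderiv ℝ f) y u (I • v) = I • fderiv ℝ (fderiv ℝ f) y u v := by
  have hfy := hf.contDiffAt (hU.mem_nhds hy)
  rw [← fderiv_fderiv_apply hfy, ← fderiv_fderiv_apply hfy]
  have he : (fun z => fderiv ℝ f z (I • v)) =ᶠ[𝓝 y] fun z => I • fderiv ℝ f z v := by
    filter_upwards [hU.mem_nhds hy] with z hz
    exact fderiv_real_I (hd.differentiableAt (hU.mem_nhds hz)) v
  have h1 : DifferentiableAt ℝ (fderiv ℝ f) y :=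
    (hfy.fderiv_right (m := 1) (by norm_num)).differentiableAt (by norm_num)
  rw [he.fderiv_eq, fderiv_fun_const_smul (h1.clm_apply (differentiableAt_const v))]
  rfl

/-- A real smooth function that is complex differentiable is complex smooth. -/
theorem contDiffOn_complex [FiniteDimensional ℂ E] {f : E → F} {U : Set E} (hU : IsOpen U)
    (hf : ContDiffOn ℝ ∞ f U) (hd : DifferentiableOn ℂ f U) : ContDiffOn ℂ ∞ f U := by
  rw [contDiffOn_infty]
  intro n
  induction n generalizing f with
  | zero => exact contDiffOn_zero.2 hd.continuousOn
  | succ n ih =>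
    push_cast
    rw [contDiffOn_succ_iff_fderiv_of_isOpen hU]
    refine ⟨hd, fun h => absurd h (by simp), ?_⟩
    rw [contDiffOn_clm_apply]
    intro v
    have hr : ContDiffOn ℝ ∞ (fun z => fderiv ℝ f z v) U :=
      (hf.fderiv_of_isOpen hU (m := ∞) (by simp)).clm_apply contDiffOn_const
    have he : ∀ z ∈ U, fderiv ℂ f z v = fderiv ℝ f z v := fun z hz =>
      (fderiv_real_eq (hd.differentiableAt (hU.mem_nhds hz)) v).symm
    refine ContDiffOn.congr (ih hr ?_) he
    intro z hz
    refine (differentiableAt_complex_of_fderiv_I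
      ((hr.contDiffAt (hU.mem_nhds hz)).differentiableAt (by simp)) fun w => ?_).differentiableWithinAt
    have hf2 : ContDiffOn ℝ 2 f U := hf.of_le ENat.LEInfty.out
    have hfz := hf2.contDiffAt (hU.mem_nhds hz)
    -- Symmetry of the second derivative moves `I` from the differentiation slot to the slot in
    -- which the Cauchy–Riemann equation of `f` applies. Thus each directional derivative again
    -- satisfies Cauchy–Riemann, and the induction continues.
    rw [fderiv_fderiv_apply hfz, fderiv_fderiv_apply hfz, fderiv_fderiv_comm hfz,
      fderiv_fderiv_I hU hf2 hd hz, fderiv_fderiv_comm hfz]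

/-- The second derivative of a composition. -/
theorem fderiv_fderiv_comp {φ : F → G} {ψ : E → F} {y : E} (hφ : ContDiffAt ℝ 2 φ (ψ y))
    (hψ : ContDiffAt ℝ 2 ψ y) (u v : E) :
    fderiv ℝ (fderiv ℝ (φ ∘ ψ)) y u v =
      fderiv ℝ (fderiv ℝ φ) (ψ y) (fderiv ℝ ψ y u) (fderiv ℝ ψ y v) +
        fderiv ℝ φ (ψ y) (fderiv ℝ (fderiv ℝ ψ) y u v) := by
  have h2 : ContDiffAt ℝ 2 (φ ∘ ψ) y := hφ.comp y hψ
  have hd : DifferentiableAt ℝ (fderiv ℝ φ) (ψ y) :=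
    (hφ.fderiv_right (m := 1) (by norm_num)).differentiableAt (by norm_num)
  have hd' : DifferentiableAt ℝ (fderiv ℝ ψ) y :=
    (hψ.fderiv_right (m := 1) (by norm_num)).differentiableAt (by norm_num)
  have hψd : DifferentiableAt ℝ ψ y := hψ.differentiableAt (by norm_num)
  rw [← fderiv_fderiv_apply h2]
  have he : (fun z => fderiv ℝ (φ ∘ ψ) z v) =ᶠ[𝓝 y]
      fun z => fderiv ℝ φ (ψ z) (fderiv ℝ ψ z v) := by
    have h1 : ∀ᶠ z in 𝓝 y, ContDiffAt ℝ 2 ψ z := hψ.eventually (by simp)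
    have h3 : ∀ᶠ z in 𝓝 y, ContDiffAt ℝ 2 φ (ψ z) :=
      hψ.continuousAt.eventually (hφ.eventually (by simp))
    filter_upwards [h1, h3] with z hz hz'
    rw [fderiv_comp z (hz'.differentiableAt (by norm_num)) (hz.differentiableAt (by norm_num))]
    rfl
  rw [he.fderiv_eq, fderiv_clm_apply (c := fun z => fderiv ℝ φ (ψ z)) (hd.comp y hψd)
    (hd'.clm_apply (differentiableAt_const v))]
  have h4 : fderiv ℝ (fun z => fderiv ℝ φ (ψ z)) y = (fderiv ℝ (fderiv ℝ φ) (ψ y)).comp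
    (fderiv ℝ ψ y) := fderiv_comp y hd hψd
  rw [h4]
  have h5 := fderiv_fderiv_apply hψ u v
  simp only [add_apply, ContinuousLinearMap.comp_apply, ContinuousLinearMap.flip_apply, h5]
  rw [add_comm]

end Calculus

/-! ### The Levi form: holomorphic invariance and pluriharmonic functions -/

section Levi

variable {m n : ℕ} {φ φ' : Cm m → ℝ} {y : Cm m}

theorem levi_congr (h : φ =ᶠ[𝓝 y] φ') (u v : Cm m) : levi φ y u v = levi φ' y u v := by
  have : fderiv ℝ (fderiv ℝ φ) y = fderiv ℝ (fderiv ℝ φ') y := h.fderiv.fderiv_eq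
  simp only [levi, this]

theorem levi_sub (hφ : ContDiffAt ℝ 2 φ y) (hφ' : ContDiffAt ℝ 2 φ' y) (u v : Cm m) :
    levi (fun z => φ z - φ' z) y u v = levi φ y u v - levi φ' y u v := by
  have he : fderiv ℝ (fun z => φ z - φ' z) =ᶠ[𝓝 y] fun z => fderiv ℝ φ z - fderiv ℝ φ' z := by
    filter_upwards [hφ.eventually (by simp), hφ'.eventually (by simp)] with z h1 h2
    exact fderiv_fun_sub (h1.differentiableAt (by norm_num)) (h2.differentiableAt (by norm_num))
  have hd : DifferentiableAt ℝ (fderiv ℝ φ) y :=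
    (hφ.fderiv_right (m := 1) (by norm_num)).differentiableAt (by norm_num)
  have hd' : DifferentiableAt ℝ (fderiv ℝ φ') y :=
    (hφ'.fderiv_right (m := 1) (by norm_num)).differentiableAt (by norm_num)
  have h2 : fderiv ℝ (fderiv ℝ (fun z => φ z - φ' z)) y =
      fderiv ℝ (fderiv ℝ φ) y - fderiv ℝ (fderiv ℝ φ') y := by
    rw [he.fderiv_eq, fderiv_fun_sub hd hd']
  simp only [levi, h2, sub_apply, Complex.ofReal_sub]
  ring

/-- Hermitian symmetry of the Levi form. -/
theorem levi_conj (hφ : ContDiffAt ℝ 2 φ y) (u v : Cm m) : conj (levi φ y u v) = levi φ y v u := by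
  simp only [levi, map_mul, map_add, map_sub, Complex.conj_ofReal, Complex.conj_I]
  rw [fderiv_fderiv_comm hφ v u, fderiv_fderiv_comm hφ (I • v) (I • u),
    fderiv_fderiv_comm hφ v (I • u), fderiv_fderiv_comm hφ (I • v) u]
  simp only [map_div₀, map_one, map_ofNat]
  ring

/-- The Levi form transforms as a tensor under holomorphic maps. -/
theorem levi_comp {ψ : Cm n → Cm m} {y : Cm n} {U : Set (Cm n)} (hU : IsOpen U)
    (hψ : ContDiffOn ℂ 2 ψ U) (hy : y ∈ U) (hφ : ContDiffAt ℝ 2 φ (ψ y)) (u v : Cm n) :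
    levi (φ ∘ ψ) y u v = levi φ (ψ y) (fderiv ℝ ψ y u) (fderiv ℝ ψ y v) := by
  have hd : DifferentiableOn ℂ ψ U := hψ.differentiableOn (by norm_num)
  have hψr : ContDiffOn ℝ 2 ψ U := hψ.restrict_scalars ℝ
  have hψy := hψr.contDiffAt (hU.mem_nhds hy)
  have hI : ∀ w, fderiv ℝ ψ y (I • w) = I • fderiv ℝ ψ y w :=
    fderiv_real_I (hd.differentiableAt (hU.mem_nhds hy))
  -- The second derivative of a holomorphic map is complex bilinear. Its contribution `fderiv φ
  -- (D²ψ(u, v))` to the Hessian of the composition therefore cancels in the Levi combination, and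
  -- only the tensorial term survives.
  have hI2 : ∀ a b, fderiv ℝ (fderiv ℝ ψ) y a (I • b) = I • fderiv ℝ (fderiv ℝ ψ) y a b :=
    fderiv_fderiv_I hU hψr hd hy
  have hI1 : ∀ a b, fderiv ℝ (fderiv ℝ ψ) y (I • a) b = I • fderiv ℝ (fderiv ℝ ψ) y a b := by
    intro a b
    rw [fderiv_fderiv_comm hψy, hI2, fderiv_fderiv_comm hψy]
  have hII : ∀ w : Cm m, I • I • w = -w := fun w => by rw [smul_smul, I_mul_I, neg_one_smul]
  simp only [levi, fderiv_fderiv_comp hφ hψy, hI, hI1, hI2, hII, map_neg, Complex.ofReal_add,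
    Complex.ofReal_neg]
  ring

/-- The real part of a holomorphic function is pluriharmonic. -/
theorem levi_re_eq_zero {F : Cm n → ℂ} {y : Cm n} {U : Set (Cm n)} (hU : IsOpen U)
    (hF : ContDiffOn ℂ 2 F U) (hy : y ∈ U) (u v : Cm n) :
    levi (fun z => (F z).re) y u v = 0 := by
  have h1 : ContDiffOn ℂ 2 (fun z => (fun _ : Fin 1 => F z)) U := contDiffOn_pi.2 fun _ => hF
  -- Write `re ∘ F` as the composition of a holomorphic map into ℂ¹ with a real linear function,
  -- whose Hessian is zero.
  let φ : Cm 1 →L[ℝ] ℝ := Complex.reCLM.comp (ContinuousLinearMap.proj (R := ℝ) (0 : Fin 1))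
  have h2 := levi_comp (φ := φ) hU h1 hy φ.contDiff.contDiffAt u v
  have h3 : levi (fun z => (F z).re) y u v = levi (φ ∘ fun z => (fun _ : Fin 1 => F z)) y u v := rfl
  rw [h3, h2]
  have h4 : fderiv ℝ φ = fun _ => φ := by funext z; exact φ.fderiv
  simp [levi, h4]

/-- `log |g|²` is pluriharmonic for `g` holomorphic without zeros. -/
theorem levi_log_normSq_eq_zero {g : Cm n → ℂ} {y : Cm n} {U : Set (Cm n)} (hU : IsOpen U)
    (hg : ContDiffOn ℂ 2 g U) (hy : y ∈ U) (h0 : g y ≠ 0) (u v : Cm n) :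
    levi (fun z => Real.log (normSq (g z))) y u v = 0 := by
  -- Dividing by `g y` moves the value at `y` to 1, so the principal logarithm is holomorphic
  -- nearby; the constant restores the real part to `log |g|²`.
  let F : Cm n → ℂ := fun z => 2 * Complex.log (g z / g y) + (Real.log (normSq (g y)) : ℝ)
  have hcont : ContinuousOn (fun z => g z / g y) U := hg.continuousOn.div_const _
  let V := U ∩ (fun z => g z / g y) ⁻¹' slitPlane
  have hV : IsOpen V := hcont.isOpen_inter_preimage hU isOpen_slitPlane
  have hyV : y ∈ V := ⟨hy, by simp [h0]⟩
  have hF : ContDiffOn ℂ 2 F V := by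
    have h1 : ContDiffOn ℂ 2 (fun z => Complex.log (g z / g y)) V := fun z hz =>
      (Complex.contDiffAt_log hz.2).comp_contDiffWithinAt (f := fun z => g z / g y) z
        ((hg.mono Set.inter_subset_left).div_const _ z hz)
    exact (contDiffOn_const.mul h1).add contDiffOn_const
  rw [← levi_re_eq_zero hV hF hyV u v]
  refine levi_congr ?_ u v
  filter_upwards [hV.mem_nhds hyV] with z hz
  have hz0 : g z ≠ 0 := by
    intro hz0
    have := hz.2
    simp [hz0] at this
  simp only [F, Complex.add_re, Complex.mul_re, Complex.log_re, Complex.ofReal_re, norm_div]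
  rw [Real.log_div (by simpa using hz0) (by simpa using h0), normSq_eq_norm_sq, normSq_eq_norm_sq,
    Real.log_pow, Real.log_pow]
  simp
  ring

theorem contDiffAt_log_normSq {g : Cm n → ℂ} {y : Cm n} {k : ℕ∞ω} (hg : ContDiffAt ℝ k g y)
    (h0 : g y ≠ 0) : ContDiffAt ℝ k (fun z => Real.log (normSq (g z))) y := by
  have h1 : ContDiffAt ℝ k (fun z => normSq (g z)) y := by
    have : (fun z => normSq (g z)) = fun z => (g z).re * (g z).re + (g z).im * (g z).im := by
      funext z; rfl
    rw [this]
    have hr : ContDiffAt ℝ k (fun z => (g z).re) y := Complex.reCLM.contDiff.contDiffAt.comp y hg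
    have hi : ContDiffAt ℝ k (fun z => (g z).im) y := Complex.imCLM.contDiff.contDiffAt.comp y hg
    exact (hr.mul hr).add (hi.mul hi)
  exact h1.log (by simpa using h0)

/-- `i ∂∂̄ φ` in terms of the real Hessian. -/
theorem iddbar_eq (hφ : ContDiffAt ℝ 2 φ y) (u v : Cm m) :
    iddbar φ y u v = (1 / 2) * (fderiv ℝ (fderiv ℝ φ) y (I • u) v
      - fderiv ℝ (fderiv ℝ φ) y u (I • v)) := by
  simp only [iddbar, levi]
  rw [fderiv_fderiv_comm hφ v u, fderiv_fderiv_comm hφ (I • v) (I • u),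
    fderiv_fderiv_comm hφ v (I • u), fderiv_fderiv_comm hφ (I • v) u]
  simp
  ring

/-- The Hermitian form is recovered from the 2-form and multiplication by `I`, so that what is
proved about `iddbar` (invariance under a flow, positivity) passes to the Levi matrix. -/
theorem levi_eq_iddbar (hφ : ContDiffAt ℝ 2 φ y) (u v : Cm m) :
    levi φ y u v = (1 / 2) * ((iddbar φ y u (I • v) : ℂ) - I * (iddbar φ y u v : ℂ)) := by
  have hII : ∀ w : Cm m, I • I • w = -w := fun w => by rw [smul_smul, I_mul_I, neg_one_smul]
  rw [iddbar_eq hφ, iddbar_eq hφ, hII, levi]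
  push_cast
  rw [map_neg]
  push_cast
  ring

theorem iddbar_swap (u v : Cm m) : iddbar φ y u v = - iddbar φ y v u := by
  simp only [iddbar, ← Complex.neg_re]
  congr 1; ring

end Levi

end KahlerQuant

namespace KahlerQuant

/-! ### Derivative of a determinant -/

section Jacobi

open Matrix

/-- Jacobi's formula for the derivative of a determinant. -/
theorem hasDerivAt_det {n : Type*} [Fintype n] [DecidableEq n] {A : ℝ → Matrix n n ℂ}
    {A' : Matrix n n ℂ} {t : ℝ} (hA : ∀ i j, HasDerivAt (fun s => A s i j) (A' i j) t) :
    HasDerivAt (fun s => (A s).det) (((A t).adjugate * A').trace) t := by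
  have h1 : HasDerivAt (fun s => (A s).det)
      (∑ σ : Equiv.Perm n, ((Equiv.Perm.sign σ : ℤ) : ℂ) *
        ∑ c, (∏ i ∈ Finset.univ.erase c, A t (σ i) i) • A' (σ c) c) t := by
    simp only [Matrix.det_apply']
    exact HasDerivAt.fun_sum fun σ _ =>
      (HasDerivAt.fun_finsetProd fun c _ => hA (σ c) c).const_mul _
  convert h1 using 1
  -- By Cramer's rule a diagonal entry is the determinant with column `c` replaced by that of `A'`,
  -- which is the term of the Leibniz expansion in which column `c` is differentiated.
  have h2 : ∀ c, ((A t).adjugate * A') c c = ((A t).updateCol c fun i => A' i c).det := by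
    intro c
    rw [← Matrix.cramer_apply, Matrix.cramer_eq_adjugate_mulVec]
    rfl
  simp only [Matrix.trace, Matrix.diag, h2, Matrix.det_apply']
  rw [Finset.sum_comm]
  refine Finset.sum_congr rfl fun σ _ => ?_
  rw [Finset.mul_sum]
  refine Finset.sum_congr rfl fun c _ => ?_
  rw [← Finset.mul_prod_erase Finset.univ _ (Finset.mem_univ c), Matrix.updateCol_self, smul_eq_mul,
    mul_comm (A' (σ c) c)]
  congr 2
  refine Finset.prod_congr rfl fun i hi => ?_
  rw [Matrix.updateCol_ne (Finset.ne_of_mem_erase hi)]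

end Jacobi

/-! ### Holomorphic Hamiltonian vector fields on open subsets of ℂᵐ -/

section Hamiltonian

set_option synthInstance.maxHeartbeats 200000

variable {m : ℕ} {U : Set (Cm m)} {φ H : Cm m → ℝ} {ξ : Cm m → Cm m}

/-- The local description of a holomorphic Hamiltonian vector field `ξ` for the Kähler potential
`φ` on an open set `U ⊆ ℂᵐ`. -/
structure IsLocalHamiltonian (U : Set (Cm m)) (φ H : Cm m → ℝ) (ξ : Cm m → Cm m) : Prop where
  isOpen : IsOpen U
  potential : ContDiffOn ℝ ∞ φ U
  hamiltonian : ContDiffOn ℝ ∞ H U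
  holomorphic : DifferentiableOn ℂ ξ U
  pos : ∀ y ∈ U, ∀ u, u ≠ 0 → 0 < iddbar φ y u (I • u)
  eq : ∀ y ∈ U, ∀ v, iddbar φ y (ξ y) v = fderiv ℝ H y v

/-- Presents the form as a smooth family of continuous linear maps into the dual, which can then be
inverted to solve for the Hamiltonian field. The Hessian formula used here needs symmetry of second
derivatives, hence equality only near `y`. -/
theorem contDiffAt_iddbarBilin {y : Cm m} (hφ : ContDiffAt ℝ ∞ φ y) :
    ∃ T : Cm m → (Cm m →L[ℝ] Cm m →L[ℝ] ℝ), ContDiffAt ℝ ∞ T y ∧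
      ∀ᶠ z in 𝓝 y, ∀ u v, T z u v = iddbar φ z u v := by
  let J : Cm m →L[ℝ] Cm m := I • ContinuousLinearMap.id ℝ (Cm m)
  let T : Cm m → (Cm m →L[ℝ] Cm m →L[ℝ] ℝ) := fun z => (1 / 2 : ℝ) •
    ((fderiv ℝ (fderiv ℝ φ) z).comp J -
      (ContinuousLinearMap.compL ℝ (Cm m) (Cm m) ℝ).flip J ∘L fderiv ℝ (fderiv ℝ φ) z)
  refine ⟨T, ?_, ?_⟩
  · have h1 : ContDiffAt ℝ ∞ (fderiv ℝ (fderiv ℝ φ)) y :=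
      (hφ.fderiv_right (m := ∞) (by simp)).fderiv_right (m := ∞) (by simp)
    exact ((h1.clm_comp contDiffAt_const).sub (contDiffAt_const.clm_comp h1)).const_smul _
  · have h2 : ContDiffAt ℝ 2 φ y := hφ.of_le ENat.LEInfty.out
    filter_upwards [h2.eventually (by simp)] with z hz u v
    rw [iddbar_eq hz]
    rfl

namespace IsLocalHamiltonian

variable (hl : IsLocalHamiltonian U φ H ξ) {y : Cm m}
include hl

theorem contDiffAt_potential (hy : y ∈ U) : ContDiffAt ℝ ∞ φ y :=
  hl.potential.contDiffAt (hl.isOpen.mem_nhds hy)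

theorem contDiffAt_two (hy : y ∈ U) : ContDiffAt ℝ 2 φ y :=
  (hl.contDiffAt_potential hy).of_le ENat.LEInfty.out

theorem contDiffAt_hamiltonian (hy : y ∈ U) : ContDiffAt ℝ ∞ H y :=
  hl.hamiltonian.contDiffAt (hl.isOpen.mem_nhds hy)

theorem differentiableAt_field (hy : y ∈ U) : DifferentiableAt ℂ ξ y :=
  hl.holomorphic.differentiableAt (hl.isOpen.mem_nhds hy)

/-- Nondegeneracy gives ξ = ω⁻¹(dH), and inversion of linear isomorphisms is smooth. Smoothness of ξ
thus comes from the Hamiltonian equation, whereas `holomorphic` alone records only complex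
differentiability. -/
theorem contDiffAt_field (hy : y ∈ U) : ContDiffAt ℝ ∞ ξ y := by
  obtain ⟨T, hT, hTe⟩ := contDiffAt_iddbarBilin (hl.contDiffAt_potential hy)
  have hinj : ∀ z ∈ U, (∀ u v, T z u v = iddbar φ z u v) → Function.Injective (T z) := by
    intro z hz hTz
    rw [injective_iff_map_eq_zero]
    intro u hu
    by_contra hne
    have h1 := hl.pos z hz u hne
    rw [← hTz, hu] at h1
    exact lt_irrefl _ h1
  have hfin : Module.finrank ℝ (Cm m) = Module.finrank ℝ (Cm m →L[ℝ] ℝ) := by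
    rw [← LinearMap.toContinuousLinearMap.finrank_eq]
    exact (Subspace.dual_finrank_eq (K := ℝ) (V := Cm m)).symm
  have hbij : ∀ z ∈ U, (∀ u v, T z u v = iddbar φ z u v) →
      ∃ e : Cm m ≃L[ℝ] (Cm m →L[ℝ] ℝ), (e : Cm m →L[ℝ] (Cm m →L[ℝ] ℝ)) = T z := by
    intro z hz hTz
    let e := LinearEquiv.ofInjectiveOfFinrankEq (T z).toLinearMap (hinj z hz hTz) hfin
    exact ⟨e.toContinuousLinearEquiv, by ext; rfl⟩
  have hyT := hTe.self_of_nhds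
  obtain ⟨e, he⟩ := hbij y hy hyT
  have h1 : ContDiffAt ℝ ∞ (fun z => ContinuousLinearMap.inverse (T z)) y := by
    have h2 := contDiffAt_map_inverse (𝕜 := ℝ) (n := ∞) e
    rw [he] at h2
    exact h2.comp y hT
  have h3 : ContDiffAt ℝ ∞ (fun z => ContinuousLinearMap.inverse (T z) (fderiv ℝ H z)) y :=
    h1.clm_apply ((hl.contDiffAt_hamiltonian hy).fderiv_right (m := ∞) (by simp))
  refine h3.congr_of_eventuallyEq ?_
  filter_upwards [hTe, hl.isOpen.mem_nhds hy] with z hz hzU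
  obtain ⟨e', he'⟩ := hbij z hzU hz
  rw [← he', ContinuousLinearMap.inverse_equiv]
  have h4 : e' (ξ z) = fderiv ℝ H z := by
    have : e' (ξ z) = T z (ξ z) := by rw [← he']; rfl
    rw [this]
    ext v
    rw [hz, hl.eq z hzU]
  rw [← h4]
  simp

theorem contDiffOn_field : ContDiffOn ℂ ∞ ξ U :=
  contDiffOn_complex hl.isOpen
    (fun _ hy => (hl.contDiffAt_field hy).contDiffWithinAt) hl.holomorphic

/-- The function `H - i ∂φ(ξ)`. -/
noncomputable def moment (φ H : Cm m → ℝ) (ξ : Cm m → Cm m) (y : Cm m) : ℂ :=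
  (H y : ℂ) - I * ((1 / 2) * ((fderiv ℝ φ y (ξ y) : ℂ) - I * (fderiv ℝ φ y (I • ξ y) : ℂ)))

omit hl in
theorem hasFDerivAt_ofReal_comp {f : Cm m → ℝ} {f' : Cm m →L[ℝ] ℝ} (hf : HasFDerivAt f f' y) :
    HasFDerivAt (fun z => (f z : ℂ)) (Complex.ofRealCLM.comp f') y :=
  Complex.ofRealCLM.hasFDerivAt.comp y hf

theorem contDiffOn_moment_real : ContDiffOn ℝ ∞ (moment φ H ξ) U := by
  intro y hy
  refine ContDiffAt.contDiffWithinAt ?_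
  have h1 := (hl.contDiffAt_potential hy).fderiv_right (m := ∞) (by simp)
  have h2 := hl.contDiffAt_field hy
  have h3 : ContDiffAt ℝ ∞ (fun z => I • ξ z) y := h2.const_smul I
  have h4 : ∀ f : Cm m → ℝ, ContDiffAt ℝ ∞ f y → ContDiffAt ℝ ∞ (fun z => (f z : ℂ)) y :=
    fun f hf => Complex.ofRealCLM.contDiff.contDiffAt.comp y hf
  exact (h4 _ (hl.contDiffAt_hamiltonian hy)).sub (contDiffAt_const.mul
    (contDiffAt_const.mul ((h4 _ (h1.clm_apply h2)).sub
      (contDiffAt_const.mul (h4 _ (h1.clm_apply h3))))))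

/-- `H - i ∂φ(ξ)` is holomorphic. -/
theorem contDiffOn_moment : ContDiffOn ℂ ∞ (moment φ H ξ) U := by
  refine contDiffOn_complex hl.isOpen hl.contDiffOn_moment_real fun y hy =>
    (differentiableAt_complex_of_fderiv_I ((hl.contDiffOn_moment_real.contDiffAt
      (hl.isOpen.mem_nhds hy)).differentiableAt (by simp)) fun v => ?_).differentiableWithinAt
  have hφ2 := hl.contDiffAt_two hy
  have h1 : HasFDerivAt (fderiv ℝ φ) (fderiv ℝ (fderiv ℝ φ) y) y :=
    ((hφ2.fderiv_right (m := 1) (by norm_num)).differentiableAt (by norm_num)).hasFDerivAt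
  have h2 : HasFDerivAt ξ (fderiv ℝ ξ y) y :=
    ((hl.contDiffAt_field hy).differentiableAt (by simp)).hasFDerivAt
  have h3 : HasFDerivAt (fun z => I • ξ z) (I • fderiv ℝ ξ y) y := h2.const_smul I
  have hH := ((hl.contDiffAt_hamiltonian hy).differentiableAt (by simp)).hasFDerivAt
  have hK : HasFDerivAt (moment φ H ξ) _ y :=
    (hasFDerivAt_ofReal_comp hH).sub (((((hasFDerivAt_ofReal_comp (h1.clm_apply h2))).sub
      ((hasFDerivAt_ofReal_comp (h1.clm_apply h3)).const_mul I)).const_mul (1 / 2)).const_mul I)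
  rw [hK.fderiv]
  have hI := fderiv_real_I (hl.differentiableAt_field hy) v
  have hII : ∀ w : Cm m, I • I • w = -w := fun w => by rw [smul_smul, I_mul_I, neg_one_smul]
  -- The Hamiltonian equation at `v` and `I • v` expresses `dH` by the Hessian of φ. The terms
  -- containing the derivative of ξ are complex linear in `v` already by `hI`; the remaining ones
  -- match by symmetry of the Hessian. This is ∂̄H = i ∂̄(∂φ(ξ)) in real notation.
  have e1 := hl.eq y hy v
  have e2 := hl.eq y hy (I • v)
  rw [iddbar_eq hφ2] at e1 e2
  simp only [hII, map_neg] at e1 e2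
  simp only [sub_apply, ContinuousLinearMap.comp_apply, smul_apply, add_apply,
    ContinuousLinearMap.flip_apply, smul_eq_mul, Complex.ofRealCLM_apply, hI, hII, map_neg,
    ← e1, ← e2]
  rw [fderiv_fderiv_comm hφ2 v (ξ y), fderiv_fderiv_comm hφ2 v (I • ξ y),
    fderiv_fderiv_comm hφ2 (I • v) (ξ y), fderiv_fderiv_comm hφ2 (I • v) (I • ξ y)]
  push_cast
  ring_nf
  simp only [I_sq, I_pow_three]
  ring_nf

/-- The derivative of `iddbar φ z u v` in the base point `z`. -/
theorem fderiv_iddbar (hy : y ∈ U) (a b c : Cm m) :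
    HasFDerivAt (fun z => iddbar φ z b c) (fderiv ℝ (fun z => iddbar φ z b c) y) y ∧
    fderiv ℝ (fun z => iddbar φ z b c) y a = (1 / 2) *
      (fderiv ℝ (fderiv ℝ (fderiv ℝ φ)) y a (I • b) c -
        fderiv ℝ (fderiv ℝ (fderiv ℝ φ)) y a b (I • c)) := by
  have h3 : HasFDerivAt (fderiv ℝ (fderiv ℝ φ)) (fderiv ℝ (fderiv ℝ (fderiv ℝ φ)) y) y :=
    ((((hl.contDiffAt_potential hy).fderiv_right (m := ∞) (by simp)).fderiv_right (m := ∞)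
      (by simp)).differentiableAt (by simp)).hasFDerivAt
  have hD : ∀ b c : Cm m, HasFDerivAt (fun z => fderiv ℝ (fderiv ℝ φ) z b c) _ y := fun b c =>
    (h3.clm_apply (hasFDerivAt_const b y)).clm_apply (hasFDerivAt_const c y)
  have he : (fun z => iddbar φ z b c) =ᶠ[𝓝 y] fun z => (1 / 2) *
      (fderiv ℝ (fderiv ℝ φ) z (I • b) c - fderiv ℝ (fderiv ℝ φ) z b (I • c)) := by
    filter_upwards [hl.isOpen.mem_nhds hy] with z hz
    exact iddbar_eq (hl.contDiffAt_two hz) b c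
  have h4 := (((hD (I • b) c).sub (hD b (I • c))).const_mul (1 / 2 : ℝ)).congr_of_eventuallyEq he
  refine ⟨h4.differentiableAt.hasFDerivAt, ?_⟩
  rw [h4.fderiv]
  simp

/-- The Kähler form is invariant under the flow of `ξ`: its Lie derivative vanishes. -/
theorem lieDeriv_iddbar (hy : y ∈ U) (u v : Cm m) :
    fderiv ℝ (fun z => iddbar φ z u v) y (ξ y) + iddbar φ y (fderiv ℝ ξ y u) v
      + iddbar φ y u (fderiv ℝ ξ y v) = 0 := by
  have hφ2 := hl.contDiffAt_two hy
  have hφ' : ContDiffAt ℝ ∞ (fderiv ℝ φ) y :=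
    (hl.contDiffAt_potential hy).fderiv_right (m := ∞) (by simp)
  -- Full symmetry of the third derivative of φ (`hs1`, `hs2`) plays the role of dω = 0.
  have hs1 : ∀ a b c : Cm m, fderiv ℝ (fderiv ℝ (fderiv ℝ φ)) y a b c =
      fderiv ℝ (fderiv ℝ (fderiv ℝ φ)) y b a c := fun a b c => by
    rw [fderiv_fderiv_comm (hφ'.of_le ENat.LEInfty.out)]
  have h3 : HasFDerivAt (fderiv ℝ (fderiv ℝ φ)) (fderiv ℝ (fderiv ℝ (fderiv ℝ φ)) y) y :=
    ((hφ'.fderiv_right (m := ∞) (by simp)).differentiableAt (by simp)).hasFDerivAt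
  have hD : ∀ b c : Cm m, HasFDerivAt (fun z => fderiv ℝ (fderiv ℝ φ) z b c) _ y := fun b c =>
    (h3.clm_apply (hasFDerivAt_const b y)).clm_apply (hasFDerivAt_const c y)
  have hs2 : ∀ a b c : Cm m, fderiv ℝ (fderiv ℝ (fderiv ℝ φ)) y a b c =
      fderiv ℝ (fderiv ℝ (fderiv ℝ φ)) y a c b := by
    intro a b c
    have he : (fun z => fderiv ℝ (fderiv ℝ φ) z b c) =ᶠ[𝓝 y]
        fun z => fderiv ℝ (fderiv ℝ φ) z c b := by
      filter_upwards [hl.isOpen.mem_nhds hy] with z hz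
      exact fderiv_fderiv_comm (hl.contDiffAt_two hz) b c
    have h5 := congrArg (fun A : Cm m →L[ℝ] ℝ => A a) (he.fderiv_eq (𝕜 := ℝ))
    rw [(hD b c).fderiv, (hD c b).fderiv] at h5
    simpa using h5
  have h2 : HasFDerivAt ξ (fderiv ℝ ξ y) y :=
    ((hl.contDiffAt_field hy).differentiableAt (by simp)).hasFDerivAt
  -- The derivative of the Hamiltonian equation in the direction `a`: the first term differentiates
  -- ω with ξ frozen, the second differentiates ξ.
  have key : ∀ a b : Cm m, (1 / 2) * (fderiv ℝ (fderiv ℝ (fderiv ℝ φ)) y a (I • ξ y) b -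
      fderiv ℝ (fderiv ℝ (fderiv ℝ φ)) y a (ξ y) (I • b)) + iddbar φ y (fderiv ℝ ξ y a) b =
      fderiv ℝ (fderiv ℝ H) y a b := by
    intro a b
    have hH2 : ContDiffAt ℝ 2 H y := (hl.contDiffAt_hamiltonian hy).of_le ENat.LEInfty.out
    rw [← fderiv_fderiv_apply hH2]
    have he : (fun z => fderiv ℝ H z b) =ᶠ[𝓝 y] fun z => (1 / 2) *
        (fderiv ℝ (fderiv ℝ φ) z (I • ξ z) b - fderiv ℝ (fderiv ℝ φ) z (ξ z) (I • b)) := by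
      filter_upwards [hl.isOpen.mem_nhds hy] with z hz
      rw [← hl.eq z hz, iddbar_eq (hl.contDiffAt_two hz)]
    have h6 : HasFDerivAt (fun z => (1 / 2) *
        (fderiv ℝ (fderiv ℝ φ) z (I • ξ z) b - fderiv ℝ (fderiv ℝ φ) z (ξ z) (I • b))) _ y :=
      ((((h3.clm_apply (h2.const_smul I)).clm_apply (hasFDerivAt_const b y)).sub
        ((h3.clm_apply h2).clm_apply (hasFDerivAt_const (I • b) y))).const_mul (1 / 2 : ℝ))
    rw [he.fderiv_eq, h6.fderiv, iddbar_eq hφ2]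
    simp
    ring
  -- Symmetry of the Hessian of `H` is d(ι_ξ ω) = ddH = 0. Together with dω = 0 this is Cartan's
  -- formula for the Lie derivative, and the rest is linear algebra in third derivatives.
  have hH2 : fderiv ℝ (fderiv ℝ H) y u v = fderiv ℝ (fderiv ℝ H) y v u :=
    fderiv_fderiv_comm ((hl.contDiffAt_hamiltonian hy).of_le ENat.LEInfty.out) u v
  rw [← key u v, ← key v u] at hH2
  rw [(hl.fderiv_iddbar hy (ξ y) u v).2, iddbar_swap u (fderiv ℝ ξ y v)]
  have r1 := hs1 (ξ y) (I • u) v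
  have r2 := hs2 (I • u) (ξ y) v
  have r3 := hs1 (ξ y) u (I • v)
  have r4 := hs1 (I • u) v (ξ y)
  have r5 := hs2 v (I • u) (ξ y)
  have r6 := hs1 u (I • ξ y) v
  have r7 := hs2 (I • ξ y) u v
  have r8 := hs1 (I • ξ y) v u
  linarith

/-- Combines the invariance of ω for the pairs `(u, v)` and `(u, I • v)`; holomorphy of ξ is what
lets its derivative commute with `I`. -/
theorem hasFDerivAt_levi (hy : y ∈ U) (u v : Cm m) :
    HasFDerivAt (fun z => levi φ z u v) (fderiv ℝ (fun z => levi φ z u v) y) y ∧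
    fderiv ℝ (fun z => levi φ z u v) y (ξ y) =
      -(levi φ y (fderiv ℝ ξ y u) v + levi φ y u (fderiv ℝ ξ y v)) := by
  have hφ2 := hl.contDiffAt_two hy
  have he : (fun z => levi φ z u v) =ᶠ[𝓝 y] fun z => (1 / 2) *
      ((iddbar φ z u (I • v) : ℂ) - I * (iddbar φ z u v : ℂ)) := by
    filter_upwards [hl.isOpen.mem_nhds hy] with z hz
    exact levi_eq_iddbar (hl.contDiffAt_two hz) u v
  have h1 := (((hasFDerivAt_ofReal_comp (hl.fderiv_iddbar hy u u (I • v)).1).sub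
    ((hasFDerivAt_ofReal_comp (hl.fderiv_iddbar hy u u v).1).const_mul I)).const_mul
      (1 / 2 : ℂ)).congr_of_eventuallyEq he
  refine ⟨h1.differentiableAt.hasFDerivAt, ?_⟩
  rw [h1.fderiv, levi_eq_iddbar hφ2, levi_eq_iddbar hφ2]
  have e1 := hl.lieDeriv_iddbar hy u v
  have e2 := hl.lieDeriv_iddbar hy u (I • v)
  rw [fderiv_real_I (hl.differentiableAt_field hy)] at e2
  have e1' := congrArg (Complex.ofReal) e1
  have e2' := congrArg (Complex.ofReal) e2
  push_cast at e1' e2'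
  simp only [sub_apply, ContinuousLinearMap.comp_apply, smul_apply, smul_eq_mul,
    Complex.ofRealCLM_apply]
  linear_combination (1 / 2 : ℂ) * e2' - (1 / 2 : ℂ) * I * e1'

end IsLocalHamiltonian

end Hamiltonian

end KahlerQuant

namespace KahlerQuant

/-! ### The Levi matrix: positivity, change of variables, vanishing divergence -/

section LeviMatrix

variable {m n : ℕ} {φ φ' : Cm m → ℝ} {y : Cm m}

theorem levi_csmul_left (φ : Cm m → ℝ) (y u v : Cm m) (c : ℂ) :
    levi φ y (c • u) v = c * levi φ y u v := by
  have hc : c • u = c.re • u + c.im • (I • u) := by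
    conv_lhs => rw [← Complex.re_add_im c]
    rw [add_smul, mul_smul, Complex.coe_smul, Complex.coe_smul]
  rw [hc, levi_add_left, levi_smul_left, levi_smul_left, levi_I_left]
  conv_rhs => rw [← Complex.re_add_im c]
  ring

theorem levi_csmul_right (φ : Cm m → ℝ) (y u v : Cm m) (c : ℂ) :
    levi φ y u (c • v) = conj c * levi φ y u v := by
  have hc : c • v = c.re • v + c.im • (I • v) := by
    conv_lhs => rw [← Complex.re_add_im c]
    rw [add_smul, mul_smul, Complex.coe_smul, Complex.coe_smul]
  rw [hc, levi_add_right, levi_smul_right, levi_smul_right, levi_I_right]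
  conv_rhs => rw [← Complex.re_add_im c]
  simp only [map_add, map_mul, Complex.conj_ofReal, Complex.conj_I]
  ring

/-- The Levi form in coordinates. -/
theorem levi_eq_sum (φ : Cm m → ℝ) (y u v : Cm m) :
    levi φ y u v = ∑ j, ∑ k, u j * conj (v k) * leviMatrix φ y j k := by
  let Ll : Cm m →+ Cm m →+ ℂ := AddMonoidHom.mk' (fun u => AddMonoidHom.mk' (levi φ y u)
    (levi_add_right φ y u)) (fun a b =>
      AddMonoidHom.ext fun v => levi_add_left φ y a b v)
  have hu : ∀ w : Cm m, w = ∑ j, w j • (Pi.single j 1 : Cm m) := fun w => by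
    conv_lhs => rw [pi_eq_sum_univ' w]
  have h1 : levi φ y u v = Ll u v := rfl
  rw [h1]
  conv_lhs => rw [hu u, hu v]
  simp only [map_sum, AddMonoidHom.finsetSum_apply]
  rw [Finset.sum_comm]
  refine Finset.sum_congr rfl fun j _ => Finset.sum_congr rfl fun k _ => ?_
  change levi φ y _ _ = _
  rw [levi_csmul_left, levi_csmul_right, leviMatrix, Matrix.of_apply]
  ring

open scoped ComplexOrder Matrix in
theorem leviMatrix_posDef (hφ : ContDiffAt ℝ 2 φ y)
    (hpos : ∀ u, u ≠ 0 → 0 < iddbar φ y u (I • u)) : (leviMatrix φ y).PosDef := by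
  rw [Matrix.posDef_iff_dotProduct_mulVec]
  refine ⟨?_, fun x hx => ?_⟩
  · ext j k
    simp only [Matrix.conjTranspose_apply, leviMatrix, Matrix.of_apply]
    exact levi_conj hφ _ _
  -- `levi` is conjugate linear in its second argument while the quadratic form `x* A x` conjugates
  -- the first, hence the vector `star x`.
  · have h1 : star x ⬝ᵥ (leviMatrix φ y *ᵥ x) = levi φ y (star x) (star x) := by
      rw [levi_eq_sum]
      simp only [dotProduct, Matrix.mulVec, Finset.mul_sum]
      refine Finset.sum_congr rfl fun j _ => Finset.sum_congr rfl fun k _ => ?_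
      simp
      ring
    have h2 : iddbar φ y (star x) (star x) = 0 := by
      have := iddbar_swap (φ := φ) (y := y) (star x) (star x)
      linarith
    have h3 := hpos (star x) (by simpa using hx)
    rw [h1, levi_eq_iddbar hφ, h2]
    simp only [Complex.ofReal_zero, mul_zero, sub_zero]
    rw [show (1 / 2 : ℂ) * (iddbar φ y (star x) (I • star x) : ℂ) =
      ((1 / 2 * iddbar φ y (star x) (I • star x) : ℝ) : ℂ) by push_cast; ring]
    rw [Complex.zero_lt_real]
    linarith

open scoped ComplexOrder in
theorem leviMatrix_det_pos (hφ : ContDiffAt ℝ 2 φ y)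
    (hpos : ∀ u, u ≠ 0 → 0 < iddbar φ y u (I • u)) : 0 < (leviMatrix φ y).det.re :=
  (Complex.pos_iff.1 (leviMatrix_posDef hφ hpos).det_pos).1

/-- The real determinant of a complex linear map is the norm from ℂ to ℝ of its complex determinant,
that is |det|². -/
theorem det_real_fderiv {ψ : Cm m → Cm m} (hψ : DifferentiableAt ℂ ψ y) :
    (fderiv ℝ ψ y).det =
      normSq (Matrix.of fun l j : Fin m => fderiv ℝ ψ y (Pi.single j 1) l).det := by
  have h1 : fderiv ℝ ψ y = (fderiv ℂ ψ y).restrictScalars ℝ := hψ.fderiv_restrictScalars ℝ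
  have h2 : (Matrix.of fun l j : Fin m => fderiv ℝ ψ y (Pi.single j 1) l) =
      LinearMap.toMatrix' (fderiv ℂ ψ y).toLinearMap := by
    ext l j
    rw [Matrix.of_apply, LinearMap.toMatrix'_apply, fderiv_real_eq hψ]
    rfl
  rw [h2, LinearMap.det_toMatrix', ← Algebra.norm_complex_apply, h1]
  exact LinearMap.det_restrictScalars

/-- The density of the Kähler volume transforms by the real Jacobian determinant. -/
theorem leviMatrix_comp_det {ψ : Cm m → Cm m} {U : Set (Cm m)} (hU : IsOpen U)
    (hψ : ContDiffOn ℂ 2 ψ U) (hy : y ∈ U) (hφ : ContDiffAt ℝ 2 φ (ψ y)) :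
    (leviMatrix (φ ∘ ψ) y).det.re = |(fderiv ℝ ψ y).det| * (leviMatrix φ (ψ y)).det.re := by
  have hd : DifferentiableAt ℂ ψ y :=
    (hψ.differentiableOn (by norm_num)).differentiableAt (hU.mem_nhds hy)
  set P : Matrix (Fin m) (Fin m) ℂ := Matrix.of fun l j => fderiv ℝ ψ y (Pi.single j 1) l with hP
  -- Tensoriality in matrix form; the two outer determinants multiply to |det P|², which is the real
  -- Jacobian.
  have h1 : leviMatrix (φ ∘ ψ) y = P.transpose * leviMatrix φ (ψ y) * P.map conj := by
    ext j k
    rw [leviMatrix, Matrix.of_apply, levi_comp hU hψ hy hφ, levi_eq_sum]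
    simp only [Matrix.mul_apply, Matrix.transpose_apply, Matrix.map_apply, hP, Matrix.of_apply,
      Finset.sum_mul]
    rw [Finset.sum_comm]
    refine Finset.sum_congr rfl fun l _ => Finset.sum_congr rfl fun i _ => ?_
    ring
  have h2 : (P.map conj).det = conj P.det := (RingHom.map_det (starRingEnd ℂ) P).symm
  rw [h1, Matrix.det_mul, Matrix.det_mul, Matrix.det_transpose, h2, det_real_fderiv hd,
    abs_of_nonneg (normSq_nonneg _), ← Complex.re_ofReal_mul, ← Complex.mul_conj, ← hP]
  congr 1
  ring

end LeviMatrix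

namespace IsLocalHamiltonian

variable {m : ℕ} {U : Set (Cm m)} {φ H : Cm m → ℝ} {ξ : Cm m → Cm m}

theorem contDiffAt_levi {y : Cm m} (hφ : ContDiffAt ℝ ∞ φ y) (u v : Cm m) :
    ContDiffAt ℝ ∞ (fun z => levi φ z u v) y := by
  have h1 : ContDiffAt ℝ ∞ (fderiv ℝ (fderiv ℝ φ)) y :=
    (hφ.fderiv_right (m := ∞) (by simp)).fderiv_right (m := ∞) (by simp)
  have hD : ∀ b c : Cm m, ContDiffAt ℝ ∞ (fun z => ((fderiv ℝ (fderiv ℝ φ) z b c : ℝ) : ℂ)) y :=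
    fun b c => Complex.ofRealCLM.contDiff.contDiffAt.comp y
      ((h1.clm_apply contDiffAt_const).clm_apply contDiffAt_const)
  exact contDiffAt_const.mul (((hD u v).add (hD _ _)).add
    (contDiffAt_const.mul ((hD _ _).sub (hD _ _))))

theorem contDiffAt_leviMatrix_det {y : Cm m} (hφ : ContDiffAt ℝ ∞ φ y) :
    ContDiffAt ℝ ∞ (fun z => (leviMatrix φ z).det) y := by
  simp only [Matrix.det_apply']
  exact ContDiffAt.sum fun σ _ => contDiffAt_const.mul
    (contDiffAt_prod fun i _ => contDiffAt_levi hφ _ _)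

/-- A holomorphic Hamiltonian vector field is divergence free for the Kähler volume. -/
theorem divergence_eq_zero (hl : IsLocalHamiltonian U φ H ξ) {y : Cm m} (hy : y ∈ U) :
    fderiv ℝ (fun z => (leviMatrix φ z).det.re) y (ξ y) + (leviMatrix φ y).det.re *
      ∑ j, ((fderiv ℝ ξ y (Pi.single j 1) j).re + (fderiv ℝ ξ y (I • Pi.single j 1) j).im) = 0 := by
  have hφ2 := hl.contDiffAt_two hy
  set A := leviMatrix φ y with hA
  set B : Matrix (Fin m) (Fin m) ℂ := Matrix.of fun l j => fderiv ℝ ξ y (Pi.single j 1) l with hB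
  have hline : HasDerivAt (fun t : ℝ => y + t • ξ y) (ξ y) 0 := by
    simpa using ((hasDerivAt_id (0 : ℝ)).smul_const (ξ y)).const_add y
  have h0 : y + (0 : ℝ) • ξ y = y := by simp
  -- Invariance of the Levi form says that along ξ the matrix `A` changes by -(BᵀA + A B̄), where
  -- `B` is the complex Jacobian of ξ. Restricting to the line through `y` in the direction ξ(y)
  -- makes the one-variable Jacobi formula applicable.
  have hent : ∀ j k, HasDerivAt (fun t : ℝ => leviMatrix φ (y + t • ξ y) j k)
      ((-(B.transpose * A + A * B.map conj)) j k) 0 := by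
    intro j k
    have h1 := (hl.hasFDerivAt_levi hy (Pi.single j 1) (Pi.single k 1)).1
    have h2 := (hl.hasFDerivAt_levi hy (Pi.single j 1) (Pi.single k 1)).2
    rw [← h0] at h1
    have h3 := h1.comp_hasDerivAt (0 : ℝ) hline
    rw [h0] at h3
    rw [h2] at h3
    refine HasDerivAt.congr_deriv h3 ?_
    symm
    have e : ∀ (i l : Fin m), (Pi.single i 1 : Cm m) l = if l = i then 1 else 0 := fun i l => by
      rw [Pi.single_apply]
    rw [Matrix.neg_apply, Matrix.add_apply, Matrix.mul_apply, Matrix.mul_apply, levi_eq_sum φ y _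
      (Pi.single k 1), levi_eq_sum φ y (Pi.single j 1)]
    congr 2
    · refine Finset.sum_congr rfl fun l _ => ?_
      simp [e, hB, hA]
    · simp [e, hB, hA, mul_comm]
  have hdet := hasDerivAt_det hent
  rw [h0, ← hA] at hdet
  -- Since adj(A) A = det(A), the logarithmic derivative of det A along ξ is -(tr B + conj (tr B)).
  have htr : (A.adjugate * -(B.transpose * A + A * B.map conj)).trace =
      -(A.det * (B.trace + conj B.trace)) := by
    have t1 : (A.adjugate * (B.transpose * A)).trace = A.det * B.trace := by
      rw [Matrix.trace_mul_comm, Matrix.mul_assoc, Matrix.mul_adjugate, Matrix.mul_smul,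
        Matrix.mul_one, Matrix.trace_smul, Matrix.trace_transpose, smul_eq_mul]
    have t2 : (A.adjugate * (A * B.map conj)).trace = A.det * conj B.trace := by
      rw [← Matrix.mul_assoc, Matrix.adjugate_mul, Matrix.smul_mul, Matrix.one_mul,
        Matrix.trace_smul, smul_eq_mul]
      congr 1
      simp [Matrix.trace]
    rw [mul_neg, Matrix.trace_neg, mul_add, Matrix.trace_add, t1, t2]
    ring
  rw [htr, Complex.add_conj] at hdet
  have hD : HasFDerivAt (fun z => (leviMatrix φ z).det.re)
      (fderiv ℝ (fun z => (leviMatrix φ z).det.re) y) y :=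
    ((Complex.reCLM.contDiff.contDiffAt.comp y (contDiffAt_leviMatrix_det
      (hl.contDiffAt_potential hy))).differentiableAt (by simp)).hasFDerivAt
  have h5 : HasDerivAt (fun t : ℝ => (leviMatrix φ (y + t • ξ y)).det.re)
      (fderiv ℝ (fun z => (leviMatrix φ z).det.re) y (ξ y)) 0 := by
    rw [← h0] at hD
    have h6 := hD.comp_hasDerivAt (0 : ℝ) hline
    rw [h0] at h6
    exact h6
  have h7 : HasDerivAt (fun t : ℝ => (leviMatrix φ (y + t • ξ y)).det.re)
      (-(A.det * ((2 * B.trace.re : ℝ) : ℂ))).re 0 :=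
    Complex.reCLM.hasFDerivAt.comp_hasDerivAt (0 : ℝ) hdet
  rw [h5.unique h7]
  -- The left side is the real divergence in the coordinates x_j, y_j. By Cauchy–Riemann both
  -- partial derivatives contribute Re B_jj.
  have h8 : ∑ j, ((fderiv ℝ ξ y (Pi.single j 1) j).re +
      (fderiv ℝ ξ y (I • Pi.single j 1) j).im) = 2 * B.trace.re := by
    simp only [fderiv_real_I (hl.differentiableAt_field hy)]
    simp only [Matrix.trace, Matrix.diag, hB, Matrix.of_apply, Complex.re_sum, Finset.mul_sum]
    refine Finset.sum_congr rfl fun j _ => ?_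
    simp
    ring
  rw [h8, Complex.neg_re, Complex.re_mul_ofReal]
  ring

end IsLocalHamiltonian

end KahlerQuant

namespace KahlerQuant

/-! ### Functions and derivatives in charts -/

section Charts

variable {𝕜 : Type*} [NontriviallyNormedField 𝕜] {E : Type*} [NormedAddCommGroup E]
  [NormedSpace 𝕜 E] {G : Type*} [NormedAddCommGroup G] [NormedSpace 𝕜 G]
  {M : Type*} [TopologicalSpace M] [ChartedSpace E M]

/-- The coordinate change from the preferred chart at `x` to the one at `p`. -/
def coordChange (E : Type*) [TopologicalSpace E] {M : Type*} [TopologicalSpace M]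
    [ChartedSpace E M] (x p : M) : E → E := chartAt E p ∘ (chartAt E x).symm

/-- The domain of `coordChange`. -/
def coordChangeDom (E : Type*) [TopologicalSpace E] {M : Type*} [TopologicalSpace M]
    [ChartedSpace E M] (x p : M) : Set E :=
  (chartAt E x).target ∩ (chartAt E x).symm ⁻¹' (chartAt E p).source

theorem isOpen_chart_preimage (p : M) {s : Set M} (hs : IsOpen s) :
    IsOpen ((chartAt E p).target ∩ (chartAt E p).symm ⁻¹' s) :=
  (chartAt E p).isOpen_inter_preimage_symm hs

theorem isOpen_coordChangeDom (x p : M) : IsOpen (coordChangeDom E x p) :=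
  isOpen_chart_preimage x (chartAt E p).open_source

theorem mem_coordChangeDom {x p z : M} (h1 : z ∈ (chartAt E x).source)
    (h2 : z ∈ (chartAt E p).source) : chartAt E x z ∈ coordChangeDom E x p :=
  ⟨(chartAt E x).map_source h1, by
    rw [Set.mem_preimage, (chartAt E x).left_inv h1]; exact h2⟩

theorem coordChange_apply {x p z : M} (h1 : z ∈ (chartAt E x).source) :
    coordChange E x p (chartAt E x z) = chartAt E p z := by
  simp only [coordChange, Function.comp_apply, (chartAt E x).left_inv h1]

theorem contDiffOn_coordChange (n : ℕ∞ω) [IsManifold 𝓘(𝕜, E) n M] (x p : M) :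
    ContDiffOn 𝕜 n (coordChange E x p) (coordChangeDom E x p) := by
  have h1 := contDiffOn_ext_coord_change (I := 𝓘(𝕜, E)) (n := n) p x
  simp only [mfld_simps] at h1
  exact h1

theorem contDiffOn_comp_chart_symm (n : ℕ∞ω) [IsManifold 𝓘(𝕜, E) n M] {F : M → G} {s : Set M}
    (hF : ContMDiffOn 𝓘(𝕜, E) 𝓘(𝕜, G) n F s) (p : M) :
    ContDiffOn 𝕜 n (F ∘ (chartAt E p).symm)
      ((chartAt E p).target ∩ (chartAt E p).symm ⁻¹' s) := by
  rw [← contMDiffOn_iff_contDiffOn]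
  exact (hF.comp ((contMDiffOn_chart_symm (I := 𝓘(𝕜, E)) (x := p) (n := n)).mono
    Set.inter_subset_left) Set.inter_subset_right)

theorem contMDiffAt_of_comp_chart_symm (n : ℕ∞ω) [IsManifold 𝓘(𝕜, E) n M] {F : M → G} {x p : M}
    (hx : x ∈ (chartAt E p).source)
    (hF : ContDiffAt 𝕜 n (F ∘ (chartAt E p).symm) (chartAt E p x)) :
    ContMDiffAt 𝓘(𝕜, E) 𝓘(𝕜, G) n F x := by
  have h1 : ContMDiffAt 𝓘(𝕜, E) 𝓘(𝕜, E) n (chartAt E p) x :=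
    (contMDiffOn_chart (I := 𝓘(𝕜, E)) (x := p) (n := n)).contMDiffAt
      ((chartAt E p).open_source.mem_nhds hx)
  refine ((hF.contMDiffAt).comp x h1).congr_of_eventuallyEq ?_
  filter_upwards [(chartAt E p).open_source.mem_nhds hx] with z hz
  simp [(chartAt E p).left_inv hz]

/-- The derivative of a function on a manifold in the preferred chart. -/
theorem mfderiv_eq_fderiv {F : M → G} {x : M} (hF : MDifferentiableAt 𝓘(𝕜, E) 𝓘(𝕜, G) F x)
    (v : TangentSpace 𝓘(𝕜, E) x) :
    mfderiv 𝓘(𝕜, E) 𝓘(𝕜, G) F x v =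
      fderiv 𝕜 (F ∘ (chartAt E x).symm) (chartAt E x x) (v : E) := by
  rw [hF.mfderiv]
  simp only [mfld_simps, fderivWithin_univ]
  rfl

/-- The derivative of a function on a manifold in an arbitrary chart. -/
theorem mfderiv_eq_fderiv_coordChange [IsManifold 𝓘(𝕜, E) 1 M] {F : M → G} {x p : M}
    (hF : ContMDiffAt 𝓘(𝕜, E) 𝓘(𝕜, G) 1 F x) (hx : x ∈ (chartAt E p).source)
    (v : TangentSpace 𝓘(𝕜, E) x) :
    mfderiv 𝓘(𝕜, E) 𝓘(𝕜, G) F x v =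
      fderiv 𝕜 (F ∘ (chartAt E p).symm) (chartAt E p x)
        (fderiv 𝕜 (coordChange E x p) (chartAt E x x) (v : E)) := by
  rw [mfderiv_eq_fderiv (hF.mdifferentiableAt (by simp))]
  have hxx := mem_chart_source E x
  have hmem : chartAt E x x ∈ coordChangeDom E x p := mem_coordChangeDom hxx hx
  have h1 : DifferentiableAt 𝕜 (coordChange E x p) (chartAt E x x) :=
    ((contDiffOn_coordChange (𝕜 := 𝕜) 1 x p).contDiffAt
      ((isOpen_coordChangeDom x p).mem_nhds hmem)).differentiableAt (by simp)
  have h2 : DifferentiableAt 𝕜 (F ∘ (chartAt E p).symm) (chartAt E p x) := by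
    have h3 : ContMDiffAt 𝓘(𝕜, E) 𝓘(𝕜, E) 1 (chartAt E p).symm (chartAt E p x) :=
      (contMDiffOn_chart_symm (I := 𝓘(𝕜, E)) (x := p) (n := 1)).contMDiffAt
        ((chartAt E p).open_target.mem_nhds ((chartAt E p).map_source hx))
    have h4 : ContMDiffAt 𝓘(𝕜, E) 𝓘(𝕜, G) 1 F ((chartAt E p).symm (chartAt E p x)) := by
      rw [(chartAt E p).left_inv hx]; exact hF
    exact (contMDiffAt_iff_contDiffAt.1 (h4.comp _ h3)).differentiableAt (by simp)
  have he : F ∘ (chartAt E x).symm =ᶠ[𝓝 (chartAt E x x)]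
      (F ∘ (chartAt E p).symm) ∘ coordChange E x p := by
    filter_upwards [(isOpen_coordChangeDom x p).mem_nhds hmem] with z hz
    simp only [Function.comp_apply, coordChange, (chartAt E p).left_inv hz.2]
  rw [he.fderiv_eq]
  have h5 : coordChange E x p (chartAt E x x) = chartAt E p x := coordChange_apply hxx
  rw [← h5] at h2
  rw [fderiv_comp _ h2 h1, h5]
  rfl

/-- The two coordinate changes are mutually inverse near the point. This is used to realize any
coordinate vector in the chart at `p` by a tangent vector, tangent spaces being identified with ℂᵐ
through their preferred charts. -/
theorem fderiv_coordChange_comp [IsManifold 𝓘(𝕜, E) 1 M] {x p z : M}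
    (hx : z ∈ (chartAt E x).source) (hp : z ∈ (chartAt E p).source) (v : E) :
    fderiv 𝕜 (coordChange E x p) (chartAt E x z)
      (fderiv 𝕜 (coordChange E p x) (chartAt E p z) v) = v := by
  have hd : ∀ {a b : M}, z ∈ (chartAt E a).source → z ∈ (chartAt E b).source →
      DifferentiableAt 𝕜 (coordChange E a b) (chartAt E a z) := fun {a b} ha hb =>
    ((contDiffOn_coordChange (𝕜 := 𝕜) 1 a b).contDiffAt
      ((isOpen_coordChangeDom a b).mem_nhds (mem_coordChangeDom ha hb))).differentiableAt (by simp)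
  have h1 := hd hx hp
  rw [← coordChange_apply (p := x) hp] at h1
  have h2 := fderiv_comp (chartAt E p z) h1 (hd hp hx)
  have he : coordChange E x p ∘ coordChange E p x =ᶠ[𝓝 (chartAt E p z)] id := by
    filter_upwards [(isOpen_coordChangeDom p x).mem_nhds (mem_coordChangeDom hp hx)] with w hw
    simp only [Function.comp_apply, coordChange, (chartAt E x).left_inv hw.2,
      (chartAt E p).right_inv hw.1, id]
  rw [he.fderiv_eq, fderiv_id, coordChange_apply hp] at h2
  exact (DFunLike.congr_fun h2 v).symm

end Charts

section RealManifold

variable {m : ℕ} {M : Type*} [TopologicalSpace M] [ChartedSpace (Cm m) M]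
  [IsManifold 𝓘(ℂ, Cm m) ω M]

/-- Complex analytic transition maps are real smooth, so the complex atlas serves as a real smooth
atlas as well. -/
theorem isManifold_real (m : ℕ) (M : Type*) [TopologicalSpace M] [ChartedSpace (Cm m) M]
    [IsManifold 𝓘(ℂ, Cm m) ω M] : IsManifold 𝓘(ℝ, Cm m) ∞ M := by
  refine isManifold_of_contDiffOn _ _ _ fun e e' he he' => ?_
  have h1 := (contDiffGroupoid ω 𝓘(ℂ, Cm m)).compatible he he'
  rw [contDiffGroupoid, mem_groupoid_of_pregroupoid] at h1
  have h2 : ContDiffOn ℂ ω _ _ := h1.1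
  simp only [mfld_simps] at h2 ⊢
  exact (h2.of_le le_top).restrict_scalars ℝ

theorem isManifold_complex_infty (m : ℕ) (M : Type*) [TopologicalSpace M]
    [ChartedSpace (Cm m) M] [IsManifold 𝓘(ℂ, Cm m) ω M] : IsManifold 𝓘(ℂ, Cm m) ∞ M :=
  IsManifold.of_le (n := ω) le_top

theorem isManifold_complex_one (m : ℕ) (M : Type*) [TopologicalSpace M]
    [ChartedSpace (Cm m) M] [IsManifold 𝓘(ℂ, Cm m) ω M] : IsManifold 𝓘(ℂ, Cm m) 1 M :=
  IsManifold.of_le (n := ω) le_top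

theorem isManifold_real_one (m : ℕ) (M : Type*) [TopologicalSpace M]
    [ChartedSpace (Cm m) M] [IsManifold 𝓘(ℂ, Cm m) ω M] : IsManifold 𝓘(ℝ, Cm m) 1 M :=
  haveI := isManifold_real m M
  IsManifold.of_le (n := ∞) (by simp)

theorem contDiffOn_coordChange_complex (x p : M) :
    ContDiffOn ℂ ∞ (coordChange (Cm m) x p) (coordChangeDom (Cm m) x p) :=
  haveI := isManifold_complex_infty m M
  contDiffOn_coordChange (𝕜 := ℂ) ∞ x p

theorem differentiableAt_coordChange {x p : M} {y : Cm m} (hy : y ∈ coordChangeDom (Cm m) x p) :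
    DifferentiableAt ℂ (coordChange (Cm m) x p) y :=
  ((contDiffOn_coordChange_complex x p).contDiffAt
    ((isOpen_coordChangeDom x p).mem_nhds hy)).differentiableAt (by simp)

end RealManifold

/-! ### Local frames of L and its powers; transition functions and weights -/

section Frames

variable {m : ℕ} {M : Type*} [TopologicalSpace M] [ChartedSpace (Cm m) M]
  (L : M → Type*) [∀ x, AddCommGroup (L x)] [∀ x, Module ℂ (L x)]
  [∀ x, TopologicalSpace (L x)] [TopologicalSpace (TotalSpace ℂ L)] [FiberBundle ℂ L]
  [VectorBundle ℂ ℂ L]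

theorem isOpen_frameSet (q : M) : IsOpen (frameSet L q) := (trivializationAt ℂ L q).open_baseSet

theorem mem_frameSet (q : M) : q ∈ frameSet L q := FiberBundle.mem_baseSet_trivializationAt' q

/-- The transition function between the frames around `q'` and `q`. -/
noncomputable def transFun (q q' x : M) : ℂ := (trivializationAt ℂ L q).linearMapAt ℂ x (frame L q' x)

variable {L}

theorem linearMapAt_frame {q x : M} (hx : x ∈ frameSet L q) :
    (trivializationAt ℂ L q).linearMapAt ℂ x (frame L q x) = 1 := by
  rw [frame, ← Trivialization.symmₗ_apply (R := ℂ) _ hx]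
  exact (trivializationAt ℂ L q).linearMapAt_symmₗ hx 1

theorem linearMapAt_smul_frame {q x : M} (hx : x ∈ frameSet L q) (v : L x) :
    (trivializationAt ℂ L q).linearMapAt ℂ x v • frame L q x = v := by
  rw [frame, ← Trivialization.symmₗ_apply (R := ℂ) _ hx, ← map_smul, smul_eq_mul, mul_one]
  exact (trivializationAt ℂ L q).symmₗ_linearMapAt hx v

theorem frame_ne_zero {q x : M} (hx : x ∈ frameSet L q) : frame L q x ≠ 0 := by
  intro h0
  have := linearMapAt_frame hx
  rw [h0, map_zero] at this
  exact zero_ne_one this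

theorem transFun_smul_frame {q q' x : M} (hx : x ∈ frameSet L q) :
    transFun L q q' x • frame L q x = frame L q' x :=
  linearMapAt_smul_frame hx _

theorem transFun_ne_zero {q q' x : M} (hx : x ∈ frameSet L q) (hx' : x ∈ frameSet L q') :
    transFun L q q' x ≠ 0 := by
  intro h0
  have := transFun_smul_frame (q' := q') hx
  rw [h0, zero_smul] at this
  exact frame_ne_zero hx' this.symm

theorem linearMapAt_trans {q q' x : M} (hx' : x ∈ frameSet L q')
    (v : L x) : (trivializationAt ℂ L q).linearMapAt ℂ x v =
      transFun L q q' x * (trivializationAt ℂ L q').linearMapAt ℂ x v := by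
  conv_lhs => rw [← linearMapAt_smul_frame hx' v]
  rw [map_smul, smul_eq_mul, mul_comm]
  rfl

/-- In rank one the transition function is the coordinate change of the bundle applied to 1. -/
theorem contMDiffOn_transFun [ContMDiffVectorBundle ω ℂ L 𝓘(ℂ, Cm m)] (q q' : M) :
    ContMDiffOn 𝓘(ℂ, Cm m) 𝓘(ℂ, ℂ) ω (transFun L q q') (frameSet L q' ∩ frameSet L q) := by
  have h1 := contMDiffOn_coordChangeL (n := ω) (IB := 𝓘(ℂ, Cm m)) (trivializationAt ℂ L q')
    (trivializationAt ℂ L q)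
  have h2 := (((ContinuousLinearMap.apply ℂ ℂ (1 : ℂ)).contMDiff (n := ω)).comp_contMDiffOn h1)
  refine h2.congr fun x hx => ?_
  simp only [Function.comp_apply, ContinuousLinearMap.apply_apply, ContinuousLinearEquiv.coe_coe]
  rw [Trivialization.coordChangeL_apply' _ _ hx, transFun, frame,
    Trivialization.linearMapAt_apply, if_pos hx.2, Trivialization.mk_symm _ hx.1]

end Frames

end KahlerQuant

namespace KahlerQuant

noncomputable section

section Frames

variable {m : ℕ} {M : Type*} [TopologicalSpace M] [ChartedSpace (Cm m) M]
  {L : M → Type*} [∀ x, AddCommGroup (L x)] [∀ x, Module ℂ (L x)]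
  [∀ x, TopologicalSpace (L x)] [TopologicalSpace (TotalSpace ℂ L)] [FiberBundle ℂ L]
  [VectorBundle ℂ ℂ L] (h : HermitianMetric m L) {k : ℕ}

theorem powCoeff_tprod (q x : M) (v : Fin k → L x) :
    powCoeff L k q x (PiTensorProduct.tprod ℂ v) =
      ∏ i, (trivializationAt ℂ L q).linearMapAt ℂ x (v i) := by
  simp only [powCoeff, PiTensorProduct.lift.tprod, MultilinearMap.compLinearMap_apply,
    MultilinearMap.mkPiAlgebra_apply]

theorem powCoeff_trans {q q' x : M} (hx' : x ∈ frameSet L q') (v : ⨂[ℂ]^k (L x)) :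
    powCoeff L k q x v = transFun L q q' x ^ k * powCoeff L k q' x v := by
  have h1 : powCoeff L k q x = (transFun L q q' x ^ k) • powCoeff L k q' x := by
    apply PiTensorProduct.ext
    ext w
    simp only [LinearMap.compMultilinearMap_apply, LinearMap.smul_apply, smul_eq_mul]
    rw [powCoeff_tprod, powCoeff_tprod]
    simp only [linearMapAt_trans (q := q) hx', Finset.prod_mul_distrib, Finset.prod_const,
      Finset.card_univ, Fintype.card_fin]
  rw [h1]; rfl

/-- On pure tensors this is multilinearity together with v = (coefficient of v) e in each factor,
and pure tensors determine a linear map. -/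
theorem powCoeff_smul_tpow {q x : M} (hx : x ∈ frameSet L q) (v : ⨂[ℂ]^k (L x)) :
    powCoeff L k q x v • tpow k (frame L q x) = v := by
  have h1 : (LinearMap.toSpanSingleton ℂ (⨂[ℂ]^k (L x)) (tpow k (frame L q x))).comp
      (powCoeff L k q x) = LinearMap.id := by
    apply PiTensorProduct.ext
    ext w
    simp only [LinearMap.compMultilinearMap_apply, LinearMap.comp_apply, LinearMap.id_apply,
      LinearMap.toSpanSingleton_apply]
    rw [powCoeff_tprod, tpow, ← MultilinearMap.map_smul_univ]
    congr 1
    funext i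
    exact linearMapAt_smul_frame hx (w i)
  exact LinearMap.congr_fun h1 v

theorem powCoeff_tpow_frame {q x : M} (hx : x ∈ frameSet L q) :
    powCoeff L k q x (tpow k (frame L q x)) = 1 := by
  rw [tpow, powCoeff_tprod]
  simp [linearMapAt_frame hx]

theorem powCoeff_eq_zero_iff {q x : M} (hx : x ∈ frameSet L q) (v : ⨂[ℂ]^k (L x)) :
    powCoeff L k q x v = 0 ↔ v = 0 := by
  refine ⟨fun h0 => ?_, fun h0 => by rw [h0, map_zero]⟩
  rw [← powCoeff_smul_tpow hx v, h0, zero_smul]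

theorem localRep_trans {q q' x : M} (hx' : x ∈ frameSet L q') (s : PowSection L k) :
    localRep L s q x = transFun L q q' x ^ k * localRep L s q' x :=
  powCoeff_trans hx' (s x)

theorem form_frame_im (q x : M) : (h.form x (frame L q x) (frame L q x)).im = 0 :=
  Complex.conj_eq_iff_im.1 (h.conj_symm x _ _)

theorem form_frame_pos {q x : M} (hx : x ∈ frameSet L q) :
    0 < (h.form x (frame L q x) (frame L q x)).re := h.pos x _ (frame_ne_zero hx)

theorem form_frame_eq_exp {q x : M} (hx : x ∈ frameSet L q) :
    h.form x (frame L q x) (frame L q x) = (Real.exp (-weight h q x) : ℝ) := by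
  rw [weight, neg_neg, Real.exp_log (form_frame_pos h hx)]
  exact Complex.ext rfl (by rw [form_frame_im, Complex.ofReal_im])

theorem form_frame_trans {q q' x : M} (hx : x ∈ frameSet L q) :
    h.form x (frame L q' x) (frame L q' x) =
      (normSq (transFun L q q' x) : ℂ) * h.form x (frame L q x) (frame L q x) := by
  rw [← transFun_smul_frame (q' := q') hx]
  simp only [LinearMap.map_smulₛₗ, map_smul, LinearMap.smul_apply, smul_eq_mul]
  rw [← Complex.mul_conj]
  ring

/-- Frames differ by a nowhere zero factor g, so weights differ by log |g|². For holomorphic g this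
is pluriharmonic, which is why i∂∂̄φ does not depend on the frame. -/
theorem weight_trans {q q' x : M} (hx : x ∈ frameSet L q) (hx' : x ∈ frameSet L q') :
    weight h q' x = weight h q x - Real.log (normSq (transFun L q q' x)) := by
  rw [weight, weight, form_frame_trans h hx, Complex.re_ofReal_mul, Real.log_mul
    (by simpa using transFun_ne_zero hx hx') (form_frame_pos h hx).ne']
  ring

/-- The metric `h^k` in the frame around `q`. -/
theorem powMetric_eq {q x : M} (hx : x ∈ frameSet L q) (v w : ⨂[ℂ]^k (L x)) :
    powMetric h k x v w = conj (powCoeff L k q x v) * powCoeff L k q x w *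
      (Real.exp (-(k * weight h q x)) : ℝ) := by
  have hxx := mem_frameSet L x
  rw [powMetric, form_frame_trans h (q := q) (q' := x) hx, form_frame_eq_exp h hx,
    powCoeff_trans (q := q) (q' := x) hxx v, powCoeff_trans (q := q) (q' := x) hxx w, mul_pow,
    ← Complex.ofReal_pow (Real.exp _), ← Real.exp_nat_mul, ← Complex.mul_conj]
  simp only [map_mul, map_pow]
  rw [show (k : ℝ) * -weight h q x = -(k * weight h q x) by ring]
  ring

theorem powMetric_self (x : M) (v : ⨂[ℂ]^k (L x)) :
    powMetric h k x v v =
      ((normSq (powCoeff L k x x v) * Real.exp (-(k * weight h x x)) : ℝ) : ℂ) := by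
  rw [powMetric_eq h (mem_frameSet L x), mul_comm (conj _), Complex.mul_conj]
  push_cast
  ring

theorem contMDiffOn_weight (q : M) :
    ContMDiffOn 𝓘(ℝ, Cm m) 𝓘(ℝ, ℝ) ∞ (weight h q) (frameSet L q) := by
  intro x hx
  have h1 : ContDiffAt ℝ ∞ (fun t : ℝ => -Real.log t)
      (h.form x (frame L q x) (frame L q x)).re :=
    (Real.contDiffAt_log.2 (form_frame_pos h hx).ne').neg
  exact ContMDiffAt.comp_contMDiffWithinAt (g := fun t : ℝ => -Real.log t)
    (f := fun x => (h.form x (frame L q x) (frame L q x)).re) x h1.contMDiffAt (h.smooth q x hx)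

end Frames

/-! ### From the global data to local Hamiltonian data in any chart and frame -/

section Local

variable {m : ℕ} {M : Type*} [TopologicalSpace M] [ChartedSpace (Cm m) M]
  [IsManifold 𝓘(ℂ, Cm m) ω M]
  {L : M → Type*} [∀ x, AddCommGroup (L x)] [∀ x, Module ℂ (L x)]
  [∀ x, TopologicalSpace (L x)] [TopologicalSpace (TotalSpace ℂ L)] [FiberBundle ℂ L]
  [VectorBundle ℂ ℂ L] [ContMDiffVectorBundle ω ℂ L 𝓘(ℂ, Cm m)] (h : HermitianMetric m L)
  {H : M → ℝ} {k : ℕ}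

/-- The set of coordinates of the points of the frame domain around `q` in the chart at `p`. -/
def dom (L : M → Type*) [∀ x, AddCommGroup (L x)] [∀ x, Module ℂ (L x)]
    [∀ x, TopologicalSpace (L x)] [TopologicalSpace (TotalSpace ℂ L)] [FiberBundle ℂ L]
    [VectorBundle ℂ ℂ L] (p q : M) : Set (Cm m) :=
  (chartAt (Cm m) p).target ∩ (chartAt (Cm m) p).symm ⁻¹' frameSet L q

/-- The weight of the metric for the frame around `q` in the chart at `p`. -/
def weightIn (p q : M) : Cm m → ℝ := weight h q ∘ (chartAt (Cm m) p).symm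

/-- The Hamiltonian vector field in the chart at `p`. -/
def field (H : M → ℝ) (p : M) (y : Cm m) : Cm m :=
  let x := (chartAt (Cm m) p).symm y
  fderiv ℝ (coordChange (Cm m) x p) (chartAt (Cm m) x x) (hamVF h H x : Cm m)

theorem isOpen_dom (p q : M) : IsOpen (dom (m := m) L p q) :=
  isOpen_chart_preimage p (isOpen_frameSet L q)

theorem mem_dom {p q x : M} (hp : x ∈ (chartAt (Cm m) p).source) (hq : x ∈ frameSet L q) :
    chartAt (Cm m) p x ∈ dom L p q :=
  ⟨(chartAt (Cm m) p).map_source hp, by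
    rw [Set.mem_preimage, (chartAt (Cm m) p).left_inv hp]; exact hq⟩

theorem contDiffOn_weightIn (p q : M) : ContDiffOn ℝ ∞ (weightIn h p q) (dom L p q) :=
  have := isManifold_real m M
  contDiffOn_comp_chart_symm ∞ (contMDiffOn_weight h q) p

/-- Change of the frame and of the chart for the Levi form of the weight. -/
theorem levi_weightIn_eq {p q p' q' x : M} (hp : x ∈ (chartAt (Cm m) p).source)
    (hq : x ∈ frameSet L q) (hp' : x ∈ (chartAt (Cm m) p').source) (hq' : x ∈ frameSet L q')
    (u v : Cm m) :
    levi (weightIn h p' q') (chartAt (Cm m) p' x) u v =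
      levi (weightIn h p q) (chartAt (Cm m) p x)
        (fderiv ℝ (coordChange (Cm m) p' p) (chartAt (Cm m) p' x) u)
        (fderiv ℝ (coordChange (Cm m) p' p) (chartAt (Cm m) p' x) v) := by
  have := isManifold_complex_infty m M
  set y' := chartAt (Cm m) p' x with hy'
  set g : Cm m → ℂ := transFun L q q' ∘ (chartAt (Cm m) p').symm with hg
  set V := (chartAt (Cm m) p').target ∩ (chartAt (Cm m) p').symm ⁻¹'
    (frameSet L q' ∩ frameSet L q) with hV
  have hVo : IsOpen V := isOpen_chart_preimage p' ((isOpen_frameSet L q').inter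
    (isOpen_frameSet L q))
  have hxV : y' ∈ V := ⟨(chartAt (Cm m) p').map_source hp', by
    rw [Set.mem_preimage, (chartAt (Cm m) p').left_inv hp']; exact ⟨hq', hq⟩⟩
  have hgd : ContDiffOn ℂ ∞ g V :=
    contDiffOn_comp_chart_symm ∞ ((contMDiffOn_transFun (m := m) q q').of_le le_top) p'
  have hc := contDiffOn_coordChange_complex (m := m) p' p
  have hmem : y' ∈ coordChangeDom (Cm m) p' p := mem_coordChangeDom hp' hp
  have hcy : coordChange (Cm m) p' p y' = chartAt (Cm m) p x := coordChange_apply hp'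
  have hg0 : g y' ≠ 0 := by
    simp only [hg, hy', Function.comp_apply, (chartAt (Cm m) p').left_inv hp']
    exact transFun_ne_zero hq hq'
  -- Changing the chart composes the weight with a holomorphic map; changing the frame subtracts the
  -- pluriharmonic function log |g|².
  have he : weightIn h p' q' =ᶠ[𝓝 y'] fun z =>
      (weightIn h p q ∘ coordChange (Cm m) p' p) z - Real.log (normSq (g z)) := by
    filter_upwards [hVo.mem_nhds hxV, (isOpen_coordChangeDom p' p).mem_nhds hmem] with z hz hz'
    simp only [weightIn, Function.comp_apply, coordChange, (chartAt (Cm m) p).left_inv hz'.2]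
    exact weight_trans h hz.2.2 hz.2.1
  have hφ : ContDiffAt ℝ 2 (weightIn h p q) (coordChange (Cm m) p' p y') := by
    rw [hcy]
    exact ((contDiffOn_weightIn h p q).contDiffAt
      ((isOpen_dom p q).mem_nhds (mem_dom hp hq))).of_le ENat.LEInfty.out
  have hc2 : ContDiffOn ℂ 2 (coordChange (Cm m) p' p) (coordChangeDom (Cm m) p' p) :=
    hc.of_le ENat.LEInfty.out
  have hcr : ContDiffAt ℝ 2 (coordChange (Cm m) p' p) y' :=
    (hc2.contDiffAt ((isOpen_coordChangeDom p' p).mem_nhds hmem)).restrict_scalars ℝ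
  have hg2 : ContDiffOn ℂ 2 g V := hgd.of_le ENat.LEInfty.out
  rw [levi_congr he, levi_sub (hφ.comp y' hcr)
    (contDiffAt_log_normSq ((hg2.contDiffAt (hVo.mem_nhds hxV)).restrict_scalars ℝ) hg0),
    levi_log_normSq_eq_zero hVo hg2 hxV hg0, sub_zero,
    levi_comp (isOpen_coordChangeDom p' p) hc2 hmem hφ, hcy]

theorem iddbar_weightIn_eq {p q p' q' x : M} (hp : x ∈ (chartAt (Cm m) p).source)
    (hq : x ∈ frameSet L q) (hp' : x ∈ (chartAt (Cm m) p').source) (hq' : x ∈ frameSet L q')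
    (u v : Cm m) :
    iddbar (weightIn h p' q') (chartAt (Cm m) p' x) u v =
      iddbar (weightIn h p q) (chartAt (Cm m) p x)
        (fderiv ℝ (coordChange (Cm m) p' p) (chartAt (Cm m) p' x) u)
        (fderiv ℝ (coordChange (Cm m) p' p) (chartAt (Cm m) p' x) v) := by
  simp only [iddbar, levi_weightIn_eq h hp hq hp' hq']

theorem fderiv_coordChange_I {x p z : M} (hx : z ∈ (chartAt (Cm m) x).source)
    (hp : z ∈ (chartAt (Cm m) p).source) (v : Cm m) :
    fderiv ℝ (coordChange (Cm m) x p) (chartAt (Cm m) x z) (I • v) =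
      I • fderiv ℝ (coordChange (Cm m) x p) (chartAt (Cm m) x z) v :=
  fderiv_real_I (differentiableAt_coordChange (mem_coordChangeDom hx hp)) v

theorem kahlerForm_eq {p q x : M} (hp : x ∈ (chartAt (Cm m) p).source) (hq : x ∈ frameSet L q)
    (u v : TangentSpace 𝓘(ℝ, Cm m) x) :
    kahlerForm h x u v = iddbar (weightIn h p q) (chartAt (Cm m) p x)
        (fderiv ℝ (coordChange (Cm m) x p) (chartAt (Cm m) x x) (u : Cm m))
        (fderiv ℝ (coordChange (Cm m) x p) (chartAt (Cm m) x x) (v : Cm m)) :=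
  iddbar_weightIn_eq h hp hq (mem_chart_source _ x) (mem_frameSet L x) (u : Cm m) (v : Cm m)

theorem iddbar_weightIn_pos (hpos : IsPositive h) {p q : M} {y : Cm m} (hy : y ∈ dom L p q)
    {u : Cm m} (hu : u ≠ 0) : 0 < iddbar (weightIn h p q) y u (I • u) := by
  have := isManifold_real_one m M
  set x := (chartAt (Cm m) p).symm y with hx
  have hp : x ∈ (chartAt (Cm m) p).source := (chartAt (Cm m) p).map_target hy.1
  have hxx := mem_chart_source (Cm m) x
  have hyx : chartAt (Cm m) p x = y := (chartAt (Cm m) p).right_inv hy.1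
  -- Positivity is assumed in the preferred chart at `x`, so the coordinate vector `u` is pulled
  -- back to that chart.
  set w : Cm m := fderiv ℝ (coordChange (Cm m) p x) (chartAt (Cm m) p x) u with hw
  have h1 : fderiv ℝ (coordChange (Cm m) x p) (chartAt (Cm m) x x) w = u :=
    fderiv_coordChange_comp hxx hp u
  have hw0 : w ≠ 0 := by
    intro h0
    rw [h0, map_zero] at h1
    exact hu h1.symm
  have h2 : 0 < kahlerMetric h x w w := hpos x w hw0
  have h3 : kahlerMetric h x w w = _ := kahlerForm_eq h hp hy.2 w (I • w)
  have h4 : (fderiv ℝ (coordChange (Cm m) x p) (chartAt (Cm m) x x) (I • w) : Cm m) = I • u := by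
    rw [fderiv_coordChange_I hxx hp, h1]
  rw [h3] at h2
  change 0 < iddbar (weightIn h p q) (chartAt (Cm m) p x)
    (fderiv ℝ (coordChange (Cm m) x p) (chartAt (Cm m) x x) w)
    (fderiv ℝ (coordChange (Cm m) x p) (chartAt (Cm m) x x) (I • w)) at h2
  rwa [h4, h1, hyx] at h2

theorem mfderiv_hamVF_eq {G : Type*} [NormedAddCommGroup G] [NormedSpace ℝ G] {F : M → G} {x p : M}
    (hF : ContMDiffAt 𝓘(ℝ, Cm m) 𝓘(ℝ, G) 1 F x) (hp : x ∈ (chartAt (Cm m) p).source) :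
    mfderiv 𝓘(ℝ, Cm m) 𝓘(ℝ, G) F x (hamVF h H x) =
      fderiv ℝ (F ∘ (chartAt (Cm m) p).symm) (chartAt (Cm m) p x)
        (field h H p (chartAt (Cm m) p x)) := by
  have := isManifold_real_one m M
  rw [mfderiv_eq_fderiv_coordChange hF hp]
  simp only [field]
  rw [(chartAt (Cm m) p).left_inv hp]

/-- The trivialization of the tangent bundle around `p` acts by the derivative of the coordinate
change, so holomorphy of the section, read in it, is complex differentiability of `field`. Complex
and real derivatives agree because coordinate changes are holomorphic. -/
theorem differentiableOn_field (hol : IsHolomorphicHamiltonian h H) (p : M) :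
    DifferentiableOn ℂ (field h H p) (chartAt (Cm m) p).target := by
  have := isManifold_complex_one m M
  have : IsManifold 𝓘(ℂ, Cm m) (1 + 1) M := IsManifold.of_le (n := ω) le_top
  intro y hy
  set x := (chartAt (Cm m) p).symm y with hx
  have hp : x ∈ (chartAt (Cm m) p).source := (chartAt (Cm m) p).map_target hy
  have h1 := hol x
  have hmem : x ∈ (trivializationAt (Cm m) (TangentSpace 𝓘(ℂ, Cm m)) p).baseSet := by
    rw [TangentBundle.trivializationAt_baseSet]; exact hp
  have h2 := (Trivialization.mdifferentiableAt_section_iff 𝓘(ℂ, Cm m)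
    (trivializationAt (Cm m) (TangentSpace 𝓘(ℂ, Cm m)) p)
    (fun x : M => (hamVF h H x : Cm m)) hmem).1 h1
  have h3 : MDifferentiableAt 𝓘(ℂ, Cm m) 𝓘(ℂ, Cm m) (chartAt (Cm m) p).symm y :=
    ((contMDiffOn_chart_symm (I := 𝓘(ℂ, Cm m)) (x := p) (n := 1)).contMDiffAt
      ((chartAt (Cm m) p).open_target.mem_nhds hy)).mdifferentiableAt (by simp)
  have h4 := (MDifferentiableAt.comp y h2 h3).differentiableAt
  refine (h4.congr_of_eventuallyEq ?_).differentiableWithinAt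
  filter_upwards [(chartAt (Cm m) p).open_target.mem_nhds hy] with z hz
  have hzs := (chartAt (Cm m) p).map_target hz
  have h5 := fderiv_real_eq (differentiableAt_coordChange (m := m)
    (mem_coordChangeDom (mem_chart_source _ _) hzs))
    (hamVF h H ((chartAt (Cm m) p).symm z) : Cm m)
  refine Eq.trans h5 ?_
  change _ = fderivWithin ℂ (coordChange (Cm m) ((chartAt (Cm m) p).symm z) p) (Set.range id) _ _
  rw [Set.range_id, fderivWithin_univ]
  rfl

/-- The bridge from M to ℂᵐ: the local theory applies in every chart `p` and every frame `q`, not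
only in the preferred ones in which the global objects are defined. -/
theorem isLocalHamiltonian (hpos : IsPositive h) (hH : ContMDiff 𝓘(ℝ, Cm m) 𝓘(ℝ, ℝ) ∞ H)
    (hol : IsHolomorphicHamiltonian h H) (p q : M) :
    IsLocalHamiltonian (dom L p q) (weightIn h p q) (H ∘ (chartAt (Cm m) p).symm)
      (field h H p) where
  isOpen := isOpen_dom p q
  potential := contDiffOn_weightIn h p q
  hamiltonian := by
    have := isManifold_real m M
    exact (contDiffOn_comp_chart_symm ∞ (hH.contMDiffOn (s := frameSet L q)) p)
  holomorphic := (differentiableOn_field h hol p).mono Set.inter_subset_left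
  pos := fun y hy u hu => iddbar_weightIn_pos h hpos hy hu
  eq := fun y hy v => by
    have := isManifold_real_one m M
    set x := (chartAt (Cm m) p).symm y with hx
    have hp : x ∈ (chartAt (Cm m) p).source := (chartAt (Cm m) p).map_target hy.1
    have hxx := mem_chart_source (Cm m) x
    have hyx : chartAt (Cm m) p x = y := (chartAt (Cm m) p).right_inv hy.1
    set w : Cm m := fderiv ℝ (coordChange (Cm m) p x) (chartAt (Cm m) p x) v with hw
    have h1 : fderiv ℝ (coordChange (Cm m) x p) (chartAt (Cm m) x x) w = v :=
      fderiv_coordChange_comp hxx hp v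
    have h2 := (kahlerForm_eq h hp hy.2 (hamVF h H x) w).symm.trans
      ((hamVF_spec h hpos H x w).trans
        (mfderiv_eq_fderiv_coordChange ((hH x).of_le (by simp)) hp w))
    change iddbar (weightIn h p q) (chartAt (Cm m) p x) _
      (fderiv ℝ (coordChange (Cm m) x p) (chartAt (Cm m) x x) w) =
        fderiv ℝ (H ∘ (chartAt (Cm m) p).symm) (chartAt (Cm m) p x)
          (fderiv ℝ (coordChange (Cm m) x p) (chartAt (Cm m) x x) w) at h2
    rw [h1, hyx] at h2
    exact h2

end Local

end

end KahlerQuant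

namespace KahlerQuant

noncomputable section

/-- The Wirtinger derivative `∂φ(w) = (dφ(w) - i dφ(iw)) / 2`. -/
def del {m : ℕ} (φ : Cm m → ℝ) (y w : Cm m) : ℂ :=
  (1 / 2) * ((fderiv ℝ φ y w : ℂ) - I * (fderiv ℝ φ y (I • w) : ℂ))

/-! ### The Wirtinger derivative ∂ -/

section Del

variable {m : ℕ} {y : Cm m} {φ φ' : Cm m → ℝ}

theorem del_congr (he : φ =ᶠ[𝓝 y] φ') (w : Cm m) : del φ y w = del φ' y w := by
  simp only [del, he.fderiv_eq]

theorem del_add (hφ : DifferentiableAt ℝ φ y) (hφ' : DifferentiableAt ℝ φ' y) (w : Cm m) :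
    del (fun z => φ z + φ' z) y w = del φ y w + del φ' y w := by
  simp only [del, fderiv_fun_add hφ hφ', add_apply, Complex.ofReal_add]
  ring

theorem del_I (φ : Cm m → ℝ) (y w : Cm m) : del φ y (I • w) = I * del φ y w := by
  have hII : I • I • w = -w := by rw [smul_smul, I_mul_I, neg_one_smul]
  simp only [del, hII, map_neg, Complex.ofReal_neg]
  linear_combination (1 / 2) * (fderiv ℝ φ y (I • w) : ℂ) * I_sq

theorem del_add_conj (φ : Cm m → ℝ) (y w : Cm m) :
    del φ y w + conj (del φ y w) = (fderiv ℝ φ y w : ℂ) := by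
  simp only [del, map_mul, map_sub, map_div₀, map_one, map_ofNat, Complex.conj_ofReal,
    Complex.conj_I]
  ring

/-- log |g|² = log g + conj (log g), and ∂ kills the antiholomorphic summand. This is the
connection's change of gauge. -/
theorem del_log_normSq {g : Cm m → ℂ} (hg : DifferentiableAt ℂ g y) (h0 : g y ≠ 0) (w : Cm m) :
    del (fun z => Real.log (normSq (g z))) y w = fderiv ℝ g y w / g y := by
  have hr : HasFDerivAt g (fderiv ℝ g y) y := (hg.restrictScalars ℝ).hasFDerivAt
  have h1 : HasFDerivAt (fun z => (g z).re) (Complex.reCLM.comp (fderiv ℝ g y)) y :=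
    Complex.reCLM.hasFDerivAt.comp y hr
  have h2 : HasFDerivAt (fun z => (g z).im) (Complex.imCLM.comp (fderiv ℝ g y)) y :=
    Complex.imCLM.hasFDerivAt.comp y hr
  have h3 : HasFDerivAt (fun z => normSq (g z)) _ y := (h1.mul h1).add (h2.mul h2)
  have hn : normSq (g y) ≠ 0 := by simpa using h0
  have h4 := h3.log hn
  have hI := fderiv_real_I hg w
  rw [del, h4.fderiv]
  simp only [smul_apply, add_apply, ContinuousLinearMap.comp_apply, hI, Complex.reCLM_apply,
    Complex.imCLM_apply, smul_eq_mul, Complex.I_re, Complex.I_im, Complex.mul_re, Complex.mul_im]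
  rw [div_eq_mul_inv _ (g y), Complex.inv_def]
  generalize fderiv ℝ g y w = b at *
  apply Complex.ext
  · simp
    ring
  · simp
    ring

end Del

/-! ### The Chern connection and the operator H + (i/k)∇_ξ -/

section Chern

variable {m : ℕ} {M : Type*} [TopologicalSpace M] [ChartedSpace (Cm m) M]
  [IsManifold 𝓘(ℂ, Cm m) ω M]
  {L : M → Type*} [∀ x, AddCommGroup (L x)] [∀ x, Module ℂ (L x)]
  [∀ x, TopologicalSpace (L x)] [TopologicalSpace (TotalSpace ℂ L)] [FiberBundle ℂ L]
  [VectorBundle ℂ ℂ L] [ContMDiffVectorBundle ω ℂ L 𝓘(ℂ, Cm m)] (h : HermitianMetric m L)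
  {H : M → ℝ} {k : ℕ} {s t : PowSection L k}

/-- The coefficient of a section for the frame around `q` in the chart at `p`. -/
def repIn (s : PowSection L k) (p q : M) : Cm m → ℂ :=
  localRep L s q ∘ (chartAt (Cm m) p).symm

theorem contDiffOn_repIn (hs : s ∈ holSections m L k) (p q : M) :
    ContDiffOn ℂ ∞ (repIn s p q) (dom (m := m) L p q) :=
  have := isManifold_complex_infty m M
  contDiffOn_comp_chart_symm ∞ (hs q) p

theorem differentiableAt_repIn (hs : s ∈ holSections m L k) {p q : M} {y : Cm m}
    (hy : y ∈ dom L p q) : DifferentiableAt ℂ (repIn s p q) y :=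
  ((contDiffOn_repIn hs p q).contDiffAt ((isOpen_dom p q).mem_nhds hy)).differentiableAt (by simp)

theorem contMDiffOn_localRep_real (hs : s ∈ holSections m L k) (q : M) :
    ContMDiffOn 𝓘(ℝ, Cm m) 𝓘(ℝ, ℂ) ∞ (localRep L s q) (frameSet L q) := by
  have := isManifold_real m M
  intro x hx
  have h1 := (contDiffOn_repIn hs x q).contDiffAt
    ((isOpen_dom x q).mem_nhds (mem_dom (mem_chart_source _ x) hx))
  exact (contMDiffAt_of_comp_chart_symm ∞ (mem_chart_source (Cm m) x)
    (h1.restrict_scalars ℝ)).contMDiffWithinAt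

theorem differentiableAt_weightIn {p q : M} {y : Cm m} (hy : y ∈ dom L p q) :
    DifferentiableAt ℝ (weightIn h p q) y :=
  ((contDiffOn_weightIn h p q).contDiffAt ((isOpen_dom p q).mem_nhds hy)).differentiableAt
    (by simp)

/-- The Chern connection in the preferred chart and frame, for a holomorphic section. -/
theorem chernDeriv_eq (hs : s ∈ holSections m L k) (x : M) (u : Cm m) :
    chernDeriv h s x u = (fderiv ℝ (repIn s x x) (chartAt (Cm m) x x) u -
      k * localRep L s x x * del (weightIn h x x) (chartAt (Cm m) x x) u) •
        tpow k (frame L x x) := by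
  have h1 : ContMDiffAt 𝓘(ℝ, Cm m) 𝓘(ℝ, ℂ) ∞ (localRep L s x) x :=
    (contMDiffOn_localRep_real hs x).contMDiffAt ((isOpen_frameSet L x).mem_nhds (mem_frameSet L x))
  have h2 : ContMDiffAt 𝓘(ℝ, Cm m) 𝓘(ℝ, ℝ) ∞ (weight h x) x :=
    (contMDiffOn_weight h x).contMDiffAt ((isOpen_frameSet L x).mem_nhds (mem_frameSet L x))
  have e1 := mfderiv_eq_fderiv (h1.mdifferentiableAt (by simp)) u
  have e2 := fun w : Cm m => mfderiv_eq_fderiv (h2.mdifferentiableAt (by simp)) w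
  have key : ∀ (a a' : ℂ) (b b' c c' : ℝ), a = a' → b = b' → c = c' →
      (a - k * localRep L s x x * ((1 / 2) * ((b : ℂ) - I * (c : ℂ)))) • tpow k (frame L x x) =
        (a' - k * localRep L s x x * ((1 / 2) * ((b' : ℂ) - I * (c' : ℂ)))) •
          tpow k (frame L x x) := by
    rintro a a' b b' c c' rfl rfl rfl
    rfl
  exact key _ _ _ _ _ _ e1 (e2 u) (e2 (I • u))

/-- For a holomorphic coefficient both `df` and ∂φ are complex linear in the direction. This
converts ∇_ξ into the derivative along the gradient Jξ. -/
theorem chernDeriv_J (hs : s ∈ holSections m L k) (x : M) (u : Cm m) :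
    chernDeriv h s x (J x u) = I • chernDeriv h s x u := by
  have h1 := chernDeriv_eq h hs x (I • u)
  have h2 := chernDeriv_eq h hs x (u : Cm m)
  refine h1.trans (Eq.trans ?_ (congrArg (fun v => I • v) h2).symm)
  have hd : DifferentiableAt ℂ (repIn s x x) (chartAt (Cm m) x x) :=
    differentiableAt_repIn hs (mem_dom (mem_chart_source _ x) (mem_frameSet L x))
  rw [fderiv_real_I hd, del_I, smul_smul]
  congr 1
  rw [smul_eq_mul]
  ring

/-- The coefficient of the Chern derivative in an arbitrary chart and frame. -/
theorem powCoeff_chernDeriv (hs : s ∈ holSections m L k) {p q x : M}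
    (hp : x ∈ (chartAt (Cm m) p).source) (hq : x ∈ frameSet L q) (u : Cm m) :
    powCoeff L k q x (chernDeriv h s x u) =
      fderiv ℝ (repIn s p q) (chartAt (Cm m) p x)
          (fderiv ℝ (coordChange (Cm m) x p) (chartAt (Cm m) x x) u) -
        k * localRep L s q x * del (weightIn h p q) (chartAt (Cm m) p x)
          (fderiv ℝ (coordChange (Cm m) x p) (chartAt (Cm m) x x) u) := by
  have := isManifold_complex_infty m M
  have hxx := mem_chart_source (Cm m) x
  have hqx := mem_frameSet L x
  set y := chartAt (Cm m) x x with hy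
  set c := coordChange (Cm m) x p with hc
  have hcd : DifferentiableAt ℂ c y := differentiableAt_coordChange (mem_coordChangeDom hxx hp)
  have hcr : DifferentiableAt ℝ c y := hcd.restrictScalars ℝ
  have hcy : c y = chartAt (Cm m) p x := coordChange_apply hxx
  set g : Cm m → ℂ := transFun L x q ∘ (chartAt (Cm m) x).symm with hg
  set V := (chartAt (Cm m) x).target ∩ (chartAt (Cm m) x).symm ⁻¹'
    (frameSet L q ∩ frameSet L x) with hV
  have hVo : IsOpen V := isOpen_chart_preimage x ((isOpen_frameSet L q).inter
    (isOpen_frameSet L x))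
  have hyV : y ∈ V := ⟨(chartAt (Cm m) x).map_source hxx, by
    rw [Set.mem_preimage, (chartAt (Cm m) x).left_inv hxx]; exact ⟨hq, hqx⟩⟩
  have hgd : DifferentiableAt ℂ g y :=
    ((contDiffOn_comp_chart_symm ∞ ((contMDiffOn_transFun (m := m) x q).of_le le_top)
      x).contDiffAt (hVo.mem_nhds hyV)).differentiableAt (by simp)
  have hgy : g y = transFun L x q x := by
    simp only [hg, hy, Function.comp_apply, (chartAt (Cm m) x).left_inv hxx]
  have hg0 : g y ≠ 0 := by rw [hgy]; exact transFun_ne_zero hqx hq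
  have hdom : c y ∈ dom L p q := by rw [hcy]; exact mem_dom hp hq
  have hf : DifferentiableAt ℂ (repIn s p q) (c y) := differentiableAt_repIn hs hdom
  have hw : DifferentiableAt ℝ (weightIn h p q) (c y) := differentiableAt_weightIn h hdom
  have hfx : repIn s x x =ᶠ[𝓝 y] fun z => g z ^ k * (repIn s p q ∘ c) z := by
    filter_upwards [hVo.mem_nhds hyV,
      (isOpen_coordChangeDom x p).mem_nhds (mem_coordChangeDom hxx hp)] with z hz hz'
    simp only [repIn, Function.comp_apply, hc, coordChange, (chartAt (Cm m) p).left_inv hz'.2, hg]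
    exact localRep_trans hz.2.1 s
  have hwx : weightIn h x x =ᶠ[𝓝 y] fun z => (weightIn h p q ∘ c) z +
      Real.log (normSq (g z)) := by
    filter_upwards [hVo.mem_nhds hyV,
      (isOpen_coordChangeDom x p).mem_nhds (mem_coordChangeDom hxx hp)] with z hz hz'
    simp only [weightIn, Function.comp_apply, hc, coordChange,
      (chartAt (Cm m) p).left_inv hz'.2, hg]
    rw [weight_trans h (q := x) (q' := q) hz.2.2 hz.2.1]
    ring
  rw [chernDeriv_eq h hs x u, map_smul, powCoeff_trans (q := q) (q' := x) hqx,
    powCoeff_tpow_frame hqx, smul_eq_mul, mul_one]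
  have hinv : transFun L q x x * transFun L x q x = 1 := by
    have h1 := linearMapAt_trans (q := q) (q' := x) hqx (frame L q x)
    rw [linearMapAt_frame hq] at h1
    exact h1.symm
  -- Gauge invariance: f changes by g^k and φ by log |g|². The term k g^(k-1) dg f produced here is
  -- cancelled by k f times the summand dg/g in `d2`.
  have d1 : fderiv ℝ (repIn s x x) y u = (k : ℂ) * g y ^ (k - 1) * fderiv ℝ g y u *
      repIn s p q (c y) + g y ^ k * fderiv ℝ (repIn s p q) (c y) (fderiv ℝ c y u) := by
    have a1 := (hgd.restrictScalars ℝ).hasFDerivAt.pow k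
    have a2 := (hf.restrictScalars ℝ).hasFDerivAt.comp y hcr.hasFDerivAt
    have a3 : HasFDerivAt (fun z => g z ^ k * (repIn s p q ∘ c) z) _ y := a1.mul a2
    rw [hfx.fderiv_eq, a3.fderiv]
    simp
    ring
  have d2 : del (weightIn h x x) y u =
      del (weightIn h p q) (c y) (fderiv ℝ c y u) + fderiv ℝ g y u / g y := by
    rw [del_congr hwx, del_add (hw.comp y hcr) ((contDiffAt_log_normSq (k := 1)
      (((contDiffOn_comp_chart_symm ∞ ((contMDiffOn_transFun (m := m) x q).of_le le_top)
      x).contDiffAt (hVo.mem_nhds hyV)).restrict_scalars ℝ |>.of_le (by simp))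
        hg0).differentiableAt (by simp)), del_log_normSq hgd hg0]
    congr 1
    simp only [del]
    rw [fderiv_comp y hw hcr]
    simp only [ContinuousLinearMap.comp_apply, fderiv_real_I hcd]
  have d3 : localRep L s x x = g y ^ k * localRep L s q x := by
    rw [hgy]; exact localRep_trans hq s
  have d4 : repIn s p q (c y) = localRep L s q x := by
    rw [hcy]; simp only [repIn, Function.comp_apply, (chartAt (Cm m) p).left_inv hp]
  rw [d1, d2, d3, d4, hcy]
  have d5 : transFun L q x x ^ k * g y ^ k = 1 := by rw [hgy, ← mul_pow, hinv, one_pow]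
  -- The truncated exponent at `k = 0` is harmless because of the factor `k`.
  have d6 : (k : ℂ) * g y ^ (k - 1) = k * g y ^ k / g y := by
    rcases Nat.eq_zero_or_pos k with hk | hk
    · simp [hk]
    · rw [eq_div_iff hg0, mul_assoc, ← pow_succ, Nat.sub_add_cancel hk]
  rw [d6]
  linear_combination (fderiv ℝ (repIn s p q) (chartAt (Cm m) p x) (fderiv ℝ c y u) -
    k * localRep L s q x * del (weightIn h p q) (chartAt (Cm m) p x) (fderiv ℝ c y u)) * d5

/-- The operator `H + (i/k) ∇_{ξ_H}` before projection. -/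
def prequantum (H : M → ℝ) (s : PowSection L k) : PowSection L k := fun x =>
  (H x : ℂ) • s x + (I / k) • chernDeriv h s x (hamVF h H x)

/-- The connection term -k ∂φ(ξ), multiplied by i/k, completes `H` to the holomorphic function
`moment`. What remains is a first-order differential operator with holomorphic coefficients. -/
theorem localRep_prequantum (hk : k ≠ 0) (hs : s ∈ holSections m L k) {p q : M} {y : Cm m}
    (hy : y ∈ dom L p q) :
    localRep L (prequantum h H s) q ((chartAt (Cm m) p).symm y) =
      IsLocalHamiltonian.moment (weightIn h p q) (H ∘ (chartAt (Cm m) p).symm) (field h H p) y *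
        repIn s p q y + (I / k) * fderiv ℂ (repIn s p q) y (field h H p y) := by
  set x := (chartAt (Cm m) p).symm y with hx
  have hp : x ∈ (chartAt (Cm m) p).source := (chartAt (Cm m) p).map_target hy.1
  have hyx : chartAt (Cm m) p x = y := (chartAt (Cm m) p).right_inv hy.1
  have h1 := powCoeff_chernDeriv h hs hp hy.2 (hamVF h H x)
  have h2 : fderiv ℝ (coordChange (Cm m) x p) (chartAt (Cm m) x x) (hamVF h H x : Cm m) =
    field h H p y := rfl
  have h3 : localRep L (prequantum h H s) q x = (H x : ℂ) * localRep L s q x + (I / k) *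
      powCoeff L k q x (chernDeriv h s x (hamVF h H x)) := by
    simp only [localRep, prequantum, map_add, map_smul, smul_eq_mul]
  have h4 : localRep L s q x = repIn s p q y := rfl
  have hk' : (k : ℂ) ≠ 0 := by exact_mod_cast hk
  have h5 : powCoeff L k q x (chernDeriv h s x (hamVF h H x)) =
      fderiv ℂ (repIn s p q) y (field h H p y) - k * repIn s p q y *
        del (weightIn h p q) y (field h H p y) := by
    refine h1.trans ?_
    rw [h2, hyx, fderiv_real_eq (differentiableAt_repIn hs hy), h4]
  have h6 : IsLocalHamiltonian.moment (weightIn h p q) (H ∘ (chartAt (Cm m) p).symm)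
      (field h H p) y = (H x : ℂ) - I * del (weightIn h p q) y (field h H p y) := rfl
  rw [h3, h5, h4, h6]
  field_simp
  ring

/-- `H + (i/k) ∇_{ξ_H}` preserves holomorphic sections. -/
theorem prequantum_mem (hpos : IsPositive h) (hH : ContMDiff 𝓘(ℝ, Cm m) 𝓘(ℝ, ℝ) ∞ H)
    (hol : IsHolomorphicHamiltonian h H) (hk : k ≠ 0) (hs : s ∈ holSections m L k) :
    prequantum h H s ∈ holSections m L k := by
  have := isManifold_complex_infty m M
  intro q x hx
  have hl := isLocalHamiltonian h hpos hH hol x q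
  have hmem : chartAt (Cm m) x x ∈ dom L x q := mem_dom (mem_chart_source _ x) hx
  refine (contMDiffAt_of_comp_chart_symm ∞ (mem_chart_source (Cm m) x) ?_).contMDiffWithinAt
  have hr := contDiffOn_repIn hs x q
  have h1 : ContDiffOn ℂ ∞ (fun y => IsLocalHamiltonian.moment (weightIn h x q)
      (H ∘ (chartAt (Cm m) x).symm) (field h H x) y * repIn s x q y +
        (I / k) * fderiv ℂ (repIn s x q) y (field h H x y)) (dom (m := m) L x q) :=
    (hl.contDiffOn_moment.mul hr).add (contDiffOn_const.mul
      ((hr.fderiv_of_isOpen hl.isOpen (m := ∞) (by simp)).clm_apply hl.contDiffOn_field))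
  refine (h1.contDiffAt (hl.isOpen.mem_nhds hmem)).congr_of_eventuallyEq ?_
  filter_upwards [hl.isOpen.mem_nhds hmem] with y hy
  exact localRep_prequantum h hk hs hy

/-- The pointwise inner product of two holomorphic sections in a chart and a frame. -/
theorem powMetric_comp_chart {p q : M} {y : Cm m} (hy : y ∈ dom L p q) :
    powMetric h k ((chartAt (Cm m) p).symm y) (s ((chartAt (Cm m) p).symm y))
      (t ((chartAt (Cm m) p).symm y)) = conj (repIn s p q y) * repIn t p q y *
        (Real.exp (-(k * weightIn h p q y)) : ℝ) :=
  powMetric_eq h hy.2 _ _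

theorem contMDiff_powMetric (hs : s ∈ holSections m L k) (ht : t ∈ holSections m L k) :
    ContMDiff 𝓘(ℝ, Cm m) 𝓘(ℝ, ℂ) ∞ (fun x => powMetric h k x (s x) (t x)) := by
  have := isManifold_real m M
  intro x
  have hmem : chartAt (Cm m) x x ∈ dom L x x :=
    mem_dom (mem_chart_source _ x) (mem_frameSet L x)
  have hn := (isOpen_dom x x).mem_nhds hmem
  refine contMDiffAt_of_comp_chart_symm ∞ (mem_chart_source (Cm m) x) ?_
  have h1 := ((contDiffOn_repIn hs x x).contDiffAt hn).restrict_scalars ℝ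
  have h2 := ((contDiffOn_repIn ht x x).contDiffAt hn).restrict_scalars ℝ
  have h3 := (contDiffOn_weightIn h x x).contDiffAt hn
  have h4 : ContDiffAt ℝ ∞ (fun y => conj (repIn s x x y) * repIn t x x y *
        (Real.exp (-(k * weightIn h x x y)) : ℝ)) (chartAt (Cm m) x x) :=
    ((Complex.conjCLE.contDiff.contDiffAt.comp _ h1).mul h2).mul
      (Complex.ofRealCLM.contDiff.contDiffAt.comp _
        (Real.contDiff_exp.contDiffAt.comp _ (contDiffAt_const.mul h3).neg))
  refine h4.congr_of_eventuallyEq ?_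
  filter_upwards [hn] with y hy
  exact powMetric_comp_chart h hy

/-- The Chern connection is compatible with the metric. -/
theorem mfderiv_powMetric (hs : s ∈ holSections m L k) (ht : t ∈ holSections m L k) (x : M)
    (u : Cm m) :
    mfderiv 𝓘(ℝ, Cm m) 𝓘(ℝ, ℂ) (fun x => powMetric h k x (s x) (t x)) x u =
      powMetric h k x (chernDeriv h s x u) (t x) + powMetric h k x (s x) (chernDeriv h t x u) := by
  have hmem : chartAt (Cm m) x x ∈ dom L x x :=
    mem_dom (mem_chart_source _ x) (mem_frameSet L x)
  have hn := (isOpen_dom x x).mem_nhds hmem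
  have hx := mem_frameSet L x
  set y := chartAt (Cm m) x x with hy
  have e1 := mfderiv_eq_fderiv (((contMDiff_powMetric h hs ht) x).mdifferentiableAt (by simp)) u
  refine e1.trans ?_
  have he : (fun x => powMetric h k x (s x) (t x)) ∘ (chartAt (Cm m) x).symm =ᶠ[𝓝 y]
      fun y => conj (repIn s x x y) * repIn t x x y *
        (Real.exp (-(k * weightIn h x x y)) : ℝ) := by
    filter_upwards [hn] with y hy
    exact powMetric_comp_chart h hy
  have h1 := ((differentiableAt_repIn hs hmem).restrictScalars ℝ).hasFDerivAt
  have h2 := ((differentiableAt_repIn ht hmem).restrictScalars ℝ).hasFDerivAt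
  have h3 := (differentiableAt_weightIn h hmem).hasFDerivAt
  have h4 : HasFDerivAt (fun y => conj (repIn s x x y)) _ y :=
    Complex.conjCLE.toContinuousLinearMap.hasFDerivAt.comp y h1
  have h5 : HasFDerivAt (fun y => ((Real.exp (-(k * weightIn h x x y)) : ℝ) : ℂ)) _ y :=
    Complex.ofRealCLM.hasFDerivAt.comp y (h3.const_mul (k : ℝ)).neg.exp
  have h6 : HasFDerivAt (fun y => conj (repIn s x x y) * repIn t x x y *
      ((Real.exp (-(k * weightIn h x x y)) : ℝ) : ℂ)) _ y := (h4.mul h2).mul h5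
  have e2 := chernDeriv_eq h hs x (u : Cm m)
  have e3 := chernDeriv_eq h ht x (u : Cm m)
  have pl : ∀ (a : ℂ) (v : ⨂[ℂ]^k (L x)), powMetric h k x (a • tpow k (frame L x x)) v =
      conj a * powCoeff L k x x v * (Real.exp (-(k * weight h x x)) : ℝ) := fun a v => by
    rw [powMetric_eq h hx, map_smul, powCoeff_tpow_frame hx, smul_eq_mul, mul_one]
  have pr : ∀ (a : ℂ) (v : ⨂[ℂ]^k (L x)), powMetric h k x v (a • tpow k (frame L x x)) =
      conj (powCoeff L k x x v) * a * (Real.exp (-(k * weight h x x)) : ℝ) := fun a v => by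
    rw [powMetric_eq h hx, map_smul, powCoeff_tpow_frame hx, smul_eq_mul, mul_one]
  have e4 := (congrArg (fun v => powMetric h k x v (t x)) e2).trans (pl _ _)
  have e5 := (congrArg (fun v => powMetric h k x (s x) v) e3).trans (pr _ _)
  rw [e4, e5, he.fderiv_eq, h6.fderiv, ← hy]
  have r1 : powCoeff L k x x (t x) = localRep L t x x := rfl
  have r2 : powCoeff L k x x (s x) = localRep L s x x := rfl
  have r3 : ∀ s : PowSection L k, repIn s x x y = localRep L s x x := fun s => by
    simp only [repIn, hy, Function.comp_apply, (chartAt (Cm m) x).left_inv (mem_chart_source _ x)]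
  have r4 : weightIn h x x y = weight h x x := by
    simp only [weightIn, hy, Function.comp_apply,
      (chartAt (Cm m) x).left_inv (mem_chart_source _ x)]
  rw [r1, r2]
  -- The factor e^(-kφ) contributes -k dφ = -k ∂φ - k conj(∂φ); one summand belongs to each of the
  -- two covariant derivatives.
  have r5 := del_add_conj (weightIn h x x) y (u : Cm m)
  simp only [add_apply, smul_apply, ContinuousLinearMap.comp_apply, r3, r4, smul_eq_mul, map_sub,
    map_mul, map_natCast, neg_apply, Complex.ofRealCLM_apply, Complex.ofReal_mul,
    Complex.ofReal_neg]
  change _ * (_ * (-(_ * ((fderiv ℝ (weightIn h x x) y (u : Cm m) : ℝ) : ℂ)))) + _ = _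
  rw [← r5]
  simp only [Pi.mul_apply, Pi.neg_apply, r3, r4]
  simp
  ring

end Chern

end

end KahlerQuant

namespace KahlerQuant

noncomputable section

/-! ### The volume density in charts -/

section Density

variable {m : ℕ} {M : Type*} [TopologicalSpace M] [ChartedSpace (Cm m) M]
  [IsManifold 𝓘(ℂ, Cm m) ω M]
  {L : M → Type*} [∀ x, AddCommGroup (L x)] [∀ x, Module ℂ (L x)]
  [∀ x, TopologicalSpace (L x)] [TopologicalSpace (TotalSpace ℂ L)] [FiberBundle ℂ L]
  [VectorBundle ℂ ℂ L] [ContMDiffVectorBundle ω ℂ L 𝓘(ℂ, Cm m)] (h : HermitianMetric m L)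

theorem fderiv_coordChange_self {p z : M} (hz : z ∈ (chartAt (Cm m) p).source) (v : Cm m) :
    fderiv ℝ (coordChange (Cm m) p p) (chartAt (Cm m) p z) v = v := by
  have he : coordChange (Cm m) p p =ᶠ[𝓝 (chartAt (Cm m) p z)] id := by
    filter_upwards [(chartAt (Cm m) p).open_target.mem_nhds ((chartAt (Cm m) p).map_source hz)]
      with y hy
    exact (chartAt (Cm m) p).right_inv hy
  rw [he.fderiv_eq, fderiv_id]
  rfl

/-- The definition takes the frame around the moving point. The Levi form does not see the frame, so
near a point one fixed frame can be used; without this the density would not visibly be smooth. -/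
theorem volumeDensity_eq {p q : M} {y : Cm m} (hy : y ∈ dom L p q) :
    volumeDensity h p y = 2 ^ m * (leviMatrix (weightIn h p q) y).det.re := by
  set x := (chartAt (Cm m) p).symm y with hx
  have hp : x ∈ (chartAt (Cm m) p).source := (chartAt (Cm m) p).map_target hy.1
  have hyx : chartAt (Cm m) p x = y := (chartAt (Cm m) p).right_inv hy.1
  have h1 : leviMatrix (weightIn h p x) y = leviMatrix (weightIn h p q) y := by
    ext j k
    simp only [leviMatrix, Matrix.of_apply]
    have h2 := levi_weightIn_eq h hp hy.2 hp (mem_frameSet L x) (Pi.single j 1) (Pi.single k 1)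
    rwa [fderiv_coordChange_self hp, fderiv_coordChange_self hp, hyx] at h2
  rw [← h1]
  rfl

theorem exists_mem_dom {p : M} {y : Cm m} (hy : y ∈ (chartAt (Cm m) p).target) :
    y ∈ dom L p ((chartAt (Cm m) p).symm y) := ⟨hy, mem_frameSet L _⟩

theorem volumeDensity_pos (hpos : IsPositive h) {p : M} {y : Cm m}
    (hy : y ∈ (chartAt (Cm m) p).target) : 0 < volumeDensity h p y := by
  have hd := exists_mem_dom (L := L) hy
  rw [volumeDensity_eq h hd]
  have h1 : ContDiffAt ℝ 2 (weightIn h p ((chartAt (Cm m) p).symm y)) y :=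
    ((contDiffOn_weightIn h p _).contDiffAt ((isOpen_dom p _).mem_nhds hd)).of_le ENat.LEInfty.out
  have := leviMatrix_det_pos h1 fun u hu => iddbar_weightIn_pos h hpos hd hu
  positivity

theorem contDiffAt_volumeDensity {p : M} {y : Cm m} (hy : y ∈ (chartAt (Cm m) p).target) :
    ContDiffAt ℝ ∞ (volumeDensity h p) y := by
  have hd := exists_mem_dom (L := L) hy
  set q := (chartAt (Cm m) p).symm y
  have hn := (isOpen_dom (L := L) p q).mem_nhds hd
  have h1 := Complex.reCLM.contDiff.contDiffAt.comp y
    (IsLocalHamiltonian.contDiffAt_leviMatrix_det ((contDiffOn_weightIn h p q).contDiffAt hn))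
  refine ContDiffAt.congr_of_eventuallyEq
    ((contDiffAt_const (c := (2 : ℝ) ^ m)).mul h1) ?_
  filter_upwards [hn] with z hz
  exact volumeDensity_eq h hz

theorem continuousOn_volumeDensity (p : M) :
    ContinuousOn (volumeDensity h p) (chartAt (Cm m) p).target := fun _ hy =>
  (contDiffAt_volumeDensity h hy).continuousAt.continuousWithinAt

/-- Change of charts for the volume density. -/
theorem volumeDensity_coordChange {p p' : M} {y : Cm m} (hy : y ∈ coordChangeDom (Cm m) p p') :
    volumeDensity h p y = |(fderiv ℝ (coordChange (Cm m) p p') y).det| *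
      volumeDensity h p' (coordChange (Cm m) p p' y) := by
  set q := (chartAt (Cm m) p).symm y with hq
  have hd : y ∈ dom L p q := exists_mem_dom hy.1
  have hd' : coordChange (Cm m) p p' y ∈ dom L p' q := mem_dom hy.2 (mem_frameSet L q)
  have he : weightIn h p q =ᶠ[𝓝 y] weightIn h p' q ∘ coordChange (Cm m) p p' := by
    filter_upwards [(isOpen_coordChangeDom p p').mem_nhds hy] with z hz
    simp only [weightIn, Function.comp_apply, coordChange, (chartAt (Cm m) p').left_inv hz.2]
  have h1 : leviMatrix (weightIn h p q) y =
      leviMatrix (weightIn h p' q ∘ coordChange (Cm m) p p') y := by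
    ext j k
    simp only [leviMatrix, Matrix.of_apply, levi_congr he]
  have h2 : ContDiffAt ℝ 2 (weightIn h p' q) (coordChange (Cm m) p p' y) :=
    ((contDiffOn_weightIn h p' _).contDiffAt
      ((isOpen_dom p' _).mem_nhds hd')).of_le ENat.LEInfty.out
  rw [volumeDensity_eq h hd, volumeDensity_eq h hd', h1, leviMatrix_comp_det
    (isOpen_coordChangeDom p p') ((contDiffOn_coordChange_complex p p').of_le ENat.LEInfty.out)
      hy h2]
  ring

end Density

/-! ### The Kähler volume measure -/

section Volume

variable {m : ℕ} {M : Type*} [TopologicalSpace M] [ChartedSpace (Cm m) M]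
  [IsManifold 𝓘(ℂ, Cm m) ω M] [CompactSpace M] [MeasurableSpace M] [BorelSpace M]
  {L : M → Type*} [∀ x, AddCommGroup (L x)] [∀ x, Module ℂ (L x)]
  [∀ x, TopologicalSpace (L x)] [TopologicalSpace (TotalSpace ℂ L)] [FiberBundle ℂ L]
  [VectorBundle ℂ ℂ L] [ContMDiffVectorBundle ω ℂ L 𝓘(ℂ, Cm m)] (h : HermitianMetric m L)

theorem measurableSet_chart_preimage (p : M) {S : Set M} (hS : MeasurableSet S) :
    MeasurableSet ((chartAt (Cm m) p).target ∩ (chartAt (Cm m) p).symm ⁻¹' S) := by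
  have h1 := (continuousOn_iff_continuous_domRestrict.1
    (chartAt (Cm m) p).continuousOn_symm).measurable hS
  have h2 := (chartAt (Cm m) p).open_target.measurableSet.subtype_image h1
  convert h2 using 1
  ext y
  simp [and_comm]

/-- The Kähler volume of a subset of the domain of the chart at `p`. -/
def chartVolume (p : M) (S : Set M) : ENNReal :=
  ∫⁻ y in (chartAt (Cm m) p).target ∩ (chartAt (Cm m) p).symm ⁻¹' S,
    ENNReal.ofReal (volumeDensity h p y)

/-- Change of variables in the integral: the Jacobian is exactly the factor by which the density
transforms. -/
theorem chartVolume_eq {p p' : M} {S : Set M} (hS : MeasurableSet S)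
    (hp : S ⊆ (chartAt (Cm m) p).source) (hp' : S ⊆ (chartAt (Cm m) p').source) :
    chartVolume h p S = chartVolume h p' S := by
  set T := (chartAt (Cm m) p).target ∩ (chartAt (Cm m) p).symm ⁻¹' S with hT
  set T' := (chartAt (Cm m) p').target ∩ (chartAt (Cm m) p').symm ⁻¹' S with hT'
  have hTd : T ⊆ coordChangeDom (Cm m) p p' := fun y hy => ⟨hy.1, hp' hy.2⟩
  have hder : ∀ y ∈ T, HasFDerivWithinAt (coordChange (Cm m) p p')
      (fderiv ℝ (coordChange (Cm m) p p') y) T y := fun y hy =>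
    ((differentiableAt_coordChange (hTd hy)).restrictScalars ℝ).hasFDerivAt.hasFDerivWithinAt
  have hinj : Set.InjOn (coordChange (Cm m) p p') T := by
    intro y hy z hz hyz
    have h1 := (chartAt (Cm m) p').injOn (hTd hy).2 (hTd hz).2 hyz
    exact (chartAt (Cm m) p).symm.injOn hy.1 hz.1 h1
  have himg : coordChange (Cm m) p p' '' T = T' := by
    apply Set.Subset.antisymm
    · rintro _ ⟨y, hy, rfl⟩
      refine ⟨(chartAt (Cm m) p').map_source (hTd hy).2, ?_⟩
      rw [Set.mem_preimage, coordChange, Function.comp_apply,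
        (chartAt (Cm m) p').left_inv (hTd hy).2]
      exact hy.2
    · intro z hz
      refine ⟨chartAt (Cm m) p ((chartAt (Cm m) p').symm z),
        ⟨(chartAt (Cm m) p).map_source (hp hz.2), ?_⟩, ?_⟩
      · rw [Set.mem_preimage, (chartAt (Cm m) p).left_inv (hp hz.2)]; exact hz.2
      · rw [coordChange_apply (hp hz.2), (chartAt (Cm m) p').right_inv hz.1]
  have h1 := lintegral_image_eq_lintegral_abs_det_fderiv_mul volume
    (measurableSet_chart_preimage p hS) hder hinj
    fun z => ENNReal.ofReal (volumeDensity h p' z)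
  rw [himg] at h1
  rw [chartVolume, chartVolume, h1]
  refine setLIntegral_congr_fun (measurableSet_chart_preimage p hS) fun y hy => ?_
  rw [volumeDensity_coordChange h (hTd hy), ENNReal.ofReal_mul (abs_nonneg _)]

/-- The Kähler volume in the chart at `p`. -/
theorem kahlerVolume_apply {p : M} {S : Set M} (hS : MeasurableSet S)
    (hp : S ⊆ (chartAt (Cm m) p).source) : kahlerVolume h S = chartVolume h p S := by
  rw [kahlerVolume]
  set n := (exists_finite_chart_cover (m := m) (M := M)).choose
  set a : Fin n → M := (exists_finite_chart_cover (m := m) (M := M)).choose_spec.choose with ha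
  have hcov : ⋃ i, (chartAt (Cm m) (a i)).source = Set.univ :=
    (exists_finite_chart_cover (m := m) (M := M)).choose_spec.choose_spec
  set A : Fin n → Set M := fun i =>
    (chartAt (Cm m) (a i)).source \ ⋃ j, ⋃ _ : j < i, (chartAt (Cm m) (a j)).source with hA
  have hAm : ∀ i, MeasurableSet (A i) := fun i =>
    (chartAt (Cm m) (a i)).open_source.measurableSet.diff
      (isOpen_iUnion fun j => isOpen_iUnion fun _ => (chartAt (Cm m) (a j)).open_source).measurableSet
  have hAd : Pairwise fun i j => Disjoint (A i) (A j) := by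
    have h1 : ∀ i j, i < j → Disjoint (A i) (A j) := fun i j hij => by
      rw [Set.disjoint_left]
      intro x hx hx'
      exact hx'.2 (Set.mem_iUnion₂.2 ⟨i, hij, hx.1⟩)
    intro i j hij
    rcases lt_or_gt_of_ne hij with h2 | h2
    · exact h1 i j h2
    · exact (h1 j i h2).symm
  have hAu : ⋃ i, A i = Set.univ := by
    rw [Set.eq_univ_iff_forall]
    intro x
    have hx : ∃ i, x ∈ (chartAt (Cm m) (a i)).source := by
      have : x ∈ ⋃ i, (chartAt (Cm m) (a i)).source := by rw [hcov]; trivial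
      exact Set.mem_iUnion.1 this
    classical
    -- A point lies in the piece belonging to the least index whose chart contains it.
    obtain ⟨i, hi, hmin⟩ := WellFounded.has_min (wellFounded_lt (α := Fin n))
      {i | x ∈ (chartAt (Cm m) (a i)).source} hx
    refine Set.mem_iUnion.2 ⟨i, hi, fun hx' => ?_⟩
    obtain ⟨j, hj, hxj⟩ := Set.mem_iUnion₂.1 hx'
    exact hmin j hxj hj
  have hterm : ∀ i, Measure.map (chartAt (Cm m) (a i)).symm
      ((volume.restrict ((chartAt (Cm m) (a i)).target ∩ (chartAt (Cm m) (a i)).symm ⁻¹' A i)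
        ).withDensity fun y => ENNReal.ofReal (volumeDensity h (a i) y)) S =
        chartVolume h p (A i ∩ S) := by
    intro i
    have hsm : AEMeasurable (chartAt (Cm m) (a i)).symm
        (volume.restrict ((chartAt (Cm m) (a i)).target ∩ (chartAt (Cm m) (a i)).symm ⁻¹' A i)) :=
      ((chartAt (Cm m) (a i)).continuousOn_symm.aemeasurable
        (chartAt (Cm m) (a i)).open_target.measurableSet).mono_measure
          (Measure.restrict_mono Set.inter_subset_left le_rfl)
    rw [Measure.map_apply_of_aemeasurable (hsm.mono_ac (withDensity_absolutelyContinuous _ _)) hS]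
    have hvA : ∀ i, A i ∩ S ⊆ (chartAt (Cm m) (a i)).source := fun i x hx => hx.1.1
    -- The set `A i ∩ S` lies in the domains of both the chart at `p` and the chart at `a i`, so its
    -- volume may be computed in the latter, where the piece was defined.
    rw [chartVolume_eq h ((hAm i).inter hS) (Set.inter_subset_right.trans hp) (hvA i), chartVolume,
      withDensity_apply', Measure.restrict_restrict₀']
    · congr 2
      ext y
      simp only [Set.mem_inter_iff, Set.mem_preimage]
      tauto
    · exact (measurableSet_chart_preimage (a i) (hAm i)).nullMeasurableSet
  simp only [Measure.coe_finsetSum, Finset.sum_apply]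
  rw [Finset.sum_congr rfl fun i _ => hterm i]
  have hpre : (chartAt (Cm m) p).target ∩ (chartAt (Cm m) p).symm ⁻¹' S =
      ⋃ i, (chartAt (Cm m) p).target ∩ (chartAt (Cm m) p).symm ⁻¹' (A i ∩ S) := by
    rw [← Set.inter_iUnion, ← Set.preimage_iUnion, ← Set.iUnion_inter, hAu, Set.univ_inter]
  simp only [chartVolume]
  rw [hpre, lintegral_iUnion (fun i => measurableSet_chart_preimage p ((hAm i).inter hS)),
    tsum_fintype]
  intro i j hij
  rw [Function.onFun, Set.disjoint_left]
  intro y hy hy'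
  exact Set.disjoint_left.1 (hAd hij) hy.2.1 hy'.2.1

theorem kahlerVolume_restrict (p : M) :
    (kahlerVolume h).restrict (chartAt (Cm m) p).source =
      Measure.map (chartAt (Cm m) p).symm ((volume.restrict (chartAt (Cm m) p).target).withDensity
        fun y => ENNReal.ofReal (volumeDensity h p y)) := by
  ext S hS
  have hsm : AEMeasurable (chartAt (Cm m) p).symm
      (volume.restrict (chartAt (Cm m) p).target) :=
    (chartAt (Cm m) p).continuousOn_symm.aemeasurable (chartAt (Cm m) p).open_target.measurableSet
  rw [Measure.restrict_apply hS, Measure.map_apply_of_aemeasurable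
    (hsm.mono_ac (withDensity_absolutelyContinuous _ _)) hS, kahlerVolume_apply h
      (hS.inter (chartAt (Cm m) p).open_source.measurableSet) Set.inter_subset_right, chartVolume,
    withDensity_apply', Measure.restrict_restrict₀'
      (chartAt (Cm m) p).open_target.measurableSet.nullMeasurableSet]
  congr 2
  ext y
  simp only [Set.mem_inter_iff, Set.mem_preimage]
  constructor
  · rintro ⟨h1, h2, -⟩
    exact ⟨h2, h1⟩
  · rintro ⟨h1, h2⟩
    exact ⟨h2, h1, (chartAt (Cm m) p).map_target h2⟩

/-- The integral of a function supported in a chart. -/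
theorem integral_kahlerVolume (hpos : IsPositive h) {p : M} {F : M → ℂ} (hF : Continuous F)
    (hsupp : ∀ x, x ∉ (chartAt (Cm m) p).source → F x = 0) :
    ∫ x, F x ∂(kahlerVolume h) = ∫ y in (chartAt (Cm m) p).target,
      (volumeDensity h p y : ℂ) * F ((chartAt (Cm m) p).symm y) := by
  have hsm : AEMeasurable (chartAt (Cm m) p).symm
      (volume.restrict (chartAt (Cm m) p).target) :=
    (chartAt (Cm m) p).continuousOn_symm.aemeasurable (chartAt (Cm m) p).open_target.measurableSet
  have hvm : AEMeasurable (fun y => ENNReal.ofReal (volumeDensity h p y))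
      (volume.restrict (chartAt (Cm m) p).target) :=
    ((continuousOn_volumeDensity h p).aemeasurable
      (chartAt (Cm m) p).open_target.measurableSet).ennreal_ofReal
  rw [← setIntegral_eq_integral_of_forall_compl_eq_zero hsupp, kahlerVolume_restrict,
    integral_map (hsm.mono_ac (withDensity_absolutelyContinuous _ _)) hF.aestronglyMeasurable,
    integral_withDensity_eq_integral_toReal_smul₀ hvm (by simp)]
  refine setIntegral_congr_fun (chartAt (Cm m) p).open_target.measurableSet fun y hy => ?_
  rw [ENNReal.toReal_ofReal (volumeDensity_pos h hpos hy).le, Complex.real_smul]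

/-- The density is continuous, hence integrable on small closed balls; the measure is locally finite
on a compact space. -/
theorem isFiniteMeasure_kahlerVolume : IsFiniteMeasure (kahlerVolume h) := by
  have : IsLocallyFiniteMeasure (kahlerVolume h) := by
    refine ⟨fun x => ?_⟩
    set c := chartAt (Cm m) x with hc
    have hx := mem_chart_source (Cm m) x
    obtain ⟨r, hr, hball⟩ := Metric.nhds_basis_closedBall.mem_iff.1
      (c.open_target.mem_nhds (c.map_source hx))
    set S := c.source ∩ c ⁻¹' Metric.ball (c x) r with hS
    have hSo : IsOpen S := c.isOpen_inter_preimage Metric.isOpen_ball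
    refine ⟨S, hSo.mem_nhds ⟨hx, Metric.mem_ball_self hr⟩, ?_⟩
    rw [kahlerVolume_apply h hSo.measurableSet Set.inter_subset_left, chartVolume]
    have hsub : c.target ∩ c.symm ⁻¹' S ⊆ Metric.closedBall (c x) r := by
      intro y hy
      have h1 := hy.2.2
      rw [Set.mem_preimage, c.right_inv hy.1] at h1
      exact Metric.ball_subset_closedBall h1
    have hint : IntegrableOn (volumeDensity h x) (Metric.closedBall (c x) r) :=
      ((continuousOn_volumeDensity h x).mono hball).integrableOn_compact
        (isCompact_closedBall _ _)
    calc _ ≤ ∫⁻ y in Metric.closedBall (c x) r, ENNReal.ofReal (volumeDensity h x y) :=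
          lintegral_mono_set hsub
      _ < ⊤ := hint.lintegral_lt_top
  infer_instance

/-- The density is strictly positive. This is what makes the L² form definite on continuous
sections. -/
theorem isOpenPosMeasure_kahlerVolume (hpos : IsPositive h) :
    (kahlerVolume h).IsOpenPosMeasure := by
  refine ⟨fun U hU ⟨x, hxU⟩ h0 => ?_⟩
  set c := chartAt (Cm m) x with hc
  have hx := mem_chart_source (Cm m) x
  have hSo : IsOpen (c.source ∩ U) := c.open_source.inter hU
  have h1 : kahlerVolume h (c.source ∩ U) = 0 := measure_mono_null Set.inter_subset_right h0
  rw [kahlerVolume_apply h hSo.measurableSet Set.inter_subset_left, chartVolume] at h1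
  have hTo : IsOpen (c.target ∩ c.symm ⁻¹' (c.source ∩ U)) := isOpen_chart_preimage x hSo
  set T := c.target ∩ c.symm ⁻¹' (c.source ∩ U) with hT
  have hvm : AEMeasurable (fun y => ENNReal.ofReal (volumeDensity h x y)) (volume.restrict T) :=
    (((continuousOn_volumeDensity h x).mono Set.inter_subset_left).aemeasurable
      hTo.measurableSet).ennreal_ofReal
  rw [lintegral_eq_zero_iff' hvm] at h1
  have h2 : ∀ᵐ y ∂(volume.restrict T), y ∈ T := ae_restrict_mem hTo.measurableSet
  have h3 : ∀ᵐ y ∂(volume.restrict T), False := by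
    filter_upwards [h1, h2] with y hy hyT
    have := volumeDensity_pos h hpos hyT.1
    simp only [Pi.zero_apply, ENNReal.ofReal_eq_zero] at hy
    linarith
  rw [ae_iff] at h3
  simp only [not_false_eq_true, Set.ofPred_true, Measure.restrict_apply_univ] at h3
  have hne : T.Nonempty := ⟨c x, c.map_source hx, by
    rw [Set.mem_preimage, c.left_inv hx]; exact ⟨hx, hxU⟩⟩
  exact (hTo.measure_pos volume hne).ne' h3

end Volume

end

end KahlerQuant

namespace KahlerQuant

noncomputable section

/-! ### Integration of divergences on ℂᵐ -/

section Divergence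

variable {m : ℕ}

/-- Integration by parts against the constant 1. -/
theorem integral_fderiv_eq_zero {g : Cm m → ℂ} (hg : ContDiff ℝ 1 g) (hc : HasCompactSupport g)
    (v : Cm m) : Integrable (fun y => fderiv ℝ g y v) ∧ ∫ y, fderiv ℝ g y v = 0 := by
  have h1 : Continuous fun y => fderiv ℝ g y v :=
    (hg.continuous_fderiv (by simp)).clm_apply continuous_const
  have h2 : HasCompactSupport fun y => fderiv ℝ g y v :=
    (hc.fderiv (𝕜 := ℝ)).comp_left (g := fun A : Cm m →L[ℝ] ℂ => A v) (by simp)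
  have h3 := h1.integrable_of_hasCompactSupport (μ := volume) h2
  refine ⟨h3, ?_⟩
  have h4 := integral_mul_fderiv_eq_neg_fderiv_mul_of_integrable (μ := (volume : Measure (Cm m)))
    (f := fun _ => (1 : ℂ)) (g := g) (v := v) (by simp) (by simpa using h3)
    (by simpa using hg.continuous.integrable_of_hasCompactSupport hc)
    (fun x _ => differentiableAt_const _)
    (fun x _ => (hg.differentiable (by simp)).differentiableAt)
  simpa using h4

/-- The integral of a derivative of a function with compact support in an open set vanishes. -/
theorem setIntegral_fderiv_eq_zero {f : Cm m → ℂ} {T K : Set (Cm m)} (hT : IsOpen T)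
    (hK : IsCompact K) (hKT : K ⊆ T) (hf : ContDiffOn ℝ 1 f T) (h0 : ∀ y ∈ T, y ∉ K → f y = 0)
    (v : Cm m) :
    IntegrableOn (fun y => fderiv ℝ f y v) T ∧ ∫ y in T, fderiv ℝ f y v = 0 := by
  -- Extension by zero is C¹ everywhere: it equals `f` near points of `K` and vanishes near all
  -- others.
  set g := T.indicator f with hg
  have hgK : ∀ y, y ∉ K → g y = 0 := by
    intro y hy
    by_cases hyT : y ∈ T
    · rw [hg, Set.indicator_of_mem hyT, h0 y hyT hy]
    · rw [hg, Set.indicator_of_notMem hyT]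
  have hgT : ∀ y ∈ T, g =ᶠ[𝓝 y] f := fun y hy => by
    filter_upwards [hT.mem_nhds hy] with z hz
    exact Set.indicator_of_mem hz f
  have hgc : ∀ y ∉ K, g =ᶠ[𝓝 y] fun _ => 0 := fun y hy => by
    filter_upwards [hK.isClosed.isOpen_compl.mem_nhds hy] with z hz
    exact hgK z hz
  have hgd : ContDiff ℝ 1 g := by
    rw [contDiff_iff_contDiffAt]
    intro y
    by_cases hy : y ∈ K
    · exact (hf.contDiffAt (hT.mem_nhds (hKT hy))).congr_of_eventuallyEq (hgT y (hKT hy))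
    · exact contDiffAt_const.congr_of_eventuallyEq (hgc y hy)
  have hgs : HasCompactSupport g := HasCompactSupport.intro hK hgK
  obtain ⟨h1, h2⟩ := integral_fderiv_eq_zero hgd hgs v
  have h3 : ∀ y ∈ T, fderiv ℝ g y v = fderiv ℝ f y v := fun y hy => by rw [(hgT y hy).fderiv_eq]
  refine ⟨h1.integrableOn.congr_fun h3 hT.measurableSet, ?_⟩
  rw [← setIntegral_congr_fun hT.measurableSet h3, ← h2]
  refine setIntegral_eq_integral_of_forall_compl_eq_zero fun y hy => ?_
  rw [(hgc y fun h => hy (hKT h)).fderiv_eq]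
  simp

/-- The divergence of `G · (D ξ)` when the vector field `D ξ` is divergence free. -/
theorem sum_fderiv_eq {G : Cm m → ℂ} {D : Cm m → ℝ} {ξ : Cm m → Cm m} {y : Cm m}
    (hG : DifferentiableAt ℝ G y) (hD : DifferentiableAt ℝ D y) (hξ : DifferentiableAt ℝ ξ y)
    (hdiv : fderiv ℝ D y (ξ y) + D y * ∑ j, ((fderiv ℝ ξ y (Pi.single j 1) j).re +
      (fderiv ℝ ξ y (I • Pi.single j 1) j).im) = 0) :
    ∑ j, (fderiv ℝ (fun z => G z * ((D z * (ξ z j).re : ℝ) : ℂ)) y (Pi.single j 1) +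
      fderiv ℝ (fun z => G z * ((D z * (ξ z j).im : ℝ) : ℂ)) y (I • Pi.single j 1)) =
      (D y : ℂ) * fderiv ℝ G y (ξ y) := by
  -- The expansion in the real basis e_j, i e_j, so that the sum of partial derivatives assembles
  -- into the derivative along ξ.
  have hexp : ξ y = ∑ j, ((ξ y j).re • (Pi.single j 1 : Cm m) +
      (ξ y j).im • (I • (Pi.single j 1 : Cm m))) := by
    funext i
    simp only [Finset.sum_apply, Pi.add_apply, Pi.smul_apply, Pi.single_apply]
    rw [Finset.sum_eq_single i (fun j _ hj => by simp [Ne.symm hj]) (by simp)]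
    simp only [if_true, Complex.real_smul, smul_eq_mul, mul_one]
    exact (Complex.re_add_im _).symm
  have hj : ∀ j, HasFDerivAt (fun z => ξ z j) ((ContinuousLinearMap.proj j).comp (fderiv ℝ ξ y)) y :=
    fun j => (ContinuousLinearMap.proj (R := ℝ) (φ := fun _ : Fin m => ℂ) j).hasFDerivAt.comp y
      hξ.hasFDerivAt
  have h1 : ∀ j, HasFDerivAt (fun z => G z * ((D z * (ξ z j).re : ℝ) : ℂ)) _ y := fun j =>
    hG.hasFDerivAt.mul (Complex.ofRealCLM.hasFDerivAt.comp y
      (hD.hasFDerivAt.mul (Complex.reCLM.hasFDerivAt.comp y (hj j))))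
  have h2 : ∀ j, HasFDerivAt (fun z => G z * ((D z * (ξ z j).im : ℝ) : ℂ)) _ y := fun j =>
    hG.hasFDerivAt.mul (Complex.ofRealCLM.hasFDerivAt.comp y
      (hD.hasFDerivAt.mul (Complex.imCLM.hasFDerivAt.comp y (hj j))))
  have hterm : ∀ j, fderiv ℝ (fun z => G z * ((D z * (ξ z j).re : ℝ) : ℂ)) y (Pi.single j 1) +
      fderiv ℝ (fun z => G z * ((D z * (ξ z j).im : ℝ) : ℂ)) y (I • Pi.single j 1) =
      G y * ((D y * ((fderiv ℝ ξ y (Pi.single j 1) j).re +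
        (fderiv ℝ ξ y (I • Pi.single j 1) j).im) : ℝ) : ℂ) +
      G y * ((fderiv ℝ D y ((ξ y j).re • (Pi.single j 1 : Cm m) +
        (ξ y j).im • (I • (Pi.single j 1 : Cm m))) : ℝ) : ℂ) +
      (D y : ℂ) * fderiv ℝ G y ((ξ y j).re • (Pi.single j 1 : Cm m) +
        (ξ y j).im • (I • (Pi.single j 1 : Cm m))) := by
    intro j
    rw [(h1 j).fderiv, (h2 j).fderiv]
    simp only [add_apply, smul_apply, ContinuousLinearMap.comp_apply, map_add, map_smul,
      Complex.ofRealCLM_apply, Complex.reCLM_apply, Complex.imCLM_apply,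
      ContinuousLinearMap.proj_apply, smul_eq_mul, Complex.real_smul,
      Complex.ofReal_add, Complex.ofReal_mul]
    ring
  rw [Finset.sum_congr rfl fun j _ => hterm j, Finset.sum_add_distrib, Finset.sum_add_distrib,
    ← Finset.mul_sum, ← Finset.mul_sum, ← Finset.mul_sum, ← Complex.ofReal_sum,
    ← Complex.ofReal_sum, ← map_sum, ← map_sum, ← hexp, ← Finset.mul_sum, ← mul_add,
    ← Complex.ofReal_add, add_comm (D y * _), hdiv]
  simp

end Divergence

/-! ### The divergence theorem on M and symmetry of H + (i/k)∇_ξ -/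

section Stokes

variable {m : ℕ} {M : Type*} [TopologicalSpace M] [T2Space M] [CompactSpace M]
  [ChartedSpace (Cm m) M] [IsManifold 𝓘(ℂ, Cm m) ω M] [MeasurableSpace M] [BorelSpace M]
  {L : M → Type*} [∀ x, AddCommGroup (L x)] [∀ x, Module ℂ (L x)]
  [∀ x, TopologicalSpace (L x)] [TopologicalSpace (TotalSpace ℂ L)] [FiberBundle ℂ L]
  [VectorBundle ℂ ℂ L] [ContMDiffVectorBundle ω ℂ L 𝓘(ℂ, Cm m)] (h : HermitianMetric m L)
  {H : M → ℝ} {k : ℕ} {s t : PowSection L k}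

/-- The derivative `ξ_H F` of a function along the Hamiltonian vector field. -/
def hamDeriv (H : M → ℝ) (F : M → ℂ) (x : M) : ℂ :=
  mfderiv 𝓘(ℝ, Cm m) 𝓘(ℝ, ℂ) F x (hamVF h H x)

theorem hamDeriv_comp_chart {F : M → ℂ} (hF : ContMDiff 𝓘(ℝ, Cm m) 𝓘(ℝ, ℂ) ∞ F) {p : M}
    {y : Cm m} (hy : y ∈ (chartAt (Cm m) p).target) :
    hamDeriv h H F ((chartAt (Cm m) p).symm y) =
      fderiv ℝ (F ∘ (chartAt (Cm m) p).symm) y (field h H p y) := by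
  have h1 := mfderiv_hamVF_eq h (H := H) ((hF ((chartAt (Cm m) p).symm y)).of_le (by simp))
    ((chartAt (Cm m) p).map_target hy)
  rw [(chartAt (Cm m) p).right_inv hy] at h1
  exact h1

theorem contDiffAt_comp_chart {G : Type*} [NormedAddCommGroup G] [NormedSpace ℝ G] {F : M → G}
    (hF : ContMDiff 𝓘(ℝ, Cm m) 𝓘(ℝ, G) ∞ F) {p : M}
    {y : Cm m} (hy : y ∈ (chartAt (Cm m) p).target) :
    ContDiffAt ℝ ∞ (F ∘ (chartAt (Cm m) p).symm) y := by
  have := isManifold_real m M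
  have h1 := contDiffOn_comp_chart_symm ∞ (hF.contMDiffOn (s := Set.univ)) p
  exact h1.contDiffAt (Filter.inter_mem ((chartAt (Cm m) p).open_target.mem_nhds hy) (by simp))

variable (hpos : IsPositive h) (hH : ContMDiff 𝓘(ℝ, Cm m) 𝓘(ℝ, ℝ) ∞ H)
  (hol : IsHolomorphicHamiltonian h H)
include hpos hH hol

theorem contDiffAt_field_chart {p : M} {y : Cm m} (hy : y ∈ (chartAt (Cm m) p).target) :
    ContDiffAt ℝ ∞ (field h H p) y :=
  (isLocalHamiltonian h hpos hH hol p _).contDiffAt_field (exists_mem_dom hy)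

theorem continuous_hamDeriv {F : M → ℂ} (hF : ContMDiff 𝓘(ℝ, Cm m) 𝓘(ℝ, ℂ) ∞ F) :
    Continuous (hamDeriv h H F) := by
  rw [continuous_iff_continuousAt]
  intro x
  set c := chartAt (Cm m) x with hc
  have hx := mem_chart_source (Cm m) x
  have hy : c x ∈ c.target := c.map_source hx
  have h1 : ContinuousAt (fun y => fderiv ℝ (F ∘ c.symm) y (field h H x y)) (c x) :=
    (((contDiffAt_comp_chart hF hy).fderiv_right (m := ∞) (by simp)).continuousAt).clm_apply
      (contDiffAt_field_chart h hpos hH hol hy).continuousAt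
  refine (ContinuousAt.comp (f := c) h1 (c.continuousAt hx)).congr ?_
  filter_upwards [c.open_source.mem_nhds hx] with z hz
  have h2 := hamDeriv_comp_chart h (H := H) hF (c.map_source hz)
  rw [c.left_inv hz] at h2
  exact h2.symm

theorem divergence_volumeDensity {p : M} {y : Cm m} (hy : y ∈ (chartAt (Cm m) p).target) :
    fderiv ℝ (volumeDensity h p) y (field h H p y) + volumeDensity h p y *
      ∑ j, ((fderiv ℝ (field h H p) y (Pi.single j 1) j).re +
        (fderiv ℝ (field h H p) y (I • Pi.single j 1) j).im) = 0 := by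
  have hd := exists_mem_dom (L := L) hy
  set q := (chartAt (Cm m) p).symm y with hq
  have hn := (isOpen_dom (L := L) p q).mem_nhds hd
  have h1 := (isLocalHamiltonian h hpos hH hol p q).divergence_eq_zero hd
  have he : volumeDensity h p =ᶠ[𝓝 y]
      fun z => (2 : ℝ) ^ m * (leviMatrix (weightIn h p q) z).det.re := by
    filter_upwards [hn] with z hz
    exact volumeDensity_eq h hz
  have h2 : DifferentiableAt ℝ (fun z => (leviMatrix (weightIn h p q) z).det.re) y :=
    (Complex.reCLM.contDiff.contDiffAt.comp y (IsLocalHamiltonian.contDiffAt_leviMatrix_det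
      ((contDiffOn_weightIn h p q).contDiffAt hn))).differentiableAt (by simp)
  rw [he.fderiv_eq, he.self_of_nhds, fderiv_const_mul h2]
  simp only [smul_apply, smul_eq_mul]
  linear_combination (2 : ℝ) ^ m * h1

/-- In coordinates the integrand is D ξ(F) = div(F D ξ), as the density D satisfies div(D ξ) = 0;
the field F D ξ has compact support inside the chart. -/
theorem integral_hamDeriv_of_tsupport {F : M → ℂ} (hF : ContMDiff 𝓘(ℝ, Cm m) 𝓘(ℝ, ℂ) ∞ F) {p : M}
    (hsupp : tsupport F ⊆ (chartAt (Cm m) p).source) :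
    ∫ x, hamDeriv h H F x ∂(kahlerVolume h) = 0 := by
  set c := chartAt (Cm m) p with hc
  have h0 : ∀ x, x ∉ c.source → hamDeriv h H F x = 0 := by
    intro x hx
    have hx' : x ∉ tsupport F := fun h => hx (hsupp h)
    have he : F =ᶠ[𝓝 x] fun _ => 0 := notMem_tsupport_iff_eventuallyEq.1 hx'
    have h1 := he.mfderiv_eq (I := 𝓘(ℝ, Cm m)) (I' := 𝓘(ℝ, ℂ))
    rw [hamDeriv, h1, mfderiv_const]
    rfl
  rw [integral_kahlerVolume h hpos (continuous_hamDeriv h hpos hH hol hF) h0]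
  have hK : IsCompact (c '' tsupport F) :=
    (isClosed_tsupport F).isCompact.image_of_continuousOn (c.continuousOn.mono hsupp)
  have hKT : c '' tsupport F ⊆ c.target := by
    rintro _ ⟨x, hx, rfl⟩
    exact c.map_source (hsupp hx)
  set G : Cm m → ℂ := F ∘ c.symm with hG
  have hG0 : ∀ y ∈ c.target, y ∉ c '' tsupport F → G y = 0 := by
    intro y hy hyK
    by_contra hne
    exact hyK ⟨c.symm y, subset_tsupport F hne, c.right_inv hy⟩
  have hξ : ∀ y ∈ c.target, ContDiffAt ℝ ∞ (field h H p) y := fun y hy =>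
    contDiffAt_field_chart h hpos hH hol hy
  have hparts : ∀ (a : ℂ →L[ℝ] ℝ) (j : Fin m) (v : Cm m),
      IntegrableOn (fun y => fderiv ℝ
        (fun z => G z * ((volumeDensity h p z * a (field h H p z j) : ℝ) : ℂ)) y v) c.target ∧
      ∫ y in c.target, fderiv ℝ
        (fun z => G z * ((volumeDensity h p z * a (field h H p z j) : ℝ) : ℂ)) y v = 0 := by
    intro a j v
    refine setIntegral_fderiv_eq_zero c.open_target hK hKT (fun y hy => ?_)
      (fun y hy hyK => by rw [hG0 y hy hyK, zero_mul]) v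
    have h1 : ContDiffAt ℝ ∞ (fun z => field h H p z j) y := (contDiffAt_pi.1 (hξ y hy)) j
    have h2 : ContDiffAt ℝ ∞
        (fun z => G z * ((volumeDensity h p z * a (field h H p z j) : ℝ) : ℂ)) y :=
      (contDiffAt_comp_chart hF hy).mul (Complex.ofRealCLM.contDiff.contDiffAt.comp y
        ((contDiffAt_volumeDensity h hy).mul (a.contDiff.contDiffAt.comp y h1)))
    exact (h2.of_le (by simp)).contDiffWithinAt
  have hpt : ∀ y ∈ c.target, (volumeDensity h p y : ℂ) * hamDeriv h H F (c.symm y) =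
      ∑ j, (fderiv ℝ (fun z => G z * ((volumeDensity h p z * Complex.reCLM (field h H p z j) : ℝ) : ℂ))
          y (Pi.single j 1) +
        fderiv ℝ (fun z => G z * ((volumeDensity h p z * Complex.imCLM (field h H p z j) : ℝ) : ℂ))
          y (I • Pi.single j 1)) := by
    intro y hy
    rw [hamDeriv_comp_chart h hF hy]
    exact (sum_fderiv_eq ((contDiffAt_comp_chart hF hy).differentiableAt (by simp))
      ((contDiffAt_volumeDensity h hy).differentiableAt (by simp))
      ((hξ y hy).differentiableAt (by simp)) (divergence_volumeDensity h hpos hH hol hy)).symm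
  rw [setIntegral_congr_fun c.open_target.measurableSet hpt, integral_finsetSum]
  · refine Finset.sum_eq_zero fun j _ => ?_
    rw [integral_add (hparts Complex.reCLM j (Pi.single j 1)).1
      (hparts Complex.imCLM j (I • Pi.single j 1)).1, (hparts _ _ _).2, (hparts _ _ _).2, add_zero]
  · exact fun j _ => (hparts Complex.reCLM j (Pi.single j 1)).1.add
      (hparts Complex.imCLM j (I • Pi.single j 1)).1

/-- The divergence theorem for the Hamiltonian vector field: `∫ ξ_H F = 0`. -/
theorem integral_hamDeriv {F : M → ℂ} (hF : ContMDiff 𝓘(ℝ, Cm m) 𝓘(ℝ, ℂ) ∞ F) :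
    ∫ x, hamDeriv h H F x ∂(kahlerVolume h) = 0 := by
  have := isManifold_real m M
  have := isFiniteMeasure_kahlerVolume h
  obtain ⟨n, p, hp⟩ := exists_finite_chart_cover (m := m) (M := M)
  obtain ⟨ρ, hρ⟩ := SmoothPartitionOfUnity.exists_isSubordinate 𝓘(ℝ, Cm m) isClosed_univ
    (fun i => (chartAt (Cm m) (p i)).source) (fun i => (chartAt (Cm m) (p i)).open_source) hp.ge
  have hρF : ∀ i, ContMDiff 𝓘(ℝ, Cm m) 𝓘(ℝ, ℂ) ∞ (fun x => ρ i x • F x) := fun i =>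
    (ρ i).contMDiff.smul hF
  have hsum : ∀ x, hamDeriv h H F x = ∑ i, hamDeriv h H (fun x => ρ i x • F x) x := by
    intro x
    set c := chartAt (Cm m) x with hc
    have hx := mem_chart_source (Cm m) x
    have hy : c x ∈ c.target := c.map_source hx
    have hE : ∀ F' : M → ℂ, ContMDiff 𝓘(ℝ, Cm m) 𝓘(ℝ, ℂ) ∞ F' →
        hamDeriv h H F' x = fderiv ℝ (F' ∘ c.symm) (c x) (field h H x (c x)) := fun F' hF' => by
      have h1 : hamDeriv h H F' (c.symm (c x)) =
        fderiv ℝ (F' ∘ c.symm) (c x) (field h H x (c x)) := hamDeriv_comp_chart h hF' hy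
      rwa [c.left_inv hx] at h1
    rw [hE F hF, Finset.sum_congr rfl fun i _ => hE _ (hρF i)]
    have he : F ∘ c.symm = fun y => ∑ i, ((fun x => ρ i x • F x) ∘ c.symm) y := by
      funext y
      have h1 := ρ.sum_eq_one (Set.mem_univ (c.symm y))
      rw [finsum_eq_sum_of_fintype] at h1
      change F (c.symm y) = ∑ i, ρ i (c.symm y) • F (c.symm y)
      rw [← Finset.sum_smul, h1, one_smul]
    have h2 := fderiv_fun_sum (u := Finset.univ) fun i (_ : i ∈ Finset.univ) =>
      (contDiffAt_comp_chart (hρF i) hy).differentiableAt (by simp)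
    rw [he, h2, _root_.sum_apply]
  simp only [hsum]
  rw [integral_finsetSum]
  · refine Finset.sum_eq_zero fun i _ =>
      integral_hamDeriv_of_tsupport h hpos hH hol (hρF i) (p := p i) ?_
    exact (tsupport_smul_subset_left (ρ i) F).trans (hρ i)
  · intro i _
    exact (continuous_hamDeriv h hpos hH hol (hρF i)).integrable_of_hasCompactSupport
      (HasCompactSupport.of_compactSpace _)

omit hpos hH hol in
theorem integrable_powMetric (hs : s ∈ holSections m L k) (ht : t ∈ holSections m L k) :
    Integrable (fun x => powMetric h k x (s x) (t x)) (kahlerVolume h) := by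
  have := isFiniteMeasure_kahlerVolume h
  exact (contMDiff_powMetric h hs ht).continuous.integrable_of_hasCompactSupport
    (HasCompactSupport.of_compactSpace _)

/-- `H + (i/k) ∇_{ξ_H}` is symmetric on holomorphic sections. -/
theorem l2_prequantum (hk : k ≠ 0) (hs : s ∈ holSections m L k) (ht : t ∈ holSections m L k) :
    l2 h s (prequantum h H t) = l2 h (prequantum h H s) t := by
  have hQs := prequantum_mem h hpos hH hol hk hs
  have hQt := prequantum_mem h hpos hH hol hk ht
  rw [← sub_eq_zero, l2, l2, ← integral_sub (integrable_powMetric h hs hQt)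
    (integrable_powMetric h hQs ht)]
  -- Conjugation turns i/k into -i/k in the first slot and the multiplication terms cancel since `H`
  -- is real. Both covariant derivatives therefore appear with the same sign and add up to a
  -- derivative of the pointwise product.
  have hpt : ∀ x, powMetric h k x (s x) (prequantum h H t x) -
      powMetric h k x (prequantum h H s x) (t x) =
        (I / k) * hamDeriv h H (fun x => powMetric h k x (s x) (t x)) x := by
    intro x
    have h1 : hamDeriv h H (fun x => powMetric h k x (s x) (t x)) x =
        powMetric h k x (chernDeriv h s x (hamVF h H x)) (t x) +
          powMetric h k x (s x) (chernDeriv h t x (hamVF h H x)) :=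
      mfderiv_powMetric h hs ht x (hamVF h H x)
    rw [h1]
    simp only [powMetric, prequantum, map_add, map_smul, smul_eq_mul, map_mul, map_div₀,
      Complex.conj_ofReal, Complex.conj_I, map_natCast]
    ring
  simp only [hpt]
  rw [integral_const_mul, integral_hamDeriv h hpos hH hol (contMDiff_powMetric h hs ht), mul_zero]

end Stokes

end

end KahlerQuant

namespace KahlerQuant

noncomputable section

/-- The Riesz representation theorem for a positive definite form on a finite-dimensional space. -/
theorem exists_inner_eq {V : Type*} [AddCommGroup V] [Module ℂ V] [FiniteDimensional ℂ V]
    (c : InnerProductSpace.Core ℂ V) (f : V →ₗ[ℂ] ℂ) : ∃ v, ∀ w, c.inner v w = f w := by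
  let _ : NormedAddCommGroup V := c.toNormedAddCommGroup
  let _ : InnerProductSpace ℂ V := InnerProductSpace.ofCore c.toCore
  have : CompleteSpace V := FiniteDimensional.complete ℂ V
  refine ⟨(InnerProductSpace.toDual ℂ V).symm (LinearMap.toContinuousLinearMap f), fun w => ?_⟩
  exact InnerProductSpace.toDual_symm_apply

/-! ### Finite dimensionality of the space of holomorphic sections -/

section Sections

variable {m : ℕ} {M : Type*} [TopologicalSpace M] [CompactSpace M]
  [ChartedSpace (Cm m) M] [IsManifold 𝓘(ℂ, Cm m) ω M]
  {L : M → Type*} [∀ x, AddCommGroup (L x)] [∀ x, Module ℂ (L x)]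
  [∀ x, TopologicalSpace (L x)] [TopologicalSpace (TotalSpace ℂ L)] [FiberBundle ℂ L]
  [VectorBundle ℂ ℂ L] [ContMDiffVectorBundle ω ℂ L 𝓘(ℂ, Cm m)] (h : HermitianMetric m L)
  {H : M → ℝ} {k : ℕ} {s t : PowSection L k}

theorem powMetric_self_nonneg (x : M) (v : ⨂[ℂ]^k (L x)) : 0 ≤ (powMetric h k x v v).re := by
  rw [powMetric_self, Complex.ofReal_re]
  exact mul_nonneg (normSq_nonneg _) (Real.exp_pos _).le

theorem powMetric_self_ofReal (x : M) (v : ⨂[ℂ]^k (L x)) :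
    powMetric h k x v v = ((powMetric h k x v v).re : ℂ) := by
  rw [powMetric_self, Complex.ofReal_re]

theorem powMetric_self_re_eq_zero {x : M} {v : ⨂[ℂ]^k (L x)} (h0 : (powMetric h k x v v).re = 0) :
    v = 0 := by
  rw [powMetric_self, Complex.ofReal_re, mul_eq_zero, or_iff_left (Real.exp_pos _).ne',
    normSq_eq_zero] at h0
  exact (powCoeff_eq_zero_iff (mem_frameSet L x) v).1 h0

theorem powMetric_eq_zero {x : M} {v w : ⨂[ℂ]^k (L x)} (h0 : powMetric h k x v w = 0) :
    v = 0 ∨ w = 0 := by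
  rw [powMetric_eq h (mem_frameSet L x), mul_eq_zero, mul_eq_zero, or_iff_left
    (by exact_mod_cast (Real.exp_pos _).ne'), map_eq_zero,
    powCoeff_eq_zero_iff (mem_frameSet L x), powCoeff_eq_zero_iff (mem_frameSet L x)] at h0
  exact h0

/-- The Schwarz lemma: a holomorphic section vanishing at a point is small near this point. -/
theorem exists_nhds_powMetric_le (k : ℕ) (x₀ : M) : ∃ U ∈ 𝓝 x₀, ∀ s ∈ holSections m L k, s x₀ = 0 →
    ∀ B : ℝ, (∀ x, (powMetric h k x (s x) (s x)).re ≤ B) →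
      ∀ x ∈ U, (powMetric h k x (s x) (s x)).re ≤ B / 4 := by
  set c := chartAt (Cm m) x₀ with hc
  have hx := mem_chart_source (Cm m) x₀
  have hmem : c x₀ ∈ dom L x₀ x₀ := mem_dom hx (mem_frameSet L x₀)
  have hn := (isOpen_dom (L := L) x₀ x₀).mem_nhds hmem
  set w : Cm m → ℝ := fun y => Real.exp (-(k * weightIn h x₀ x₀ y)) with hw
  have hwc : ContinuousAt w (c x₀) :=
    (continuousAt_const.mul ((contDiffOn_weightIn h x₀ x₀).contDiffAt hn).continuousAt).neg.rexp
  set w₀ := w (c x₀) with hw₀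
  have hw₀p : 0 < w₀ := Real.exp_pos _
  -- On a ball of radius R the factor e^(-kφ) stays within a factor 2 of its central value w₀, so
  -- |f|² ≤ 2B/w₀ there. The Schwarz lemma on the ball of radius R/4 gains 1/16, and returning to
  -- the metric costs another factor 2: in total B/4. The neighbourhood does not depend on the
  -- section.
  have hev : ∀ᶠ y in 𝓝 (c x₀), y ∈ dom (m := m) L x₀ x₀ ∧ w₀ / 2 < w y ∧ w y < 2 * w₀ := by
    filter_upwards [hn, hwc.eventually (lt_mem_nhds (show w₀ / 2 < w (c x₀) by linarith)),
      hwc.eventually (gt_mem_nhds (show w (c x₀) < 2 * w₀ by linarith))] with y h1 h2 h3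
    exact ⟨h1, h2, h3⟩
  obtain ⟨R, hR, hball⟩ := Metric.eventually_nhds_iff_ball.1 hev
  refine ⟨c.source ∩ c ⁻¹' Metric.ball (c x₀) (R / 4),
    (c.isOpen_inter_preimage Metric.isOpen_ball).mem_nhds
      ⟨hx, Metric.mem_ball_self (by positivity)⟩, ?_⟩
  intro s hs hs0 B hB x hxU
  set f := repIn (m := m) s x₀ x₀ with hf
  have hval : ∀ y ∈ dom (m := m) L x₀ x₀, (powMetric h k (c.symm y) (s (c.symm y)) (s (c.symm y))).re =
      ‖f y‖ ^ 2 * w y := by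
    intro y hy
    rw [powMetric_comp_chart h hy, mul_comm (conj _), Complex.mul_conj, normSq_eq_norm_sq,
      ← Complex.ofReal_mul, Complex.ofReal_re]
  have hB0 : 0 ≤ B := (powMetric_self_nonneg h x₀ _).trans (hB x₀)
  have hfB : ∀ y ∈ Metric.ball (c x₀) R, ‖f y‖ ^ 2 ≤ 2 * B / w₀ := by
    intro y hy
    obtain ⟨h1, h2, -⟩ := hball y hy
    have h3 := hB (c.symm y)
    rw [hval y h1] at h3
    rw [le_div_iff₀ hw₀p]
    nlinarith [sq_nonneg ‖f y‖]
  have hf0 : f (c x₀) = 0 := by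
    simp only [hf, repIn, Function.comp_apply, localRep]
    rw [(chartAt (Cm m) x₀).left_inv hx, hs0, map_zero]
  have hmaps : Set.MapsTo f (Metric.ball (c x₀) R)
      (Metric.closedBall (f (c x₀)) (Real.sqrt (2 * B / w₀))) := by
    intro y hy
    rw [hf0, mem_closedBall_zero_iff]
    exact Real.le_sqrt_of_sq_le (hfB y hy)
  have hfd : DifferentiableOn ℂ f (Metric.ball (c x₀) R) := fun y hy =>
    (differentiableAt_repIn hs (hball y hy).1).differentiableWithinAt
  have hxb : c x ∈ Metric.ball (c x₀) (R / 4) := hxU.2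
  have hxb' : c x ∈ Metric.ball (c x₀) R := Metric.ball_subset_ball (by linarith) hxb
  have h4 := Complex.dist_le_div_mul_dist_of_mapsTo_ball hfd hmaps hxb'
  rw [hf0, dist_zero_right] at h4
  have hdist : dist (c x) (c x₀) ≤ R / 4 := (Metric.mem_ball.1 hxb).le
  have h5 : ‖f (c x)‖ ≤ Real.sqrt (2 * B / w₀) / 4 := by
    calc _ ≤ _ := h4
      _ ≤ Real.sqrt (2 * B / w₀) / R * (R / 4) := by gcongr
      _ = _ := by field_simp
  have h6 : ‖f (c x)‖ ^ 2 ≤ 2 * B / w₀ / 16 := by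
    calc ‖f (c x)‖ ^ 2 ≤ (Real.sqrt (2 * B / w₀) / 4) ^ 2 := by gcongr
      _ = _ := by rw [div_pow, Real.sq_sqrt (by positivity)]; norm_num
  obtain ⟨h7, -, h8⟩ := hball _ hxb'
  have h9 := hval (c x) h7
  rw [c.left_inv hxU.1] at h9
  rw [h9]
  calc ‖f (c x)‖ ^ 2 * w (c x) ≤ 2 * B / w₀ / 16 * (2 * w₀) :=
        mul_le_mul h6 h8.le (Real.exp_pos _).le (by positivity)
    _ = B / 4 := by field_simp; ring

/-- Holomorphic sections on a compact manifold are determined by finitely many values. -/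
theorem exists_finset_eq_zero (h : HermitianMetric m L) (k : ℕ) : ∃ Z : Finset M, ∀ s ∈ holSections m L k,
    (∀ z ∈ Z, s z = 0) → s = 0 := by
  choose U hU hUs using exists_nhds_powMetric_le (m := m) h k
  obtain ⟨Z, hZ⟩ := CompactSpace.elim_nhds_subcover U hU
  refine ⟨Z, fun s hs h0 => ?_⟩
  funext x
  obtain ⟨x₁, -, hmax⟩ := isCompact_univ.exists_isMaxOn ⟨x, Set.mem_univ x⟩
    (Complex.continuous_re.comp (contMDiff_powMetric h hs hs).continuous).continuousOn
  have hB : ∀ x, (powMetric h k x (s x) (s x)).re ≤ (powMetric h k x₁ (s x₁) (s x₁)).re :=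
    fun x => hmax (Set.mem_univ x)
  have hx₁ : x₁ ∈ ⋃ z ∈ Z, U z := by rw [hZ]; trivial
  obtain ⟨z, hz, hxz⟩ := Set.mem_iUnion₂.1 hx₁
  -- Taking for B the maximum of |s|² and evaluating where it is attained gives B ≤ B/4, hence B ≤
  -- 0.
  have h1 := hUs z s hs (h0 z hz) _ hB x₁ hxz
  have h2 := powMetric_self_nonneg h x (s x)
  have h3 := hB x
  exact powMetric_self_re_eq_zero h (by linarith)

/-- Evaluation at finitely many points is injective. -/
theorem finiteDimensional_holSections (h : HermitianMetric m L) (k : ℕ) :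
    FiniteDimensional ℂ (holSections m L k) := by
  obtain ⟨Z, hZ⟩ := exists_finset_eq_zero (m := m) h k
  let f : holSections m L k →ₗ[ℂ] (Z → ℂ) := LinearMap.pi fun z =>
    (powCoeff L k z.1 z.1).comp ((LinearMap.proj (z : M)).comp (holSections m L k).subtype)
  refine FiniteDimensional.of_injective f ?_
  rw [injective_iff_map_eq_zero]
  intro s hs
  refine Subtype.ext (hZ s.1 s.2 fun z hz => ?_)
  have h1 := congrFun hs ⟨z, hz⟩
  exact (powCoeff_eq_zero_iff (mem_frameSet L z) _).1 h1

end Sections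

/-! ### The L² inner product, the Bergman kernel and the Toeplitz operator -/

section Bergman

variable {m : ℕ} {M : Type*} [TopologicalSpace M] [T2Space M] [CompactSpace M]
  [ChartedSpace (Cm m) M] [IsManifold 𝓘(ℂ, Cm m) ω M] [MeasurableSpace M] [BorelSpace M]
  {L : M → Type*} [∀ x, AddCommGroup (L x)] [∀ x, Module ℂ (L x)]
  [∀ x, TopologicalSpace (L x)] [TopologicalSpace (TotalSpace ℂ L)] [FiberBundle ℂ L]
  [VectorBundle ℂ ℂ L] [ContMDiffVectorBundle ω ℂ L 𝓘(ℂ, Cm m)] (h : HermitianMetric m L)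
  {H : M → ℝ} {k : ℕ} {s t t' : PowSection L k}

theorem l2_conj (s t : PowSection L k) : conj (l2 h s t) = l2 h t s := by
  rw [l2, l2, ← integral_conj]
  congr 1
  funext x
  rw [powMetric_eq h (mem_frameSet L x), powMetric_eq h (mem_frameSet L x)]
  simp only [map_mul, Complex.conj_conj, Complex.conj_ofReal]
  ring

theorem l2_smul_left (c : ℂ) (s t : PowSection L k) : l2 h (c • s) t = conj c * l2 h s t := by
  rw [l2, l2, ← integral_const_mul]
  congr 1
  funext x
  simp only [powMetric, Pi.smul_apply, map_smul, smul_eq_mul, map_mul]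
  ring

theorem l2_smul_right (c : ℂ) (s t : PowSection L k) : l2 h s (c • t) = c * l2 h s t := by
  rw [← l2_conj, l2_smul_left, map_mul, Complex.conj_conj, l2_conj]

theorem l2_add_left (hs : s ∈ holSections m L k) (ht : t ∈ holSections m L k)
    (ht' : t' ∈ holSections m L k) : l2 h (s + t) t' = l2 h s t' + l2 h t t' := by
  rw [l2, l2, l2, ← integral_add (integrable_powMetric h hs ht') (integrable_powMetric h ht ht')]
  congr 1
  funext x
  simp only [powMetric, Pi.add_apply, map_add]
  ring

theorem l2_sub_left (hs : s ∈ holSections m L k) (ht : t ∈ holSections m L k)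
    (ht' : t' ∈ holSections m L k) : l2 h (s - t) t' = l2 h s t' - l2 h t t' := by
  rw [sub_eq_add_neg, ← neg_one_smul ℂ t, l2_add_left h hs
    ((holSections m L k).smul_mem _ ht) ht', l2_smul_left]
  simp
  ring

theorem l2_self (s : PowSection L k) :
    l2 h s s = ((∫ x, (powMetric h k x (s x) (s x)).re ∂(kahlerVolume h) : ℝ) : ℂ) := by
  rw [l2, ← integral_complex_ofReal]
  congr 1
  funext x
  exact powMetric_self_ofReal h x (s x)

theorem l2_self_nonneg (s : PowSection L k) : 0 ≤ (l2 h s s).re := by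
  rw [l2_self, Complex.ofReal_re]
  exact integral_nonneg fun x => powMetric_self_nonneg h x (s x)

/-- A continuous nonnegative function with zero integral vanishes when open sets have positive
measure. -/
theorem eq_zero_of_l2_self (hpos : IsPositive h) (hs : s ∈ holSections m L k)
    (h0 : l2 h s s = 0) : s = 0 := by
  have := isOpenPosMeasure_kahlerVolume h hpos
  rw [l2_self, Complex.ofReal_eq_zero, integral_eq_zero_iff_of_nonneg
    (fun x => powMetric_self_nonneg h x (s x)) (integrable_powMetric h hs hs).re] at h0
  have hc : Continuous fun x => (powMetric h k x (s x) (s x)).re :=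
    Complex.continuous_re.comp (contMDiff_powMetric h hs hs).continuous
  have h1 := (hc.ae_eq_iff_eq (kahlerVolume h) continuous_const).1 h0
  funext x
  exact powMetric_self_re_eq_zero h (congrFun h1 x)

theorem eq_of_l2_eq (hpos : IsPositive h) (hs : s ∈ holSections m L k) (ht : t ∈ holSections m L k)
    (heq : ∀ r ∈ holSections m L k, l2 h s r = l2 h t r) : s = t := by
  have hst := (holSections m L k).sub_mem hs ht
  rw [← sub_eq_zero]
  refine eq_zero_of_l2_self h hpos hst ?_
  rw [l2_sub_left h hs ht hst, heq _ hst, sub_self]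

/-- The `L²` inner product on holomorphic sections. -/
@[reducible]
def l2Core (hpos : IsPositive h) (k : ℕ) : InnerProductSpace.Core ℂ (holSections m L k) where
  inner s t := l2 h s.1 t.1
  conj_inner_symm s t := l2_conj h t.1 s.1
  re_inner_nonneg s := l2_self_nonneg h s.1
  add_left s t r := l2_add_left h s.2 t.2 r.2
  smul_left s t c := l2_smul_left h c s.1 t.1
  definite s hs := Subtype.ext (eq_zero_of_l2_self h hpos s.2 hs)

/-- The reproducing property of the Bergman kernel. -/
theorem bergmanKernel_spec (hpos : IsPositive h) (w : M) (ν : ⨂[ℂ]^k (L w)) :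
    bergmanKernel h w ν ∈ holSections m L k ∧
      ∀ t ∈ holSections m L k, l2 h (bergmanKernel h w ν) t = powMetric h k w ν (t w) := by
  have hex : ∃ Φ ∈ holSections m L k, ∀ t ∈ holSections m L k,
      l2 h Φ t = powMetric h k w ν (t w) := by
    have := finiteDimensional_holSections h k
    let f : holSections m L k →ₗ[ℂ] ℂ :=
      { toFun := fun t => powMetric h k w ν (t.1 w)
        map_add' := fun s t => by
          simp only [powMetric, Submodule.coe_add, Pi.add_apply, map_add]
          ring
        map_smul' := fun c t => by
          simp only [powMetric, Submodule.coe_smul, Pi.smul_apply, map_smul, smul_eq_mul,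
            RingHom.id_apply]
          ring }
    obtain ⟨Φ, hΦ⟩ := exists_inner_eq (l2Core h hpos k) f
    exact ⟨Φ.1, Φ.2, fun t ht => hΦ ⟨t, ht⟩⟩
  rw [bergmanKernel, dif_pos hex]
  exact hex.choose_spec

/-- On holomorphic sections the projection in the Toeplitz operator is superfluous. -/
theorem toeplitz_eq (hpos : IsPositive h) (hH : ContMDiff 𝓘(ℝ, Cm m) 𝓘(ℝ, ℝ) ∞ H)
    (hol : IsHolomorphicHamiltonian h H) (hk : k ≠ 0) (hs : s ∈ holSections m L k) :
    toeplitz h H s = prequantum h H s := by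
  have hQ := prequantum_mem h hpos hH hol hk hs
  -- The section `prequantum h H s` is its own projection; definiteness identifies it with the one
  -- that was chosen.
  have hex : ∃ p ∈ holSections m L k, ∀ t ∈ holSections m L k,
      l2 h t p = l2 h t (prequantum h H s) := ⟨_, hQ, fun _ _ => rfl⟩
  have h1 : toeplitz h H s = hex.choose := dif_pos hex
  obtain ⟨h2, h3⟩ := hex.choose_spec
  rw [h1]
  refine eq_of_l2_eq h hpos h2 hQ fun r hr => ?_
  rw [← l2_conj, h3 r hr, l2_conj]

end Bergman

end

end KahlerQuant

namespace KahlerQuant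

/-- A nonnegative solution of `v' = a v` with `a` eventually nonnegative that tends to `0` at
infinity vanishes. -/
theorem eq_zero_of_tendsto_zero {v a : ℝ → ℝ} (ha : Continuous a)
    (hv : ∀ t, HasDerivAt v (a t * v t) t) (h0 : ∀ t, 0 ≤ v t) (hev : ∀ᶠ t in atTop, 0 ≤ a t)
    (hlim : Tendsto v atTop (𝓝 0)) : v 0 = 0 := by
  obtain ⟨T₀, hT₀⟩ := eventually_atTop.1 hev
  set T := max T₀ 0 with hT
  have hvc : Continuous v := continuous_iff_continuousAt.2 fun t => (hv t).continuousAt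
  have hmono : MonotoneOn v (Set.Ici T) := by
    refine monotoneOn_of_deriv_nonneg (convex_Ici T) hvc.continuousOn
      (fun t _ => (hv t).differentiableAt.differentiableWithinAt) fun t ht => ?_
    rw [interior_Ici] at ht
    rw [(hv t).deriv]
    exact mul_nonneg (hT₀ t ((le_max_left _ _).trans ht.le)) (h0 t)
  -- Beyond `T` the function is nondecreasing with limit 0, so `v T ≤ 0`.
  have hvT : v T = 0 := by
    refine le_antisymm (ge_of_tendsto hlim ?_) (h0 T)
    filter_upwards [eventually_ge_atTop T] with t ht
    exact hmono Set.self_mem_Ici ht ht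
  obtain ⟨A, hA⟩ := (isCompact_Icc (a := (0 : ℝ)) (b := T)).exists_bound_of_continuousOn
    ha.continuousOn
  -- With |a| ≤ A on [0, T] the factor e^(At) makes the product nondecreasing there, so the zero at
  -- `T` forces `v 0 ≤ 0`.
  have hw : ∀ t, HasDerivAt (fun t => v t * Real.exp (A * t))
      ((a t + A) * v t * Real.exp (A * t)) t := by
    intro t
    have h1 : HasDerivAt (fun t => Real.exp (A * t)) (Real.exp (A * t) * A) t := by
      simpa using ((hasDerivAt_id t).const_mul A).exp
    refine ((hv t).mul h1).congr_deriv ?_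
    ring
  have hmono' : MonotoneOn (fun t => v t * Real.exp (A * t)) (Set.Icc 0 T) := by
    refine monotoneOn_of_deriv_nonneg (convex_Icc 0 T)
      (continuous_iff_continuousAt.2 fun t => (hw t).continuousAt).continuousOn
      (fun t _ => (hw t).differentiableAt.differentiableWithinAt) fun t ht => ?_
    rw [interior_Icc] at ht
    rw [(hw t).deriv]
    have h2 := abs_le.1 (hA t ⟨ht.1.le, ht.2.le⟩)
    exact mul_nonneg (mul_nonneg (by linarith [h2.1]) (h0 t)) (Real.exp_pos _).le
  have h3 := hmono' (Set.left_mem_Icc.2 (le_max_right _ _)) (Set.right_mem_Icc.2 (le_max_right _ _))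
    (le_max_right T₀ 0)
  dsimp only at h3
  rw [hvT] at h3
  simp only [mul_zero, Real.exp_zero, mul_one, zero_mul] at h3
  exact le_antisymm h3 (h0 0)

/-! ### Critical points and the gradient flow -/

section Main

variable {m : ℕ} {M : Type*} [TopologicalSpace M] [T2Space M] [CompactSpace M]
  [ChartedSpace (Cm m) M] [IsManifold 𝓘(ℂ, Cm m) ω M] [MeasurableSpace M] [BorelSpace M]
  {L : M → Type*} [∀ x, AddCommGroup (L x)] [∀ x, Module ℂ (L x)]
  [∀ x, TopologicalSpace (L x)] [TopologicalSpace (TotalSpace ℂ L)] [FiberBundle ℂ L]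
  [VectorBundle ℂ ℂ L] [ContMDiffVectorBundle ω ℂ L 𝓘(ℂ, Cm m)] {h : HermitianMetric m L}
  {H : M → ℝ} {k : ℕ} {s : PowSection L k}

/-- If ξ ≠ 0 then dH(Jξ) = ω(ξ, Jξ) > 0. -/
theorem hamVF_eq_zero (hpos : IsPositive h) {z : M}
    (hcrit : mfderiv 𝓘(ℝ, Cm m) 𝓘(ℝ, ℝ) H z = 0) : hamVF h H z = 0 := by
  by_contra hne
  have h1 := hpos z _ hne
  have h2 := hamVF_spec h hpos H z (J z (hamVF h H z))
  rw [hcrit] at h2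
  exact h1.ne' h2

/-- The connection term is linear in ξ, which vanishes at a critical point. -/
theorem prequantum_critical (hpos : IsPositive h) {z : M}
    (hcrit : mfderiv 𝓘(ℝ, Cm m) 𝓘(ℝ, ℝ) H z = 0) (hs : s ∈ holSections m L k) :
    prequantum h H s z = (H z : ℂ) • s z := by
  have h1 : chernDeriv h s z (hamVF h H z) = 0 := by
    rw [hamVF_eq_zero hpos hcrit]
    refine (chernDeriv_eq h hs z 0).trans ?_
    simp [del]
  rw [prequantum, h1, smul_zero, add_zero]

/-- The pointwise norm of an eigensection along an integral curve of the gradient. -/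
theorem hasDerivAt_powMetric_gradient (hk : k ≠ 0) (hs : s ∈ holSections m L k) {μ : ℝ}
    (heig : prequantum h H s = (μ : ℂ) • s) {γ : ℝ → M}
    (hγ : IsMIntegralCurve γ (fun x => gradVF h H x)) (t : ℝ) :
    HasDerivAt (fun t => (powMetric h k (γ t) (s (γ t)) (s (γ t))).re)
      (2 * k * (μ - H (γ t)) * (powMetric h k (γ t) (s (γ t)) (s (γ t))).re) t := by
  set x := γ t with hx
  set F : M → ℂ := fun x => powMetric h k x (s x) (s x) with hF
  have hk' : (k : ℂ) ≠ 0 := by exact_mod_cast hk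
  -- The eigenvalue equation gives (i/k)∇_ξ s = (μ - H)s; multiply by k and use ∇_{Jξ}s = i∇_ξ s.
  have h1 : chernDeriv h s x (gradVF h H x) = ((k * (μ - H x) : ℝ) : ℂ) • s x := by
    have h2 : chernDeriv h s x (gradVF h H x) = I • chernDeriv h s x (hamVF h H x) :=
      chernDeriv_J h hs x (hamVF h H x)
    have h3 : (H x : ℂ) • s x + (I / k) • chernDeriv h s x (hamVF h H x) = (μ : ℂ) • s x :=
      congrFun heig x
    have h4 : (I / k) • chernDeriv h s x (hamVF h H x) = ((μ : ℂ) - H x) • s x := by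
      rw [sub_smul, ← h3, add_sub_cancel_left]
    rw [h2, show I = (k : ℂ) * (I / k) by field_simp, mul_smul, h4, smul_smul]
    push_cast
    rfl
  have h5 : mfderiv 𝓘(ℝ, Cm m) 𝓘(ℝ, ℂ) F x (gradVF h H x) =
      ((2 * k * (μ - H x) * (F x).re : ℝ) : ℂ) := by
    refine (mfderiv_powMetric h hs hs x (gradVF h H x)).trans ?_
    have e1 : powMetric h k x (chernDeriv h s x (gradVF h H x)) (s x) =
        ((k * (μ - H x) : ℝ) : ℂ) * F x := by
      rw [h1]
      simp only [hF, powMetric, map_smul, smul_eq_mul, map_mul, Complex.conj_ofReal]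
      ring
    have e2 : powMetric h k x (s x) (chernDeriv h s x (gradVF h H x)) =
        ((k * (μ - H x) : ℝ) : ℂ) * F x := by
      rw [h1]
      simp only [hF, powMetric, map_smul, smul_eq_mul]
      ring
    have e3 : F x = ((F x).re : ℂ) := powMetric_self_ofReal h x (s x)
    have e4 : ((k * (μ - H x) : ℝ) : ℂ) * F x + ((k * (μ - H x) : ℝ) : ℂ) * F x =
        ((2 * k * (μ - H x) * (F x).re : ℝ) : ℂ) := by
      rw [e3, Complex.ofReal_re]
      push_cast
      ring
    exact (congrArg₂ (· + ·) e1 e2).trans e4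
  have h6 : HasMFDerivAt 𝓘(ℝ, Cm m) 𝓘(ℝ, ℂ) F (γ t) (mfderiv 𝓘(ℝ, Cm m) 𝓘(ℝ, ℂ) F (γ t)) :=
    (((contMDiff_powMetric h hs hs) (γ t)).mdifferentiableAt (by simp)).hasMFDerivAt
  let D : ℝ →L[ℝ] ℂ := (mfderiv 𝓘(ℝ, Cm m) 𝓘(ℝ, ℂ) F (γ t)).comp
    (ContinuousLinearMap.smulRight (1 : ℝ →L[ℝ] ℝ) (gradVF h H (γ t)))
  have h7 : HasFDerivAt (F ∘ γ) D t := (h6.comp t (hγ t)).hasFDerivAt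
  have h8 : HasDerivAt (F ∘ γ) ((2 * k * (μ - H x) * (F x).re : ℝ) : ℂ) t := by
    refine h7.hasDerivAt.congr_deriv (Eq.trans ?_ h5)
    change mfderiv 𝓘(ℝ, Cm m) 𝓘(ℝ, ℂ) F (γ t) ((1 : ℝ) • gradVF h H (γ t)) = _
    rw [one_smul]
  have h9 := Complex.reCLM.hasFDerivAt.comp_hasDerivAt t h8
  exact h9

end Main

end KahlerQuant

/-! ### The main theorem -/

open KahlerQuant in
theorem mainTheorem3 {m : ℕ} {M : Type*} [TopologicalSpace M] [T2Space M] [CompactSpace M]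
    [ChartedSpace (Cm m) M] [IsManifold 𝓘(ℂ, Cm m) ω M] [MeasurableSpace M] [BorelSpace M]
    (L : M → Type*) [∀ x, AddCommGroup (L x)] [∀ x, Module ℂ (L x)]
    [∀ x, TopologicalSpace (L x)] [TopologicalSpace (TotalSpace ℂ L)] [FiberBundle ℂ L]
    [VectorBundle ℂ ℂ L] [ContMDiffVectorBundle ω ℂ L 𝓘(ℂ, Cm m)]
    (h : HermitianMetric m L) (hpos : IsPositive h)
    (H : M → ℝ) (hH : ContMDiff 𝓘(ℝ, Cm m) 𝓘(ℝ, ℝ) ∞ H)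
    (hol : IsHolomorphicHamiltonian h H)
    (z_c : M) (hcrit : mfderiv 𝓘(ℝ, Cm m) 𝓘(ℝ, ℝ) H z_c = 0)
    (k : ℕ) (hk : 1 ≤ k) :
    (∀ ν : ⨂[ℂ]^k (L z_c), ν ≠ 0 →
      ((∃ t ∈ holSections m L k, t z_c ≠ 0) →
        l2 h (peakSection h z_c ν) (peakSection h z_c ν) = 1 ∧
        IsEigensection h H (peakSection h z_c ν) (H z_c)) ∧
      (∀ (s : PowSection L k) (μ : ℂ), IsEigensection h H s μ →
        l2 h (peakSection h z_c ν) s = 0 → s z_c = 0)) ∧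
    (∀ (s : PowSection L k) (μ : ℝ), IsEigensection h H s μ → μ < H z_c →
      ∀ z ∈ stablePlus h H z_c, s z = 0) ∧
    (∀ (s : PowSection L k) (μ : ℝ), IsEigensection h H s μ → H z_c < μ →
      ∀ z ∈ stableMinus h H z_c, s z = 0) := by
  have hk0 : k ≠ 0 := by omega
  have hpeak : ∀ ν : ⨂[ℂ]^k (L z_c), ν ≠ 0 → ∀ t ∈ holSections m L k, t z_c ≠ 0 →
      0 < (l2 h (bergmanKernel h z_c ν) (bergmanKernel h z_c ν)).re := by
    intro ν hν t ht htz
    obtain ⟨hΦ, hrep⟩ := bergmanKernel_spec h hpos z_c ν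
    -- If the kernel section were zero, the reproducing property would give h^k(ν, t(z_c)) = 0 with
    -- both entries nonzero, impossible in a one-dimensional fibre.
    refine (l2_self_nonneg h _).lt_of_ne fun h0 => ?_
    have h1 : l2 h (bergmanKernel h z_c ν) (bergmanKernel h z_c ν) = 0 := by
      rw [l2_self, Complex.ofReal_re] at h0
      rw [l2_self, ← h0, Complex.ofReal_zero]
    have h2 := hrep t ht
    rw [eq_zero_of_l2_self h hpos hΦ h1] at h2
    have h3 : l2 h (0 : PowSection L k) t = 0 := by
      rw [← zero_smul ℂ (0 : PowSection L k), l2_smul_left, map_zero, zero_mul]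
    rw [h3] at h2
    rcases powMetric_eq_zero h h2.symm with h4 | h4
    · exact hν h4
    · exact htz h4
  have heig : ∀ {s : PowSection L k} {μ : ℂ}, IsEigensection h H s μ →
      prequantum h H s = μ • s := fun hs => by
    rw [← toeplitz_eq h hpos hH hol hk0 hs.1]
    exact hs.2.2
  have hvanish : ∀ {s : PowSection L k} {μ : ℝ}, IsEigensection h H s μ → μ ≠ H z_c →
      s z_c = 0 := by
    intro s μ hs hμ
    -- Comparing the two values of (Qs)(z_c) gives (μ - E) s(z_c) = 0.
    have h1 := prequantum_critical hpos hcrit hs.1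
    rw [heig hs, Pi.smul_apply, ← sub_eq_zero, ← sub_smul, smul_eq_zero] at h1
    refine h1.resolve_left fun h2 => hμ ?_
    exact_mod_cast sub_eq_zero.1 h2
  have hlim : ∀ {s : PowSection L k} {μ : ℝ}, IsEigensection h H s μ → μ ≠ H z_c →
      Tendsto (fun x => (powMetric h k x (s x) (s x)).re) (𝓝 z_c) (𝓝 0) := by
    intro s μ hs hμ
    have h1 := (Complex.continuous_re.comp
      (contMDiff_powMetric h hs.1 hs.1).continuous).tendsto z_c
    have h2 : (powMetric h k z_c (s z_c) (s z_c)).re = 0 := by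
      rw [hvanish hs hμ]
      simp [powMetric]
    simp only [Function.comp_def] at h1
    rwa [h2] at h1
  have hcont : ∀ {γ : ℝ → M}, IsMIntegralCurve γ (fun x => gradVF h H x) → Continuous γ :=
    fun hγ => continuous_iff_continuousAt.2 fun t => (hγ t).continuousAt
  refine ⟨fun ν hν => ⟨?_, ?_⟩, ?_, ?_⟩
  · rintro ⟨t, ht, htz⟩
    obtain ⟨hΦ, hrep⟩ := bergmanKernel_spec h hpos z_c ν
    have hn := hpeak ν hν t ht htz
    set Φ := bergmanKernel h z_c ν with hΦd
    set n := (l2 h Φ Φ).re with hnd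
    have hp : peakSection h z_c ν = (((Real.sqrt n)⁻¹ : ℝ) : ℂ) • Φ := rfl
    have hmem : peakSection h z_c ν ∈ holSections m L k := by
      rw [hp]; exact (holSections m L k).smul_mem _ hΦ
    have hone : l2 h (peakSection h z_c ν) (peakSection h z_c ν) = 1 := by
      have h1 : l2 h Φ Φ = (n : ℂ) := by
        rw [hnd, l2_self, Complex.ofReal_re]
      rw [hp, l2_smul_left, l2_smul_right, h1, Complex.conj_ofReal, ← Complex.ofReal_mul,
        ← Complex.ofReal_mul]
      have h2 := Real.mul_self_sqrt hn.le
      have h3 := (Real.sqrt_pos.2 hn).ne'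
      rw [show (Real.sqrt n)⁻¹ * ((Real.sqrt n)⁻¹ * n) = 1 by
        field_simp
        linarith]
      simp
    refine ⟨hone, hmem, fun h0 => ?_, ?_⟩
    · rw [h0, ← zero_smul ℂ (0 : PowSection L k), l2_smul_left, map_zero, zero_mul] at hone
      exact zero_ne_one hone
    · rw [toeplitz_eq h hpos hH hol hk0 hmem]
      -- Tested against r: symmetry moves the operator onto r, the reproducing property evaluates at
      -- z_c, and there the operator is multiplication by the real number E.
      refine eq_of_l2_eq h hpos (prequantum_mem h hpos hH hol hk0 hmem)
        ((holSections m L k).smul_mem _ hmem) fun r hr => ?_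
      have h1 := prequantum_critical hpos hcrit hr
      rw [← l2_prequantum h hpos hH hol hk0 hmem hr, l2_smul_left, hp, l2_smul_left, l2_smul_left,
        hrep _ (prequantum_mem h hpos hH hol hk0 hr), hrep _ hr, h1]
      simp only [powMetric, map_smul, smul_eq_mul, Complex.conj_ofReal]
      ring
  · intro s μ hs horth
    by_contra hsz
    obtain ⟨-, hrep⟩ := bergmanKernel_spec h hpos z_c ν
    -- If s(z_c) ≠ 0, then s itself witnesses that the kernel section is nonzero, so the normalizing
    -- constant can be cancelled; the convention for a vanishing kernel never enters.
    have hn := hpeak ν hν s hs.1 hsz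
    have h3 := (Real.sqrt_pos.2 hn).ne'
    rw [peakSection, l2_smul_left, hrep s hs.1, Complex.conj_ofReal, mul_eq_zero,
      Complex.ofReal_eq_zero, or_iff_right (inv_ne_zero h3)] at horth
    rcases powMetric_eq_zero h horth with h4 | h4
    · exact hν h4
    · exact hsz h4
  · rintro s μ hs hμ z ⟨γ, hγ, rfl, hγlim⟩
    have hd := hasDerivAt_powMetric_gradient hk0 hs.1 (heig hs) hγ
    -- Reversing time changes the coefficient to 2k(H - μ), which is eventually positive because H
    -- tends to E > μ along the curve.
    have hv : ∀ t, HasDerivAt (fun t => (powMetric h k (γ (-t)) (s (γ (-t))) (s (γ (-t)))).re)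
        (2 * k * (H (γ (-t)) - μ) * (powMetric h k (γ (-t)) (s (γ (-t))) (s (γ (-t)))).re) t := by
      intro t
      refine ((hd (-t)).comp t (hasDerivAt_neg t)).congr_deriv ?_
      ring
    have h1 := eq_zero_of_tendsto_zero
      (a := fun t => 2 * k * (H (γ (-t)) - μ))
      (continuous_const.mul ((hH.continuous.comp
        ((hcont hγ).comp continuous_neg)).sub continuous_const)) hv
      (fun t => powMetric_self_nonneg h _ _) ?_ ((hlim hs hμ.ne).comp hγlim)
    · rw [neg_zero] at h1
      exact powMetric_self_re_eq_zero h h1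
    · filter_upwards [((hH.continuous.tendsto z_c).comp hγlim).eventually (lt_mem_nhds hμ)] with t ht
      have : 0 ≤ H (γ (-t)) - μ := sub_nonneg.2 (le_of_lt ht)
      positivity
  · rintro s μ hs hμ z ⟨γ, hγ, rfl, hγlim⟩
    have h1 := eq_zero_of_tendsto_zero
      (a := fun t => 2 * k * (μ - H (γ t)))
      (continuous_const.mul (continuous_const.sub (hH.continuous.comp (hcont hγ))))
      (hasDerivAt_powMetric_gradient hk0 hs.1 (heig hs) hγ)
      (fun t => powMetric_self_nonneg h _ _) ?_ ((hlim hs hμ.ne').comp hγlim)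
    · exact powMetric_self_re_eq_zero h h1
    · filter_upwards [((hH.continuous.tendsto z_c).comp hγlim).eventually (gt_mem_nhds hμ)] with t ht
      have : 0 ≤ μ - H (γ t) := sub_nonneg.2 (le_of_lt ht)
      positivity
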